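/- **Setting.** Let $q_1,q_2,q_3$ be the vertices of an equilateral triangle in the plane, let $q_4,q_5$ be the midpoints of $\overline{q_1q_2}$ and $\overline{q_1q_3}$, and put $F_2(x)=\frac12x+\frac12q_2$ and $F_i(x)=\frac13x+\frac23q_i$ for $i=1,3,4,5$. The overlapping gasket with open bottom $K_1=\mathcal{SG}^o$ is the nonempty compact set with $K_1=\bigcup_{i=1}^5F_iK_1$. Put $K_2=(K_1\setminus F_2K_1)\cup\{F_2q_1\}$. Then $$K_1=\psi_1K_1\cup\psi_2K_2,\qquad K_2=\psi_3K_1\cup\psi_4K_1\cup\psi_5K_1\cup\psi_6K_2,$$ $$\psi_1=F_2,\ \psi_2=\mathrm{id},\ \psi_3=F_1,\ \psi_4=F_3,\ \psi_5=F_5,\ \psi_6=F_4 .$$ Let $G$ be the directed graph with states $1,2$ and edges $e_1:1\to1$, $e_2:1\to2$, $e_3,e_4,e_5:2\to1$, $e_6:2\to2$. For a finite (possibly empty) walk $w=e_{i_1}\cdots e_{i_n}$ in $G$ starting at state $1$, with final state $f(w)$, write $\psi_w=\psi_{i_1}\circ\cdots\circ\psi_{i_n}$ and $K_w=\psi_wK_{f(w)}$.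 The sets $K_w$ are the *islands*; the *children* of $w$ are the walks $we$, its *ancestors* are its proper initial segments, and for two walks whose islands are similar we put $\phi_{w,w'}=\psi_{w'}\circ\psi_w^{-1}$. Let $C_w$ be the union of $K_\beta\cap K_{\beta'}$ over pairs of distinct children $\beta,\beta'$ of $w$. The *boundary* of $K_w$ is the union of the sets $\phi_{w',w}\big(K_{w'}\cap\bigcup_\gamma C_\gamma\big)$, where $w'$ runs over the nonempty walks whose island is similar to $K_w$ and $\gamma$ over the ancestors of $w'$. Let $V_1,V_2$ be the boundaries of $K_1$ and $K_2$ (the islands of the empty walk and of the walk $e_2$). The islands form a *nested structure* if they are countably many, distinct, compact, connected and not singletons, every island is the union of its children, of which there are finitely many and at least two, and every $w$ other than the root descends from the root. It is *finitely ramified of finite type (f.r.f.t.)* if in addition there are finitely many similarity classes of islands, the $\phi$'s are a coherent choice of similitudes between similar islands ($\phi_{\alpha,\beta}K_\alpha=K_\beta$, $\phi_{\alpha,\alpha}=\mathrm{id}$, $\phi_{\gamma,\beta}\circ\phi_{\alpha,\gamma}=\phi_{\alpha,\beta}$), similar islands are split alike (if $K_\alpha,K_{\alpha'}$ are similar, then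 for each child $\beta$ of $\alpha$ there is exactly one child $\beta'$ of $\alpha'$ with $K_\beta,K_{\beta'}$ similar and $\phi_{\beta,\beta'}=\phi_{\alpha,\alpha'}$), and all boundaries are finite. A *Laplacian* on a finite set $V$ is a symmetric, non-positive definite real matrix $H$ on $V$ with $Hu=0$ exactly for constant $u$ and $H_{xy}\ge0$ for $x\ne y$; its form is $\mathcal E_H(u)=-\sum_xu(x)(Hu)(x)$. A *harmonic structure* is a pair $(D,\mathbf r)$ of Laplacians $D_i$ on $V_i$ ($i=1,2$) and positive numbers $r_1,\dots,r_6$ such that, for $i=1,2$ and every $v:V_i\to\mathbb R$, $$\mathcal E_{D_i}(v)=\min_u\ \sum_{e_k:\,i\to j}r_k^{-1}\,\mathcal E_{D_j}\big(u\circ\psi_k|_{V_j}\big),$$ the sum being over the edges starting at $i$ and the minimum over all real functions $u$ on $\bigcup_{e_k:\,i\to j}\psi_kV_j$ with $u|_{V_i}=v$. It is *regular* if the product $r_w$ of the factors along $w$ is $<1$ for every cycle $w$ of $G$, and *homogeneous* if $r_w=r_{w'}$ for any two walks $w,w'$ from state $1$ whose islands are similar and for which $\phi_{w,w'}$ is an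 isometry. For a three-point set $V$ and numbers $R_x>0$ ($x\in V$), the *$Y$-shaped network with resistances $R_x$* is the Laplacian on $V$ with $H_{xy}=R_x^{-1}R_y^{-1}\big/\sum_{z\in V}R_z^{-1}$ for $x\neq y$ and zero row sums. Call $(D,\mathbf r)$ *normalized* if $r_2=1$ and $D_1$ is a $Y$-shaped network with resistance $1$ at $q_1$ and some positive resistances at $q_2,q_3$. **Theorem.** The islands $K_w$ form an f.r.f.t. nested structure, $V_1=\{q_1,q_2,q_3\}$ and $V_2=\{q_1,q_3,q_4\}$. For $a'>2$ put $$b'=d'=\frac{2+3a'}{a'-2},\quad e'=\frac1{2a'}+\frac14+\frac{a'}4,\quad f'=1,\quad s=\frac{2+a'}{4+3a'},\quad r_1=\frac{-2-a'+3a'^2}{4a'+4a'^2}.$$ 1. The map which sends $a'$ to the pair $(D,\mathbf r)$, where $D_1$ is the $Y$-shaped network with resistances $1,a',b'$ at $q_1,q_2,q_3$, $D_2$ is the $Y$-shaped network with resistances $f',e',d'$ at $q_1,q_4,q_3$, and $\mathbf r=(r_1,1,s,s,s,s)$, is a bijection from $(2,\infty)$ onto the set of all normalized homogeneous regular harmonic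 structures. 2. Without the normalization: the map which sends $(a',c,t)$ to the pair $(D,\mathbf r)$, where $D_1$ is the $Y$-shaped network with resistances $c,ca',cb'$ at $q_1,q_2,q_3$, $D_2$ is the $Y$-shaped network with resistances $cf'/t,ce'/t,cd'/t$ at $q_1,q_4,q_3$, and $\mathbf r=(r_1,t,s/t,s/t,s/t,s)$, is a bijection from $(2,\infty)\times(0,\infty)\times(0,\infty)$ onto the set of all homogeneous regular harmonic structures. -/

import Mathlib

/-! ### Nested structures on a metric space -/

/-- The data of a nested structure: an index set, the islands, the root, the
finite sets of children, and the chosen similitudes between similar islands. -/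
structure NestedStructure (X : Type) [MetricSpace X] where
  /-- the index set `Λ` -/
  Idx : Type
  /-- the islands `K_α` -/
  island : Idx → Set X
  /-- the root `ϑ`; the set carrying the structure is `island root` -/
  root : Idx
  /-- the set `Λ_α` of children of `α` -/
  children : Idx → Set Idx
  /-- the chosen similitudes `φ_{α,β}` (only used for similar `K_α`, `K_β`) -/
  phi : Idx → Idx → X ≃ᵈ X

namespace NestedStructure

variable {X : Type} [MetricSpace X] (N : NestedStructure X)

/-- `γ` is an ancestor of `β`, that is, `γ ∈ P^n(β)` for some `n ≥ 1`. -/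
def IsAncestor (γ β : N.Idx) : Prop :=
  Relation.TransGen (fun a b => b ∈ N.children a) γ β

/-- The laws of a nested structure. -/
structure IsNested : Prop where
  countable : Countable N.Idx
  distinct : Function.Injective N.island
  compact : ∀ α, IsCompact (N.island α)
  connected : ∀ α, IsConnected (N.island α)
  nontrivial : ∀ α, (N.island α).Nontrivial
  children_finite : ∀ α, (N.children α).Finite
  two_le_children : ∀ α, 2 ≤ (N.children α).ncard
  island_eq : ∀ α, N.island α = ⋃ β ∈ N.children α, N.island β
  offspring : ∀ α, α ≠ N.root → N.IsAncestor N.root α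

/-- `α ∼ β`: some similitude maps `K_α` onto `K_β`. -/
def Similar (α β : N.Idx) : Prop :=
  ∃ f : X ≃ᵈ X, f '' N.island α = N.island β

/-- `C_α`: the points lying in two different children of `K_α`. -/
def crossing (α : N.Idx) : Set X :=
  ⋃ β ∈ N.children α, ⋃ β' ∈ N.children α, ⋃ (_ : β ≠ β'), N.island β ∩ N.island β'

/-- `V_α`: the boundary of the island `K_α`. -/
def boundary (α : N.Idx) : Set X :=
  ⋃ β, ⋃ (_ : N.Similar β α), ⋃ (_ : β ≠ N.root),
    N.phi β α '' (N.island β ∩ ⋃ γ, ⋃ (_ : N.IsAncestor γ β), N.crossing γ)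

/-- A nested structure is finitely ramified of finite type. -/
structure IsFRFT : Prop where
  nested : N.IsNested
  /-- the `φ_{α,β}` are a coherent choice of similitudes -/
  phi_image : ∀ α β, N.Similar α β → N.phi α β '' N.island α = N.island β
  phi_self : ∀ α, N.phi α α = 1
  phi_comp : ∀ α β γ, N.Similar α γ → N.Similar γ β → N.phi γ β * N.phi α γ = N.phi α β
  /-- there are finitely many types of islands -/
  finite_types : (Set.range fun α => {β | N.Similar α β}).Finite
  /-- similar islands are split in the same way; exchanging `α` and `α'` shows that
  `β ↦ β'` is a one-to-one correspondence -/
  same_split : ∀ α α', N.Similar α α' → ∀ β ∈ N.children α,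
    ∃! β', β' ∈ N.children α' ∧ N.Similar β β' ∧ N.phi β β' = N.phi α α'
  /-- all boundaries are finite -/
  finite_boundary : ∀ α, (N.boundary α).Finite

end NestedStructure

/-! ### Laplacians on finite sets -/

/-- The bilinear form `E_H(u,v) = -∑ x, u(x) (Hv)(x)` of a matrix on a (finite) set. -/
noncomputable def discreteForm {V : Type} (H : Matrix V V ℝ) (u v : V → ℝ) : ℝ :=
  -∑ᶠ x, u x * ∑ᶠ y, H x y * v y

/-- `H` is a (discrete) Laplacian on the finite set `V`. -/
structure IsLaplacian {V : Type} (H : Matrix V V ℝ) : Prop where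
  finite : Finite V
  symm : H.IsSymm
  nonneg_form : ∀ u : V → ℝ, 0 ≤ discreteForm H u u
  ker : ∀ u : V → ℝ, (∀ x, ∑ᶠ y, H x y * u y = 0) ↔ ∃ c, ∀ x, u x = c
  offdiag_nonneg : ∀ x y, x ≠ y → 0 ≤ H x y

/-- The Laplacian on the finite set `V` of the star (`Y`-shaped) network joining every point `x`
of `V` to one additional centre through a resistor of resistance `R x`, after the centre has been
eliminated: the conductance between `x ≠ y` is `R(x)⁻¹ R(y)⁻¹ / ∑ z, R(z)⁻¹`. -/
noncomputable def starLaplacian {X : Type} (V : Set X) (R : X → ℝ) : Matrix V V ℝ :=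
  open Classical in
  fun x y => (R x)⁻¹ * (R y)⁻¹ / (∑ᶠ z : V, (R z)⁻¹) - if x = y then (R x)⁻¹ else 0

/-! ### Graph-directed constructions, their nested structures and harmonic structures -/

/-- A directed graph with state set `S` and edge set `E`, a similitude `ψ_e` for every edge,
a set `K_s` for every state, and an initial state. For every state `s` the walk `rep s` from the
initial state to `s` names the island `K_{α_s}` chosen to represent the islands of type `s`. -/
structure GraphDirected (X S E : Type) [MetricSpace X] where
  start : S
  init : E → S
  fin : E → S
  sim : E → X ≃ᵈ X
  K : S → Set X
  rep : S → List E

namespace GraphDirected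

variable {X S E : Type} [MetricSpace X] (G : GraphDirected X S E)

/-- A finite, possibly empty, walk starting at the state `s`. -/
def IsWalk : S → List E → Prop
  | _, [] => True
  | s, e :: w => G.init e = s ∧ IsWalk (G.fin e) w

/-- The final state of a walk starting at `s`. -/
def endState : S → List E → S
  | s, [] => s
  | _, e :: w => endState (G.fin e) w

/-- `ψ_w = ψ_{e₁} ∘ ⋯ ∘ ψ_{eₙ}`. -/
noncomputable def walkSim (w : List E) : X ≃ᵈ X := (w.map G.sim).prod

/-- The nested structure whose indices are the walks from the initial state. The island of a walk
`w` is `ψ_w K_{f(w)}`, its children are the walks `we`, and `φ_{w,w'} = ψ_{w'} ∘ ψ_w⁻¹`. -/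
noncomputable def nested : NestedStructure X where
  Idx := {w : List E // G.IsWalk G.start w}
  island w := G.walkSim w.1 '' G.K (G.endState G.start w.1)
  root := ⟨[], trivial⟩
  children w := {w' | ∃ e, w'.1 = w.1 ++ [e]}
  phi w w' := G.walkSim w'.1 * (G.walkSim w.1)⁻¹

/-- `V_{α_s}`: the boundary of the representative island of type `s`. -/
def boundary (s : S) : Set X :=
  ⋃ h : G.IsWalk G.start (G.rep s), G.nested.boundary ⟨G.rep s, h⟩

/-- A family of matrices, one on each of the sets `V_{α_s}`. -/
abbrev MatrixFamily : Type := ∀ s, Matrix (G.boundary s) (G.boundary s) ℝ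

/-- The form `E_{α_s,0}` of `D_{α_s}`, evaluated at (the restriction of) a function on `X`. -/
noncomputable def form0 (D : G.MatrixFamily) (s : S) (u : X → ℝ) : ℝ :=
  discreteForm (D s) (fun x => u x) (fun x => u x)

open Classical in
/-- The form `E_{α_s,1}(u) = ∑ r_e⁻¹ E_{α_{f(e)},0}(u ∘ ψ_e)`, summed over the edges `e` leaving
`s`. It depends only on the restriction of `u` to `V_{α_s,1} = ⋃ ψ_e V_{α_{f(e)}}`. -/
noncomputable def form1 [Fintype E] (D : G.MatrixFamily) (r : E → ℝ) (s : S) (u : X → ℝ) : ℝ :=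
  ∑ e with G.init e = s, (r e)⁻¹ * G.form0 D (G.fin e) (u ∘ G.sim e)

/-- `(D, r)` is a harmonic structure: the `D_{α_s}` are Laplacians, the `r_e` are positive, and
`(V_{α_s}, D_{α_s}) ≤ (V_{α_s,1}, H_{α_s,1})` for every `s`, that is, `E_{α_s,0}(v)` is the minimum
of `E_{α_s,1}(u)` over all `u` with `u = v` on `V_{α_s}`. -/
structure IsHarmonic [Fintype E] (D : G.MatrixFamily) (r : E → ℝ) : Prop where
  laplacian : ∀ s, IsLaplacian (D s)
  pos : ∀ e, 0 < r e
  renormalization : ∀ s, ∀ v : G.boundary s → ℝ,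
    IsLeast {t | ∃ u : X → ℝ, (∀ x : G.boundary s, u x = v x) ∧ G.form1 D r s u = t}
      (discreteForm (D s) v v)

/-- Regularity: `r_w < 1` for every cycle `w` of the graph. -/
def IsRegular (r : E → ℝ) : Prop :=
  ∀ s, ∀ w : List E, w ≠ [] → G.IsWalk s w → G.endState s w = s → (w.map r).prod < 1

/-- Homogeneity: islands of the same type and the same size (the similitude `φ` between them is
an isometry) have the same factor `r_w`. -/
def IsHomogeneous (r : E → ℝ) : Prop :=
  ∀ w w' : G.nested.Idx, G.nested.Similar w w' → Isometry (G.nested.phi w w') →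
    (w.1.map r).prod = (w'.1.map r).prod

end GraphDirected

/-! ### Invariant sets of iterated function systems -/

/-- The invariant set of an iterated function system `f`: the nonempty compact set `K` with
`K = ⋃ i, f i K`. For contractions of a complete space there is exactly one such set
(`existsUnique_invariant`), so that the union below has only one member. -/
def invariantSet {X ι : Type} [MetricSpace X] (f : ι → X → X) : Set X :=
  ⋃₀ {K | K.Nonempty ∧ IsCompact K ∧ K = ⋃ i, f i '' K}

theorem existsUnique_invariant {X ι : Type} [MetricSpace X] [CompleteSpace X] [Nonempty X]
    [Finite ι] [Nonempty ι] {c : NNReal} (f : ι → X → X) (hf : ∀ i, ContractingWith c (f i)) :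
    ∃! K : Set X, K.Nonempty ∧ IsCompact K ∧ K = ⋃ i, f i '' K := by
  classical
  open TopologicalSpace in
  have hcont : ∀ i, Continuous (f i) := fun i => (hf i).2.continuous
  have hcomp : ∀ A : Set X, IsCompact A → IsCompact (⋃ i, f i '' A) := fun A hA =>
    isCompact_iUnion fun i => hA.image (hcont i)
  have hne : ∀ A : Set X, A.Nonempty → (⋃ i, f i '' A).Nonempty := fun A hA => by
    obtain ⟨x, hx⟩ := hA
    obtain ⟨i⟩ := ‹Nonempty ι›
    exact ⟨f i x, Set.mem_iUnion.2 ⟨i, x, hx, rfl⟩⟩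
  let Φ : NonemptyCompacts X → NonemptyCompacts X := fun A =>
    ⟨⟨⋃ i, f i '' (A : Set X), hcomp _ A.isCompact⟩, hne _ A.nonempty⟩
  have hΦ : ContractingWith c Φ := by
    obtain ⟨i₀⟩ := ‹Nonempty ι›
    refine ⟨(hf i₀).1, fun A B => ?_⟩
    change Metric.hausdorffEDist (⋃ i, f i '' (A : Set X)) (⋃ i, f i '' (B : Set X)) ≤
      c * Metric.hausdorffEDist (A : Set X) (B : Set X)
    refine Metric.hausdorffEDist_iUnion_le.trans (iSup_le fun i => ?_)
    have key : ∀ A B : NonemptyCompacts X, ∀ x ∈ f i '' (A : Set X),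
        ∃ y ∈ f i '' (B : Set X), edist x y ≤ c * Metric.hausdorffEDist (A : Set X) (B : Set X) := by
      rintro A B _ ⟨x, hx, rfl⟩
      obtain ⟨y, hy, hxy⟩ := B.isCompact.exists_infEDist_eq_edist B.nonempty x
      refine ⟨f i y, ⟨y, hy, rfl⟩, ((hf i).2 x y).trans ?_⟩
      gcongr
      rw [← hxy]
      exact Metric.infEDist_le_hausdorffEDist_of_mem hx
    refine Metric.hausdorffEDist_le_of_mem_edist (key A B) ?_
    rw [Metric.hausdorffEDist_comm]
    exact key B A
  obtain ⟨x₀⟩ := ‹Nonempty X›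
  have : Nonempty (NonemptyCompacts X) := ⟨⟨⟨{x₀}, isCompact_singleton⟩, Set.singleton_nonempty x₀⟩⟩
  have hfix : Function.IsFixedPt Φ (hΦ.fixedPoint) := hΦ.fixedPoint_isFixedPt
  refine ⟨(hΦ.fixedPoint : Set X), ⟨NonemptyCompacts.nonempty _, NonemptyCompacts.isCompact _, ?_⟩, ?_⟩
  · exact (congrArg (fun A : NonemptyCompacts X => (A : Set X)) hfix).symm
  · rintro K ⟨h1, h2, h3⟩
    have : Function.IsFixedPt Φ ⟨⟨K, h2⟩, h1⟩ := by
      apply NonemptyCompacts.ext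
      exact h3.symm
    exact congrArg (fun A : NonemptyCompacts X => (A : Set X)) (hΦ.fixedPoint_unique this)

theorem invariantSet_spec {X ι : Type} [MetricSpace X] [CompleteSpace X] [Nonempty X]
    [Finite ι] [Nonempty ι] {c : NNReal} (f : ι → X → X) (hf : ∀ i, ContractingWith c (f i)) :
    (invariantSet f).Nonempty ∧ IsCompact (invariantSet f) ∧
      invariantSet f = ⋃ i, f i '' invariantSet f := by
  obtain ⟨K, hK, huniq⟩ := existsUnique_invariant f hf
  have : invariantSet f = K := by
    refine (congrArg Set.sUnion (Set.ext fun A => ⟨fun hA => huniq A hA, ?_⟩)).trans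
      (Set.sUnion_singleton K)
    rintro rfl
    exact hK
  rw [this]
  exact hK

/-! ### The overlapping gasket with open bottom -/

/-- The Euclidean plane. -/
abbrev Plane : Type := EuclideanSpace ℝ (Fin 2)

/-- The similitude `x ↦ k x + (1 - k) q` with centre `q` and ratio `k ≠ 0`. -/
noncomputable def homothety (q : Plane) (k : ℝ) (hk : k ≠ 0) : Plane ≃ᵈ Plane where
  toFun x := k • x + (1 - k) • q
  invFun y := k⁻¹ • (y - (1 - k) • q)
  left_inv x := by simp [smul_smul, hk]
  right_inv y := by simp [smul_smul, hk]
  edist_eq' := ⟨‖k‖₊, by simpa using hk, fun x y => by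
    rw [edist_add_right, edist_smul₀, ENNReal.smul_def, smul_eq_mul]⟩

namespace OpenGasket

/-- The points `q₁, q₂, q₃` (the vertices) and `q₄, q₅` (the midpoints of `q₁q₂` and `q₁q₃`). -/
noncomputable def q (T : Affine.Triangle ℝ Plane) : Fin 5 → Plane :=
  ![T.points 0, T.points 1, T.points 2,
    midpoint ℝ (T.points 0) (T.points 1), midpoint ℝ (T.points 0) (T.points 2)]

/-- The contraction ratios of `F₁, …, F₅`. -/
noncomputable def ratio : Fin 5 → ℝ := ![1 / 3, 1 / 2, 1 / 3, 1 / 3, 1 / 3]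

theorem ratio_ne_zero (i : Fin 5) : ratio i ≠ 0 := by
  fin_cases i <;> norm_num [ratio]

/-- The similitudes `F₁, …, F₅`, indexed from zero. -/
noncomputable def F (T : Affine.Triangle ℝ Plane) (i : Fin 5) : Plane ≃ᵈ Plane :=
  homothety (q T i) (ratio i) (ratio_ne_zero i)

/-- The gasket `K₁` is the invariant set of `F₁, …, F₅`, and `K₂ = (K₁ ∖ F₂K₁) ∪ {F₂q₁}`. -/
noncomputable def K (T : Affine.Triangle ℝ Plane) : Fin 2 → Set Plane :=
  let K₁ := invariantSet fun i => F T i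
  ![K₁, (K₁ \ F T 1 '' K₁) ∪ {F T 1 (q T 0)}]

/-- The graph-directed construction `K₁ = F₂K₁ ∪ K₂`, `K₂ = F₁K₁ ∪ F₃K₁ ∪ F₅K₁ ∪ F₄K₂`, with states
`0` (for `K₁`) and `1` (for `K₂`) and edges `0, …, 5` carrying the similitudes
`F₂, id, F₁, F₃, F₅, F₄`. The types are represented by `K₁` and `K₂` themselves. -/
noncomputable def graph (T : Affine.Triangle ℝ Plane) : GraphDirected Plane (Fin 2) (Fin 6) where
  start := 0
  init := ![0, 0, 1, 1, 1, 1]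
  fin := ![0, 1, 0, 0, 0, 1]
  sim := ![F T 1, 1, F T 0, F T 2, F T 4, F T 3]
  K := K T
  rep := ![[], [1]]

/-- Resistances on `K₁`: `x₁` at `q₁`, `x₂` at `q₂`, and `x₃` at the remaining point `q₃`. -/
noncomputable def legs₁ (T : Affine.Triangle ℝ Plane) (x₁ x₂ x₃ : ℝ) (x : Plane) : ℝ :=
  open Classical in
  if x = q T 0 then x₁ else if x = q T 1 then x₂ else x₃

/-- Resistances on `K₂`: `x₁` at `q₁`, `x₄` at `q₄`, and `x₃` at the remaining point `q₃`. -/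
noncomputable def legs₂ (T : Affine.Triangle ℝ Plane) (x₁ x₄ x₃ : ℝ) (x : Plane) : ℝ :=
  open Classical in
  if x = q T 0 then x₁ else if x = q T 3 then x₄ else x₃

/-- The explicit Laplacians and renormalization factors. Here `a` is the resistance `a'`, while the
scale `c` is the resistance at `q₁` in the `Y`-network of `K₁`, and `t` is the factor of the edge
from `K₁` to `K₂`. The normalization is `c = t = 1`. -/
noncomputable def solution (T : Affine.Triangle ℝ Plane) (a c t : ℝ) :
    (graph T).MatrixFamily × (Fin 6 → ℝ) :=
  let b := (2 + 3 * a) / (a - 2)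
  let d := b
  let e := 1 / (2 * a) + 1 / 4 + a / 4
  let f := 1
  let s := (2 + a) / (4 + 3 * a)
  let r₁ := (-2 - a + 3 * a ^ 2) / (4 * a + 4 * a ^ 2)
  (Fin.cons (starLaplacian ((graph T).boundary 0) (legs₁ T c (c * a) (c * b)))
    (Fin.cons (starLaplacian ((graph T).boundary 1) (legs₂ T (c * f / t) (c * e / t) (c * d / t)))
      finZeroElim),
    ![r₁, t, s / t, s / t, s / t, s])

/-- `(D, r)` is a homogeneous regular harmonic structure of the gasket. -/
def IsHomogeneousRegular (T : Affine.Triangle ℝ Plane)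
    (h : (graph T).MatrixFamily × (Fin 6 → ℝ)) : Prop :=
  (graph T).IsHarmonic h.1 h.2 ∧ (graph T).IsRegular h.2 ∧ (graph T).IsHomogeneous h.2

/-- The normalization of `(D, r)`: the factor of the edge from `K₁` to `K₂` with `ψ = id` is `1`, and
the `Y`-shaped network of `K₁` has resistance `1` at `q₁`. -/
def IsNormalized (T : Affine.Triangle ℝ Plane)
    (h : (graph T).MatrixFamily × (Fin 6 → ℝ)) : Prop :=
  h.2 1 = 1 ∧ ∃ x₂ x₃ : ℝ, 0 < x₂ ∧ 0 < x₃ ∧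
    h.1 0 = starLaplacian ((graph T).boundary 0) (legs₁ T 1 x₂ x₃)

end OpenGasket

/-! Points, maps and edges are numbered from one in this overview and from zero in the code.

Geometry. In barycentric coordinates every Fᵢ acts coordinatewise, so questions about positions
become linear inequalities. The overlap relation F₄F₂ = F₂F₁ makes F₄ preserve F₂K₁, and F₂K₁ turns
out to be the part of K₁ whose second coordinate is at least 1/2 (`mem_image_F_one`): a
counterexample would be the F₄-image of another counterexample, hence equal to the fixed point q₄,
which is none. This yields the splittings of K₁ and K₂, and sibling pieces meet in at most one point
(`piece_inter`). K₁ and K₂ have equal diameter, but only K₁ contains three points at that mutual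
distance, so they are not similar (`not_similar`). Hence the type of an island is the final state of
its walk, and the boundaries are found by following the finitely many crossing points down the walks
(`boundary_subset`).

Analysis. A Laplacian on three points is a Y-network with nonnegative resistances, at most one of
them zero (`IsLaplacian.exists_resistances`). The minimum condition is equivalent to Euler–Lagrange
equations (`isLeast_energy_iff`), which become Kirchhoff's node law once potentials are expressed
through currents (`Admissible.exists_current`). For K₁ the star of F₂K₁ hangs in series on the
q₄-leg of the star of K₂ (`series_network_iff`). For K₂ three stars form a ring with a fourth one in
series towards q₃, and the triangle-star transformation applies (`ring_network_iff`).

Since the numbers 2⁻ⁿ3⁻ᵐ are distinct, homogeneity amounts to three equations which leave three free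
factors (`isHomogeneous_iff`). Six resistances and three factors satisfy six equations, so a
three-parameter family (a', c, t) is expected. Eliminating s gives b'(a' - 2) = 3a' + 2, which
forces a' > 2; everything else is then rational in a' (`renormalization_equations_iff`). For a' > 2
both r₁ and s are below one, and the factor of a cycle is r₁ⁿsᵐ with n + m > 0, so the structure is
regular. The parameters are recovered as t = r₂, a' from s, and c as the resistance at q₁. -/

/-! ### Self-referential subsets and connectedness -/

/-- A bounded set which lies in its image under a map contracting towards `p` is at most `{p}`. -/
theorem subset_singleton_of_subset_image {X : Type} [MetricSpace X] {f : X → X} {p : X} {k : ℝ}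
    (hk0 : 0 ≤ k) (hk : k < 1) (hf : ∀ x, dist (f x) p = k * dist x p) {B : Set X}
    (hB : Bornology.IsBounded B) (h : B ⊆ f '' B) : B ⊆ {p} := by
  obtain ⟨M, hM⟩ := hB.subset_closedBall p
  -- Every point of `B` is the image of a point of `B`, so the inclusion can be iterated, gaining a
  -- factor `k` each time.
  have key : ∀ n : ℕ, ∀ x ∈ B, dist x p ≤ k ^ n * M := by
    intro n
    induction n with
    | zero => intro x hx; simpa using hM hx
    | succ n ih =>
      intro x hx
      obtain ⟨y, hy, rfl⟩ := h hx
      rw [hf, pow_succ', mul_assoc]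
      exact mul_le_mul_of_nonneg_left (ih y hy) hk0
  intro x hx
  have hlim : Filter.Tendsto (fun n : ℕ => k ^ n * M) Filter.atTop (nhds 0) := by
    simpa using (tendsto_pow_atTop_nhds_zero_of_lt_one hk0 hk).mul_const M
  have : dist x p ≤ 0 := ge_of_tendsto' hlim fun n => key n x hx
  exact dist_le_zero.1 this

/-- Every function which does not distinguish points of `K` at distance less than `δ` is constant
on `K`. -/
def ChainConnected {X : Type} [MetricSpace X] (K : Set X) (δ : ℝ) : Prop :=
  ∀ g : X → Prop, (∀ x ∈ K, ∀ y ∈ K, dist x y < δ → g x → g y) → ∀ x ∈ K, ∀ y ∈ K, g x → g y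

/-- If `g` held at some points of `K` and failed at others, the balls of radius `δ / 2` around the
two kinds of points would form two open sets covering `K`. A point of `K` in both would give an
unlike pair at distance below `δ`. -/
theorem IsPreconnected.chainConnected {X : Type} [MetricSpace X] {K : Set X}
    (hK : IsPreconnected K) {δ : ℝ} (hδ : 0 < δ) : ChainConnected K δ := by
  intro g hg x hx y hy hgx
  by_contra hgy
  let U : Set X := ⋃ z ∈ {z | z ∈ K ∧ g z}, Metric.ball z (δ / 2)
  let V : Set X := ⋃ z ∈ {z | z ∈ K ∧ ¬ g z}, Metric.ball z (δ / 2)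
  have hU : IsOpen U := isOpen_biUnion fun _ _ => Metric.isOpen_ball
  have hV : IsOpen V := isOpen_biUnion fun _ _ => Metric.isOpen_ball
  have hself : ∀ z : X, z ∈ Metric.ball z (δ / 2) := fun z => Metric.mem_ball_self (by linarith)
  obtain ⟨z, -, hzU, hzV⟩ := hK U V hU hV
    (fun z hz => by
      by_cases hgz : g z
      · exact Or.inl (Set.mem_biUnion (show z ∈ {z | z ∈ K ∧ g z} from ⟨hz, hgz⟩) (hself z))
      · exact Or.inr (Set.mem_biUnion (show z ∈ {z | z ∈ K ∧ ¬ g z} from ⟨hz, hgz⟩) (hself z)))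
    ⟨x, hx, Set.mem_biUnion (show x ∈ {z | z ∈ K ∧ g z} from ⟨hx, hgx⟩) (hself x)⟩
    ⟨y, hy, Set.mem_biUnion (show y ∈ {z | z ∈ K ∧ ¬ g z} from ⟨hy, hgy⟩) (hself y)⟩
  obtain ⟨a, ⟨haK, hga⟩, ha⟩ := Set.mem_iUnion₂.1 hzU
  obtain ⟨b, ⟨hbK, hgb⟩, hb⟩ := Set.mem_iUnion₂.1 hzV
  refine hgb (hg a haK b hbK ?_ hga)
  have := dist_triangle_left a b z
  rw [Metric.mem_ball] at ha hb
  linarith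

/-- A compact set is connected if chain connectedness at scale `2δ` implies it at scale `δ`. -/
theorem isPreconnected_of_chainConnected_step {X : Type} [MetricSpace X] {K : Set X}
    (hK : IsCompact K) (h : ∀ δ > 0, ChainConnected K (2 * δ) → ChainConnected K δ) :
    IsPreconnected K := by
  have hall : ∀ δ > 0, ChainConnected K δ := by
    intro δ hδ
    obtain ⟨M, hM⟩ := Metric.isBounded_iff.1 hK.isBounded
    have hpow : ∀ n : ℕ, ChainConnected K (2 ^ n * δ) → ChainConnected K δ := by
      intro n
      induction n with
      | zero => simp
      | succ n ih =>
        intro hn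
        refine ih (h _ (by positivity) ?_)
        rwa [← mul_assoc, ← pow_succ']
    obtain ⟨n, hn⟩ := pow_unbounded_of_one_lt (M / δ) (one_lt_two (α := ℝ))
    -- At a scale beyond the bound `M` on distances any two points are a single link; `hpow`
    -- descends from there to `δ`.
    refine hpow n fun g hg x hx y hy => hg x hx y hy ?_
    rw [div_lt_iff₀ hδ] at hn
    exact (hM hx hy).trans_lt hn
  rw [isPreconnected_iff_subset_of_disjoint_closed]
  · intro u v hu hv huv hdis
    by_contra hcon
    push Not at hcon
    obtain ⟨hcu, hcv⟩ := hcon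
    obtain ⟨x, hxK, hxv⟩ := Set.not_subset.1 hcv
    have hxu : x ∈ u := (huv hxK).resolve_right hxv
    obtain ⟨y, hyK, hyu⟩ := Set.not_subset.1 hcu
    have hd : Disjoint (K ∩ u) (K ∩ v) := by
      rw [Set.disjoint_iff]
      rintro z ⟨⟨hz, h1⟩, -, h2⟩
      exact (hdis ▸ (show z ∈ K ∩ (u ∩ v) from ⟨hz, h1, h2⟩) : z ∈ (∅ : Set X))
    -- The two disjoint parts, one compact and one closed, have a positive gap which links shorter
    -- than `δ` cannot cross.
    obtain ⟨δ, hδ, hsep⟩ := hd.exists_thickenings (hK.inter_right hu)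
      (hK.isClosed.inter hv)
    refine hyu ((hall δ hδ (fun z => z ∈ u) ?_) x hxK y hyK hxu)
    intro a ha b hb hab hau
    by_contra hbu
    have hbv : b ∈ v := (huv hb).resolve_left hbu
    refine Set.disjoint_left.1 hsep ?_ (Metric.self_subset_thickening hδ _ ⟨hb, hbv⟩)
    rw [Metric.mem_thickening_iff]
    exact ⟨a, ⟨ha, hau⟩, by rwa [dist_comm]⟩

/-- The image of a chain connected set under a map contracting distances by `1 / 2`. -/
theorem ChainConnected.image {X : Type} [MetricSpace X] {K L : Set X} {δ : ℝ}
    (hK : ChainConnected K (2 * δ)) {f : X → X} (hf : ∀ x y, dist (f x) (f y) ≤ 1 / 2 * dist x y)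
    (hL : f '' K ⊆ L) {g : X → Prop} (hg : ∀ x ∈ L, ∀ y ∈ L, dist x y < δ → g x → g y) :
    ∀ x ∈ f '' K, ∀ y ∈ f '' K, g x → g y := by
  rintro _ ⟨x, hx, rfl⟩ _ ⟨y, hy, rfl⟩
  refine hK (fun z => g (f z)) ?_ x hx y hy
  intro a ha b hb hab
  exact hg _ (hL ⟨a, ha, rfl⟩) _ (hL ⟨b, hb, rfl⟩) (by have := hf a b; linarith)

theorem fin_three_cases : ∀ i : Fin 3, i = 0 ∨ i = 1 ∨ i = 2 := by decide

theorem fin_five_cases : ∀ i : Fin 5, i = 0 ∨ i = 1 ∨ i = 2 ∨ i = 3 ∨ i = 4 := by decide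

namespace OpenGasket

variable (T : Affine.Triangle ℝ Plane)

/-! ### Barycentric coordinates -/

/-- The vertices of the triangle as an affine basis of the plane. -/
noncomputable def vertexBasis : AffineBasis (Fin 3) ℝ Plane where
  toFun := T.points
  ind' := T.independent
  tot' := by
    rw [T.independent.affineSpan_eq_top_iff_card_eq_finrank_add_one]
    simp

/-- Barycentric coordinates. -/
noncomputable def bary (j : Fin 3) : Plane →ᵃ[ℝ] ℝ := (vertexBasis T).coord j

/-- The barycentric coordinates of `q₁, …, q₅`. -/
noncomputable def qCoord : Fin 5 → Fin 3 → ℝ :=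
  ![![1, 0, 0], ![0, 1, 0], ![0, 0, 1], ![1 / 2, 1 / 2, 0], ![1 / 2, 0, 1 / 2]]

@[simp] theorem qCoord_zero : qCoord 0 = ![1, 0, 0] := rfl
@[simp] theorem qCoord_one : qCoord 1 = ![0, 1, 0] := rfl
@[simp] theorem qCoord_two : qCoord 2 = ![0, 0, 1] := rfl
@[simp] theorem qCoord_three : qCoord 3 = ![1 / 2, 1 / 2, 0] := rfl
@[simp] theorem qCoord_four : qCoord 4 = ![1 / 2, 0, 1 / 2] := rfl
@[simp] theorem ratio_zero : ratio 0 = 1 / 3 := rfl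
@[simp] theorem ratio_one : ratio 1 = 1 / 2 := rfl
@[simp] theorem ratio_two : ratio 2 = 1 / 3 := rfl
@[simp] theorem ratio_three : ratio 3 = 1 / 3 := rfl
@[simp] theorem ratio_four : ratio 4 = 1 / 3 := rfl

theorem bary_combo (j : Fin 3) (k : ℝ) (x y : Plane) :
    bary T j (k • x + (1 - k) • y) = k * bary T j x + (1 - k) * bary T j y := by
  rw [Convex.combo_affine_apply (by ring)]; rfl

theorem bary_points (i j : Fin 3) : bary T j (T.points i) = if j = i then 1 else 0 :=
  (vertexBasis T).coord_apply j i

theorem bary_midpoint (j : Fin 3) (x y : Plane) :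
    bary T j (midpoint ℝ x y) = 1 / 2 * bary T j x + 1 / 2 * bary T j y := by
  have : midpoint ℝ x y = (1 / 2 : ℝ) • x + (1 - 1 / 2 : ℝ) • y := by
    rw [midpoint_eq_smul_add, smul_add]; norm_num
  rw [this, bary_combo]; norm_num

theorem bary_q (i : Fin 5) (j : Fin 3) : bary T j (q T i) = qCoord i j := by
  rcases fin_five_cases i with rfl | rfl | rfl | rfl | rfl
  · rcases fin_three_cases j with rfl | rfl | rfl <;> simp [q, bary_points]
  · rcases fin_three_cases j with rfl | rfl | rfl <;> simp [q, bary_points]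
  · rcases fin_three_cases j with rfl | rfl | rfl <;> simp [q, bary_points]
  · change bary T j (midpoint ℝ (T.points 0) (T.points 1)) = qCoord 3 j
    rw [bary_midpoint, bary_points, bary_points]
    rcases fin_three_cases j with rfl | rfl | rfl <;> simp
  · change bary T j (midpoint ℝ (T.points 0) (T.points 2)) = qCoord 4 j
    rw [bary_midpoint, bary_points, bary_points]
    rcases fin_three_cases j with rfl | rfl | rfl <;> simp

theorem bary_F (i : Fin 5) (j : Fin 3) (x : Plane) :
    bary T j (F T i x) = ratio i * bary T j x + (1 - ratio i) * qCoord i j := by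
  rw [← bary_q T]
  exact bary_combo T j _ _ _

theorem bary_sum (x : Plane) : bary T 0 x + bary T 1 x + bary T 2 x = 1 := by
  have := (vertexBasis T).sum_coord_apply_eq_one x
  rwa [Fin.sum_univ_three] at this

variable {T} in
theorem bary_ext {x y : Plane} (h0 : bary T 0 x = bary T 0 y) (h1 : bary T 1 x = bary T 1 y) :
    x = y := by
  refine (vertexBasis T).ext_elem fun j => ?_
  have hx := bary_sum T x
  have hy := bary_sum T y
  rcases fin_three_cases j with rfl | rfl | rfl
  · exact h0
  · exact h1
  · change bary T 2 x = bary T 2 y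
    linarith

theorem bary_continuous (j : Fin 3) : Continuous (bary T j) :=
  (bary T j).continuous_of_finiteDimensional

theorem q_injective : Function.Injective (q T) := by
  intro i j h
  have h0 := congrArg (bary T 0) h
  have h1 := congrArg (bary T 1) h
  rw [bary_q, bary_q] at h0 h1
  rcases fin_five_cases i with rfl | rfl | rfl | rfl | rfl <;>
    rcases fin_five_cases j with rfl | rfl | rfl | rfl | rfl <;>
    first | rfl | (exfalso; revert h0 h1; norm_num)

theorem F_dist (i : Fin 5) (x y : Plane) : dist (F T i x) (F T i y) = ratio i * dist x y := by
  have : (0 : ℝ) ≤ ratio i := by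
    rcases fin_five_cases i with rfl | rfl | rfl | rfl | rfl <;> norm_num
  change dist (ratio i • x + (1 - ratio i) • q T i) (ratio i • y + (1 - ratio i) • q T i) = _
  rw [dist_add_right, dist_smul₀, Real.norm_of_nonneg this]

theorem ratio_pos (i : Fin 5) : 0 < ratio i := by
    rcases fin_five_cases i with rfl | rfl | rfl | rfl | rfl <;> norm_num

theorem ratio_le (i : Fin 5) : ratio i ≤ 1 / 2 := by
    rcases fin_five_cases i with rfl | rfl | rfl | rfl | rfl <;> norm_num

theorem F_q (i : Fin 5) : F T i (q T i) = q T i := by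
  change ratio i • q T i + (1 - ratio i) • q T i = _
  rw [← add_smul]; simp

theorem F_dist_q (i : Fin 5) (x : Plane) : dist (F T i x) (q T i) = ratio i * dist x (q T i) := by
  conv_lhs => rw [← F_q T i]
  exact F_dist T i _ _

theorem F_contracting (i : Fin 5) : ContractingWith (1 / 2) (F T i) := by
  refine ⟨by rw [← NNReal.coe_lt_coe]; norm_num, LipschitzWith.of_dist_le_mul fun x y => ?_⟩
  rw [F_dist]
  have : ((1 / 2 : NNReal) : ℝ) = 1 / 2 := by norm_num
  rw [this]
  exact mul_le_mul_of_nonneg_right (ratio_le i) dist_nonneg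

/-! ### The two sets `K₁` and `K₂` -/

theorem K_one_def : K T 1 = (K T 0 \ F T 1 '' K T 0) ∪ {F T 1 (q T 0)} := rfl

theorem K_zero_nonempty : (K T 0).Nonempty := (invariantSet_spec _ (F_contracting T)).1

theorem K_zero_compact : IsCompact (K T 0) := (invariantSet_spec _ (F_contracting T)).2.1

theorem K_zero_eq : K T 0 = ⋃ i, F T i '' K T 0 := (invariantSet_spec _ (F_contracting T)).2.2

variable {T}

theorem F_mem (i : Fin 5) {x : Plane} (hx : x ∈ K T 0) : F T i x ∈ K T 0 := by
  rw [K_zero_eq]; exact Set.mem_iUnion.2 ⟨i, x, hx, rfl⟩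

theorem mem_K_zero {x : Plane} (hx : x ∈ K T 0) : ∃ i, ∃ y ∈ K T 0, F T i y = x := by
  rw [K_zero_eq] at hx; exact Set.mem_iUnion.1 hx

/-- A coordinate attains its minimum m over the compact set at some `F T i y`. Since the coordinates
of the centres are nonnegative, m ≥ `ratio i` · m, whence m ≥ 0. -/
theorem bary_nonneg {x : Plane} (hx : x ∈ K T 0) (j : Fin 3) : 0 ≤ bary T j x := by
  obtain ⟨z, hz, hmin⟩ := (K_zero_compact T).exists_isMinOn (K_zero_nonempty T)
    (bary_continuous T j).continuousOn
  refine le_trans ?_ (hmin hx)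
  obtain ⟨i, y, hy, rfl⟩ := mem_K_zero hz
  have h1 : bary T j (F T i y) ≤ bary T j y := hmin hy
  rw [bary_F] at h1 ⊢
  have h2 := ratio_pos i
  have h3 := ratio_le i
  have h4 : 0 ≤ qCoord i j := by
    rcases fin_five_cases i with rfl | rfl | rfl | rfl | rfl <;>
      rcases fin_three_cases j with rfl | rfl | rfl <;> simp
  nlinarith [mul_nonneg (show (0 : ℝ) ≤ 1 - ratio i by linarith) h4]

/-- The iterates of `F T i` on any point of the closed invariant set converge to the fixed point. -/
theorem q_mem (i : Fin 5) : q T i ∈ K T 0 := by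
  obtain ⟨x, hx⟩ := K_zero_nonempty T
  have hmem : ∀ n : ℕ, (F T i)^[n] x ∈ K T 0 := by
    intro n
    induction n with
    | zero => exact hx
    | succ n ih => rw [Function.iterate_succ_apply']; exact F_mem i ih
  have hd : ∀ n : ℕ, dist ((F T i)^[n] x) (q T i) = ratio i ^ n * dist x (q T i) := by
    intro n
    induction n with
    | zero => simp
    | succ n ih => rw [Function.iterate_succ_apply', F_dist_q, ih]; ring
  refine (K_zero_compact T).isClosed.mem_of_tendsto (b := Filter.atTop)
    (tendsto_iff_dist_tendsto_zero.2 ?_) (Filter.Eventually.of_forall hmem)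
  simp_rw [hd]
  simpa using (tendsto_pow_atTop_nhds_zero_of_lt_one (ratio_pos i).le
    ((ratio_le i).trans_lt (by norm_num))).mul_const (dist x (q T i))

variable (T) in
theorem F_one_q_zero : F T 1 (q T 0) = q T 3 := by
  apply bary_ext (T := T) <;> norm_num [bary_F, bary_q]

variable (T) in
-- This is the overlap of the gasket: what the third-size copy around `q T 3` shares with the
-- half-size copy is already a cell of the latter.
theorem F_three_one (x : Plane) : F T 3 (F T 1 x) = F T 1 (F T 0 x) := by
  apply bary_ext (T := T) <;> simp only [bary_F] <;> norm_num <;> ring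

theorem F_three_mem_image {x : Plane} (hx : x ∈ F T 1 '' K T 0) : F T 3 x ∈ F T 1 '' K T 0 := by
  obtain ⟨y, hy, rfl⟩ := hx
  exact ⟨F T 0 y, F_mem 0 hy, (F_three_one T y).symm⟩

theorem q_three_mem_image : q T 3 ∈ F T 1 '' K T 0 := ⟨q T 0, q_mem 0, F_one_q_zero T⟩

/-- `F₂K₁` is the part of `K₁` cut off by the line through `q₄` parallel to `q₁q₃`. -/
theorem mem_image_F_one {x : Plane} (hx : x ∈ K T 0) :
    x ∈ F T 1 '' K T 0 ↔ 1 / 2 ≤ bary T 1 x := by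
  constructor
  · rintro ⟨y, hy, rfl⟩
    have := bary_nonneg hy 1
    rw [bary_F]; norm_num; linarith
  · intro h
    by_contra hcon
    -- The set of counterexamples lies in its own image under `F T 3`: the maps 0, 2, 4 give second
    -- coordinate at most 1/3, map 1 gives no counterexample, and map 3 keeps the value 1/2 and
    -- preserves the image of `F T 1`.
    have hsub : {x | x ∈ K T 0 ∧ 1 / 2 ≤ bary T 1 x ∧ x ∉ F T 1 '' K T 0} ⊆ {q T 3} := by
      refine subset_singleton_of_subset_image (ratio_pos 3).le
        ((ratio_le 3).trans_lt (by norm_num)) (F_dist_q T 3)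
        ((K_zero_compact T).isBounded.subset fun x hx => hx.1) ?_
      rintro x ⟨hx, h, hn⟩
      obtain ⟨i, y, hy, rfl⟩ := mem_K_zero hx
      have h0 := bary_nonneg hy 0
      have h1 := bary_nonneg hy 1
      have h2 := bary_nonneg hy 2
      have hs := bary_sum T y
      rw [bary_F] at h
      rcases fin_five_cases i with rfl | rfl | rfl | rfl | rfl
      · norm_num at h; linarith
      · exact absurd ⟨y, hy, rfl⟩ hn
      · norm_num at h; linarith
      · refine ⟨y, ⟨hy, ?_, fun hy' => hn (F_three_mem_image hy')⟩, rfl⟩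
        norm_num at h; linarith
      · norm_num at h; linarith
    have := hsub ⟨hx, h, hcon⟩
    rw [Set.mem_singleton_iff] at this
    exact hcon (this ▸ q_three_mem_image)

theorem mem_K_one {x : Plane} : x ∈ K T 1 ↔ x ∈ K T 0 ∧ (bary T 1 x < 1 / 2 ∨ x = q T 3) := by
  rw [K_one_def, F_one_q_zero]
  constructor
  · rintro (⟨hx, hn⟩ | rfl)
    · rw [mem_image_F_one hx, not_le] at hn; exact ⟨hx, Or.inl hn⟩
    · exact ⟨q_mem 3, Or.inr rfl⟩
  · rintro ⟨hx, h | h⟩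
    · left; exact ⟨hx, by rw [mem_image_F_one hx, not_le]; exact h⟩
    · right; exact h

theorem K_one_subset : K T 1 ⊆ K T 0 := fun _ h => (mem_K_one.1 h).1

theorem bary_one_le {x : Plane} (hx : x ∈ K T 1) : bary T 1 x ≤ 1 / 2 := by
  rcases (mem_K_one.1 hx).2 with h | h
  · exact h.le
  · rw [h, bary_q]; norm_num

variable (T)

theorem K_zero_split : K T 0 = F T 1 '' K T 0 ∪ K T 1 := by
  ext x
  constructor
  · intro hx
    by_cases h : x ∈ F T 1 '' K T 0
    · exact Or.inl h
    · rw [mem_image_F_one hx, not_le] at h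
      exact Or.inr (mem_K_one.2 ⟨hx, Or.inl h⟩)
  · rintro (⟨y, hy, rfl⟩ | h)
    · exact F_mem 1 hy
    · exact K_one_subset h

/-- Everything is decided by the second coordinate: it is at most 1/3 on the images under the maps
0, 2, 4, while map 3 turns b into (b + 1)/3 and so preserves the condition b < 1/2. -/
theorem K_one_split :
    K T 1 = F T 0 '' K T 0 ∪ F T 2 '' K T 0 ∪ F T 4 '' K T 0 ∪ F T 3 '' K T 1 := by
  ext x
  constructor
  · intro hx
    rcases mem_K_one.1 hx with ⟨h, h' | rfl⟩
    · obtain ⟨i, y, hy, rfl⟩ := mem_K_zero h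
      have h1 := bary_nonneg hy 1
      rw [bary_F] at h'
      rcases fin_five_cases i with rfl | rfl | rfl | rfl | rfl
      · exact Or.inl (Or.inl (Or.inl ⟨y, hy, rfl⟩))
      · norm_num at h'; linarith
      · exact Or.inl (Or.inl (Or.inr ⟨y, hy, rfl⟩))
      · refine Or.inr ⟨y, mem_K_one.2 ⟨hy, Or.inl ?_⟩, rfl⟩
        norm_num at h'; linarith
      · exact Or.inl (Or.inr ⟨y, hy, rfl⟩)
    · exact Or.inr ⟨q T 3, hx, F_q T 3⟩
  · have aux : ∀ i : Fin 5, i ≠ 1 → i ≠ 3 → F T i '' K T 0 ⊆ K T 1 := by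
      rintro i hi hi' _ ⟨y, hy, rfl⟩
      refine mem_K_one.2 ⟨F_mem i hy, Or.inl ?_⟩
      have h0 := bary_nonneg hy 0
      have h2 := bary_nonneg hy 2
      have hs := bary_sum T y
      rw [bary_F]
      rcases fin_five_cases i with rfl | rfl | rfl | rfl | rfl <;>
        first | exact absurd rfl hi | exact absurd rfl hi' | (norm_num; linarith)
    rintro (((h | h) | h) | h)
    · exact aux 0 (by decide) (by decide) h
    · exact aux 2 (by decide) (by decide) h
    · exact aux 4 (by decide) (by decide) h
    · obtain ⟨y, hy, rfl⟩ := h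
      rcases mem_K_one.1 hy with ⟨h, h' | rfl⟩
      · refine mem_K_one.2 ⟨F_mem 3 h, Or.inl ?_⟩
        rw [bary_F]; norm_num; linarith
      · rw [F_q]; exact hy

/-- The splitting passes to the closure, so the limit points missing from the set lie in their own
image under `F T 3`. They could only be `q T 3`, which was added by definition. -/
theorem K_one_compact : IsCompact (K T 1) := by
  have hcl : closure (K T 1) ⊆ K T 0 :=
    closure_minimal K_one_subset (K_zero_compact T).isClosed
  refine (K_zero_compact T).of_isClosed_subset ?_ K_one_subset
  have hFc : ∀ i, Continuous (F T i) := fun i => (F_contracting T i).2.continuous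
  have hbig : closure (K T 1) ⊆ F T 0 '' K T 0 ∪ F T 2 '' K T 0 ∪ F T 4 '' K T 0 ∪
      F T 3 '' closure (K T 1) := by
    refine closure_minimal ?_ ?_
    · conv_lhs => rw [K_one_split]
      exact Set.union_subset_union_right _ (Set.image_mono subset_closure)
    · have hc : IsCompact (closure (K T 1)) :=
        (K_zero_compact T).of_isClosed_subset isClosed_closure hcl
      have h0 := K_zero_compact T
      exact ((((h0.image (hFc 0)).union (h0.image (hFc 2))).union (h0.image (hFc 4))).union
        (hc.image (hFc 3))).isClosed
  have hsub : closure (K T 1) \ K T 1 ⊆ {q T 3} := by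
    refine subset_singleton_of_subset_image (ratio_pos 3).le
      ((ratio_le 3).trans_lt (by norm_num)) (F_dist_q T 3)
      ((K_zero_compact T).isBounded.subset (Set.sdiff_subset.trans hcl)) ?_
    rintro x ⟨hx, hn⟩
    have hn' := hn
    rw [K_one_split] at hn'
    rcases hbig hx with h | ⟨y, hy, rfl⟩
    · exact absurd (Or.inl h) hn'
    · exact ⟨y, ⟨hy, fun hy' => hn' (Or.inr ⟨y, hy', rfl⟩)⟩, rfl⟩
  refine isClosed_of_closure_subset fun x hx => ?_
  by_contra hn
  exact hn (mem_K_one.2 ⟨hcl hx, Or.inr (hsub ⟨hx, hn⟩)⟩)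

variable {T}

theorem q_zero_mem : q T 0 ∈ K T 1 :=
  mem_K_one.2 ⟨q_mem 0, Or.inl (by rw [bary_q]; norm_num)⟩

theorem q_two_mem : q T 2 ∈ K T 1 :=
  mem_K_one.2 ⟨q_mem 2, Or.inl (by rw [bary_q]; norm_num)⟩

theorem q_three_mem : q T 3 ∈ K T 1 := mem_K_one.2 ⟨q_mem 3, Or.inr rfl⟩

variable (T)

/-! ### Junction points -/

theorem F_zero_q_one : F T 0 (q T 1) = F T 3 (q T 0) := by
  apply bary_ext (T := T) <;> simp only [bary_F, bary_q] <;> norm_num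

theorem F_zero_q_two : F T 0 (q T 2) = F T 4 (q T 0) := by
  apply bary_ext (T := T) <;> simp only [bary_F, bary_q] <;> norm_num

theorem F_four_q_two : F T 4 (q T 2) = F T 2 (q T 0) := by
  apply bary_ext (T := T) <;> simp only [bary_F, bary_q] <;> norm_num

theorem F_three_q_two : F T 3 (q T 2) = F T 4 (q T 1) := by
  apply bary_ext (T := T) <;> simp only [bary_F, bary_q] <;> norm_num

theorem F_dist_le (i : Fin 5) (x y : Plane) : dist (F T i x) (F T i y) ≤ 1 / 2 * dist x y := by
  rw [F_dist]; exact mul_le_mul_of_nonneg_right (ratio_le i) dist_nonneg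

/-- Each piece inherits chains with links half as long, and the junction points link all five pieces
to the piece of `F T 0`. -/
theorem K_zero_connected : IsConnected (K T 0) := by
  refine ⟨K_zero_nonempty T, isPreconnected_of_chainConnected_step (K_zero_compact T) ?_⟩
  intro δ _ hc g hg
  have key : ∀ i, ∀ x ∈ K T 0, ∀ y ∈ K T 0, g (F T i x) ↔ g (F T i y) := fun i x hx y hy =>
    ⟨hc.image (F_dist_le T i) (by rintro _ ⟨z, hz, rfl⟩; exact F_mem i hz) hg _ ⟨x, hx, rfl⟩ _
      ⟨y, hy, rfl⟩,
    hc.image (F_dist_le T i) (by rintro _ ⟨z, hz, rfl⟩; exact F_mem i hz) hg _ ⟨y, hy, rfl⟩ _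
      ⟨x, hx, rfl⟩⟩
  have h03 : g (F T 3 (q T 0)) ↔ g (F T 0 (q T 0)) := by
    rw [← F_zero_q_one]; exact key 0 _ (q_mem 1) _ (q_mem 0)
  have h04 : g (F T 4 (q T 0)) ↔ g (F T 0 (q T 0)) := by
    rw [← F_zero_q_two]; exact key 0 _ (q_mem 2) _ (q_mem 0)
  have h42 : g (F T 2 (q T 0)) ↔ g (F T 4 (q T 0)) := by
    rw [← F_four_q_two]; exact key 4 _ (q_mem 2) _ (q_mem 0)
  have h31 : g (F T 1 (q T 0)) ↔ g (F T 3 (q T 0)) := by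
    rw [F_one_q_zero, ← F_q T 3]; exact key 3 _ (q_mem 3) _ (q_mem 0)
  have hall : ∀ x ∈ K T 0, g x ↔ g (F T 0 (q T 0)) := by
    intro x hx
    obtain ⟨i, y, hy, rfl⟩ := mem_K_zero hx
    rw [key i y hy _ (q_mem 0)]
    rcases fin_five_cases i with rfl | rfl | rfl | rfl | rfl
    · exact Iff.rfl
    · exact h31.trans h03
    · exact h42.trans h04
    · exact h03
    · exact h04
  intro x hx y hy
  rw [hall x hx, hall y hy]; exact id

theorem K_one_connected : IsConnected (K T 1) := by
  refine ⟨⟨_, q_zero_mem⟩, isPreconnected_of_chainConnected_step (K_one_compact T) ?_⟩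
  intro δ hδ hc g hg
  -- Three of the four pieces are copies of `K T 0`, whose connectedness is known; only the fourth
  -- uses the scale `2 * δ` on the set itself.
  have hc0 : ChainConnected (K T 0) (2 * δ) :=
    (K_zero_connected T).isPreconnected.chainConnected (by linarith)
  have hsub : ∀ i : Fin 5, i = 0 ∨ i = 2 ∨ i = 4 → F T i '' K T 0 ⊆ K T 1 := by
    intro i hi
    conv_rhs => rw [K_one_split]
    rcases hi with rfl | rfl | rfl <;> intro x hx <;> simp only [Set.mem_union] <;> tauto
  have key : ∀ i : Fin 5, i = 0 ∨ i = 2 ∨ i = 4 →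
      ∀ x ∈ K T 0, ∀ y ∈ K T 0, g (F T i x) ↔ g (F T i y) := fun i hi x hx y hy =>
    ⟨hc0.image (F_dist_le T i) (hsub i hi) hg _ ⟨x, hx, rfl⟩ _ ⟨y, hy, rfl⟩,
    hc0.image (F_dist_le T i) (hsub i hi) hg _ ⟨y, hy, rfl⟩ _ ⟨x, hx, rfl⟩⟩
  have hsub3 : F T 3 '' K T 1 ⊆ K T 1 := by
    conv_rhs => rw [K_one_split]
    exact Set.subset_union_right
  have key3 : ∀ x ∈ K T 1, ∀ y ∈ K T 1, g (F T 3 x) ↔ g (F T 3 y) := fun x hx y hy =>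
    ⟨hc.image (F_dist_le T 3) hsub3 hg _ ⟨x, hx, rfl⟩ _ ⟨y, hy, rfl⟩,
    hc.image (F_dist_le T 3) hsub3 hg _ ⟨y, hy, rfl⟩ _ ⟨x, hx, rfl⟩⟩
  have h03 : g (F T 3 (q T 0)) ↔ g (F T 0 (q T 0)) := by
    rw [← F_zero_q_one]; exact key 0 (by simp) _ (q_mem 1) _ (q_mem 0)
  have h04 : g (F T 4 (q T 0)) ↔ g (F T 0 (q T 0)) := by
    rw [← F_zero_q_two]; exact key 0 (by simp) _ (q_mem 2) _ (q_mem 0)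
  have h42 : g (F T 2 (q T 0)) ↔ g (F T 4 (q T 0)) := by
    rw [← F_four_q_two]; exact key 4 (by simp) _ (q_mem 2) _ (q_mem 0)
  have hall : ∀ x ∈ K T 1, g x ↔ g (F T 0 (q T 0)) := by
    intro x hx
    rw [K_one_split] at hx
    rcases hx with ((⟨y, hy, rfl⟩ | ⟨y, hy, rfl⟩) | ⟨y, hy, rfl⟩) | ⟨y, hy, rfl⟩
    · exact key 0 (by simp) y hy _ (q_mem 0)
    · exact (key 2 (by simp) y hy _ (q_mem 0)).trans (h42.trans h04)
    · exact (key 4 (by simp) y hy _ (q_mem 0)).trans h04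
    · exact (key3 y hy _ q_zero_mem).trans h03
  intro x hx y hy
  rw [hall x hx, hall y hy]; exact id

end OpenGasket

namespace OpenGasket

variable {T : Affine.Triangle ℝ Plane}

/-! ### `K₁` and `K₂` are not similar -/

/-- Expand the difference in the two edge vectors at a vertex, of length L and inner product L²/2.
The form becomes symmetric because the three coordinate differences sum to zero. -/
theorem dist_sq_bary (hT : T.Equilateral) : ∃ L : ℝ, 0 < L ∧ ∀ x y : Plane,
    dist x y ^ 2 = L ^ 2 / 2 * ((bary T 0 x - bary T 0 y) ^ 2 + (bary T 1 x - bary T 1 y) ^ 2 +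
      (bary T 2 x - bary T 2 y) ^ 2) := by
  obtain ⟨L, hL⟩ := hT
  have hL0 : 0 < L := by
    rw [← hL 0 1 (by decide), dist_pos]
    exact T.independent.injective.ne (by decide)
  refine ⟨L, hL0, fun x y => ?_⟩
  have hx : x = bary T 0 x • T.points 0 + bary T 1 x • T.points 1 + bary T 2 x • T.points 2 := by
    have := (vertexBasis T).linear_combination_coord_eq_self x
    rw [Fin.sum_univ_three] at this
    exact this.symm
  have hy : y = bary T 0 y • T.points 0 + bary T 1 y • T.points 1 + bary T 2 y • T.points 2 := by
    have := (vertexBasis T).linear_combination_coord_eq_self y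
    rw [Fin.sum_univ_three] at this
    exact this.symm
  have hsx := bary_sum T x
  have hsy := bary_sum T y
  obtain ⟨u, hu⟩ : ∃ u, u = T.points 1 - T.points 0 := ⟨_, rfl⟩
  obtain ⟨v, hv⟩ : ∃ v, v = T.points 2 - T.points 0 := ⟨_, rfl⟩
  have huu : inner ℝ u u = L ^ 2 := by
    rw [real_inner_self_eq_norm_sq, hu, ← dist_eq_norm, hL 1 0 (by decide)]
  have hvv : inner ℝ v v = L ^ 2 := by
    rw [real_inner_self_eq_norm_sq, hv, ← dist_eq_norm, hL 2 0 (by decide)]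
  have huv : inner ℝ u v = L ^ 2 / 2 := by
    have h : inner ℝ (u - v) (u - v) = L ^ 2 := by
      have : u - v = T.points 1 - T.points 2 := by rw [hu, hv]; abel
      rw [real_inner_self_eq_norm_sq, this, ← dist_eq_norm, hL 1 2 (by decide)]
    rw [inner_sub_left, inner_sub_right, inner_sub_right, real_inner_comm u v, huu, hvv] at h
    linarith
  have hd : x - y = (bary T 1 x - bary T 1 y) • u + (bary T 2 x - bary T 2 y) • v := by
    have h0 : bary T 0 x = 1 - bary T 1 x - bary T 2 x := by linarith
    have h0' : bary T 0 y = 1 - bary T 1 y - bary T 2 y := by linarith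
    conv_lhs => rw [hx, hy, h0, h0']
    rw [hu, hv]
    module
  rw [dist_eq_norm, ← real_inner_self_eq_norm_sq, hd]
  simp only [inner_add_left, inner_add_right, real_inner_smul_left, real_inner_smul_right,
    huu, hvv, huv, real_inner_comm u v]
  have h0 : bary T 0 x - bary T 0 y = -(bary T 1 x - bary T 1 y) - (bary T 2 x - bary T 2 y) := by
    linarith
  rw [h0]
  ring

theorem bary_le_one {x : Plane} (hx : x ∈ K T 0) (j : Fin 3) : bary T j x ≤ 1 := by
  have h0 := bary_nonneg hx 0
  have h1 := bary_nonneg hx 1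
  have h2 := bary_nonneg hx 2
  have hs := bary_sum T x
  rcases fin_three_cases j with rfl | rfl | rfl <;> linarith

/-- Two points of the triangle at distance at least the side length are vertices. The three vertices
would go to three such points of `K T 1`, which contains only two vertices. -/
theorem not_similar (hT : T.Equilateral) (f : Plane ≃ᵈ Plane) : f '' K T 0 ≠ K T 1 := by
  intro hf
  obtain ⟨L, hL, hd⟩ := dist_sq_bary hT
  have hvert : ∀ i j : Fin 3, i ≠ j → dist (T.points i) (T.points j) ^ 2 = L ^ 2 := by
    intro i j hij
    rw [hd]
    simp only [bary_points]
    rcases fin_three_cases i with rfl | rfl | rfl <;>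
      rcases fin_three_cases j with rfl | rfl | rfl <;>
      first | exact absurd rfl hij | (simp; try ring)
  have hpos : ∀ i j : Fin 3, i ≠ j → 0 < dist (T.points i) (T.points j) := fun i j hij =>
    dist_pos.2 (T.independent.injective.ne hij)
  have hle : ∀ x ∈ K T 0, ∀ y ∈ K T 0, dist x y ^ 2 ≤ L ^ 2 := by
    intro x hx y hy
    rw [hd]
    -- Squares of numbers in [0, 1] do not exceed them; summing over `j` bounds the sum of squares
    -- by 2.
    have key : ∀ j, (bary T j x - bary T j y) ^ 2 ≤ bary T j x + bary T j y := fun j => by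
      nlinarith [bary_nonneg hx j, bary_nonneg hy j, bary_le_one hx j, bary_le_one hy j,
        mul_nonneg (bary_nonneg hx j) (bary_nonneg hy j)]
    have := key 0
    have := key 1
    have := key 2
    have := bary_sum T x
    have := bary_sum T y
    nlinarith [sq_nonneg L]
  have hmem : ∀ i : Fin 3, T.points i ∈ K T 0 := fun i => by
    rcases fin_three_cases i with rfl | rfl | rfl
    · exact q_mem 0
    · exact q_mem 1
    · exact q_mem 2
  -- The image contains two vertices at distance L, while no two points of the source are farther
  -- apart than L.
  have hρ : 1 ≤ (Dilation.ratio f : ℝ) := by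
    obtain ⟨u, hu, hfu⟩ : T.points 0 ∈ f '' K T 0 := hf ▸ q_zero_mem
    obtain ⟨v, hv, hfv⟩ : T.points 2 ∈ f '' K T 0 := hf ▸ q_two_mem
    have h1 := hle u hu v hv
    rw [← hvert 0 2 (by decide), ← hfu, ← hfv, Dilation.dist_eq, mul_pow] at h1
    by_contra hlt
    have huv : 0 < dist u v := by
      refine dist_pos.2 fun h => ?_
      have := hpos 0 2 (by decide)
      rw [← hfu, ← hfv, h, dist_self] at this
      exact lt_irrefl _ this
    have h2 : (Dilation.ratio f : ℝ) ^ 2 < 1 := by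
      rw [sq_lt_one_iff_abs_lt_one, NNReal.abs_eq]; exact not_le.1 hlt
    nlinarith [pow_pos huv 2]
  have hfar : ∀ i j : Fin 3, i ≠ j → L ^ 2 ≤ dist (f (T.points i)) (f (T.points j)) ^ 2 := by
    intro i j hij
    rw [Dilation.dist_eq, mul_pow, hvert i j hij]
    nlinarith [mul_nonneg (sub_nonneg.2 (one_le_pow₀ hρ (n := 2))) (sq_nonneg L)]
  have hm : ∀ i : Fin 3, f (T.points i) ∈ K T 1 := fun i => hf ▸ ⟨_, hmem i, rfl⟩
  have hcorner : ∀ x ∈ K T 1, ∀ y ∈ K T 1, L ^ 2 ≤ dist x y ^ 2 →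
      bary T 1 x = 0 ∧ (bary T 0 x = 0 ∨ bary T 0 x = 1) := by
    intro x hx y hy hxy
    rw [hd] at hxy
    have hx' := K_one_subset hx
    have hy' := K_one_subset hy
    have hS : 2 ≤ (bary T 0 x - bary T 0 y) ^ 2 + (bary T 1 x - bary T 1 y) ^ 2 +
      (bary T 2 x - bary T 2 y) ^ 2 := by
      by_contra hlt
      nlinarith [pow_pos hL 2]
    have hmul : ∀ j, 0 ≤ bary T j x * bary T j y := fun j =>
      mul_nonneg (bary_nonneg hx' j) (bary_nonneg hy' j)
    have hsx : ∀ j, 0 ≤ bary T j x * (1 - bary T j x) := fun j =>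
      mul_nonneg (bary_nonneg hx' j) (by linarith [bary_le_one hx' j])
    have hsy : ∀ j, 0 ≤ bary T j y * (1 - bary T j y) := fun j =>
      mul_nonneg (bary_nonneg hy' j) (by linarith [bary_le_one hy' j])
    have e1 := bary_sum T x
    have e2 := bary_sum T y
    -- Equality case of the diameter bound: the sum of squares is 2 minus the sums of xⱼ(1 - xⱼ),
    -- yⱼ(1 - yⱼ) and 2xⱼyⱼ, all nonnegative.
    have hz : ∀ j, bary T j x * (1 - bary T j x) = 0 := by
      intro j
      have a0 := hmul 0
      have a1 := hmul 1
      have a2 := hmul 2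
      have b0 := hsx 0
      have b1 := hsx 1
      have b2 := hsx 2
      have c0 := hsy 0
      have c1 := hsy 1
      have c2 := hsy 2
      rcases fin_three_cases j with rfl | rfl | rfl <;> nlinarith
    have hb := bary_one_le hx
    refine ⟨?_, ?_⟩
    · rcases mul_eq_zero.1 (hz 1) with h | h
      · exact h
      · linarith
    · rcases mul_eq_zero.1 (hz 0) with h | h
      · exact Or.inl h
      · exact Or.inr (by linarith)
  -- With second coordinate zero, the first coordinate separates the three images, yet it takes only
  -- the values 0 and 1.
  have hne : ∀ i j : Fin 3, i ≠ j →
      bary T 0 (f (T.points i)) ≠ bary T 0 (f (T.points j)) := by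
    intro i j hij h
    have h1 := (hcorner _ (hm i) _ (hm j) (hfar i j hij)).1
    have h2 := (hcorner _ (hm j) _ (hm i) (hfar j i hij.symm)).1
    exact T.independent.injective.ne hij (f.injective (bary_ext h (h1.trans h2.symm)))
  have h01 := hne 0 1 (by decide)
  have h02 := hne 0 2 (by decide)
  have h12 := hne 1 2 (by decide)
  have c0 := (hcorner _ (hm 0) _ (hm 1) (hfar 0 1 (by decide))).2
  have c1 := (hcorner _ (hm 1) _ (hm 0) (hfar 1 0 (by decide))).2
  have c2 := (hcorner _ (hm 2) _ (hm 0) (hfar 2 0 (by decide))).2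
  rcases c0 with c0 | c0 <;> rcases c1 with c1 | c1 <;> rcases c2 with c2 | c2 <;>
    simp_all

/-! ### Intersections of the pieces -/

theorem inter_F_one_K_one {x y : Plane} (hx : x ∈ K T 0) (hy : y ∈ K T 1) (h : F T 1 x = y) :
    y = q T 3 := by
  rcases (mem_K_one.1 hy).2 with h' | h'
  · have := bary_nonneg hx 1
    rw [← h, bary_F] at h'
    norm_num at h'
    linarith
  · exact h'

theorem bary_eqs {i j : Fin 5} {x y : Plane} (h : F T i x = F T j y) (k : Fin 3) :
    ratio i * bary T k x + (1 - ratio i) * qCoord i k =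
      ratio j * bary T k y + (1 - ratio j) * qCoord j k := by
  rw [← bary_F, ← bary_F, h]

theorem inter_F_zero_two {x y : Plane} (hx : x ∈ K T 0) (hy : y ∈ K T 0) :
    F T 0 x ≠ F T 2 y := by
  intro h
  have h0 := bary_eqs h 0
  have := bary_nonneg hx 0
  have := bary_le_one hy 0
  norm_num at h0
  linarith

theorem inter_F_two_three {x y : Plane} (hx : x ∈ K T 0) (hy : y ∈ K T 0) :
    F T 2 x ≠ F T 3 y := by
  intro h
  have h0 := bary_eqs h 0
  have := bary_le_one hx 0
  have := bary_nonneg hy 0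
  have h1 := bary_eqs h 1
  have := bary_nonneg hx 2
  have := bary_nonneg hy 1
  have := bary_sum T x
  norm_num at h0 h1
  linarith

/-- The pieces lie in small triangles touching at one corner, so the coordinate inequalities become
equalities at a common point. The following lemmas hold for the same reason. -/
theorem inter_F_zero_three {x y : Plane} (hx : x ∈ K T 0) (hy : y ∈ K T 0)
    (h : F T 0 x = F T 3 y) : x = q T 1 := by
  have h0 := bary_eqs h 0
  have h1 := bary_eqs h 1
  have := bary_nonneg hx 0
  have := bary_nonneg hy 1
  have := bary_nonneg hy 2
  have := bary_nonneg hx 2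
  have := bary_sum T x
  have := bary_sum T y
  norm_num at h0 h1
  apply bary_ext (T := T) <;> rw [bary_q] <;> norm_num <;> linarith

theorem inter_F_zero_four {x y : Plane} (hx : x ∈ K T 0) (hy : y ∈ K T 0)
    (h : F T 0 x = F T 4 y) : x = q T 2 := by
  have h0 := bary_eqs h 0
  have h1 := bary_eqs h 1
  have := bary_nonneg hx 0
  have := bary_nonneg hx 1
  have := bary_nonneg hy 1
  have := bary_nonneg hy 2
  have := bary_nonneg hx 2
  have := bary_sum T x
  have := bary_sum T y
  norm_num at h0 h1
  apply bary_ext (T := T) <;> rw [bary_q] <;> norm_num <;> linarith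

theorem inter_F_four_two {x y : Plane} (hx : x ∈ K T 0) (hy : y ∈ K T 0)
    (h : F T 4 x = F T 2 y) : x = q T 2 := by
  have h0 := bary_eqs h 0
  have h1 := bary_eqs h 1
  have := bary_nonneg hx 0
  have := bary_nonneg hx 1
  have := bary_nonneg hy 1
  have := bary_nonneg hy 0
  have := bary_nonneg hy 2
  have := bary_nonneg hx 2
  have := bary_sum T x
  have := bary_sum T y
  norm_num at h0 h1
  apply bary_ext (T := T) <;> rw [bary_q] <;> norm_num <;> linarith

theorem inter_F_three_four {x y : Plane} (hx : x ∈ K T 0) (hy : y ∈ K T 0)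
    (h : F T 3 x = F T 4 y) : x = q T 2 := by
  have h0 := bary_eqs h 0
  have h1 := bary_eqs h 1
  have := bary_nonneg hx 0
  have := bary_nonneg hx 1
  have := bary_nonneg hy 1
  have := bary_nonneg hy 0
  have := bary_nonneg hy 2
  have := bary_nonneg hx 2
  have := bary_sum T x
  have := bary_sum T y
  norm_num at h0 h1
  apply bary_ext (T := T) <;> rw [bary_q] <;> norm_num <;> linarith

/-! ### The graph-directed construction -/

theorem fin_six_cases : ∀ i : Fin 6, i = 0 ∨ i = 1 ∨ i = 2 ∨ i = 3 ∨ i = 4 ∨ i = 5 := by decide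

theorem fin_two_cases : ∀ i : Fin 2, i = 0 ∨ i = 1 := by decide

variable (T) in
/-- The piece `ψ_e K_{f(e)}` belonging to the edge `e`. -/
noncomputable def piece (e : Fin 6) : Set Plane := (graph T).sim e '' K T ((graph T).fin e)

theorem piece_zero : piece T 0 = F T 1 '' K T 0 := rfl
theorem piece_one : piece T 1 = K T 1 := Set.image_id _
theorem piece_two : piece T 2 = F T 0 '' K T 0 := rfl
theorem piece_three : piece T 3 = F T 2 '' K T 0 := rfl
theorem piece_four : piece T 4 = F T 4 '' K T 0 := rfl
theorem piece_five : piece T 5 = F T 3 '' K T 1 := rfl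

@[simp] theorem graph_init_zero : (graph T).init 0 = 0 := rfl
@[simp] theorem graph_init_one : (graph T).init 1 = 0 := rfl
@[simp] theorem graph_init_two : (graph T).init 2 = 1 := rfl
@[simp] theorem graph_init_three : (graph T).init 3 = 1 := rfl
@[simp] theorem graph_init_four : (graph T).init 4 = 1 := rfl
@[simp] theorem graph_init_five : (graph T).init 5 = 1 := rfl

theorem K_eq_iUnion_piece (s : Fin 2) :
    K T s = ⋃ e, ⋃ (_ : (graph T).init e = s), piece T e := by
  ext x
  simp only [Set.mem_iUnion, exists_prop]
  rcases fin_two_cases s with rfl | rfl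
  · conv_lhs => rw [K_zero_split, ← piece_zero, ← piece_one]
    constructor
    · rintro (h | h)
      · exact ⟨0, rfl, h⟩
      · exact ⟨1, rfl, h⟩
    · rintro ⟨e, he, h⟩
      rcases fin_six_cases e with rfl | rfl | rfl | rfl | rfl | rfl <;> simp at he
      · exact Or.inl h
      · exact Or.inr h
  · conv_lhs => rw [K_one_split, ← piece_two, ← piece_three, ← piece_four, ← piece_five]
    constructor
    · rintro (((h | h) | h) | h)
      · exact ⟨2, rfl, h⟩
      · exact ⟨3, rfl, h⟩
      · exact ⟨4, rfl, h⟩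
      · exact ⟨5, rfl, h⟩
    · rintro ⟨e, he, h⟩
      rcases fin_six_cases e with rfl | rfl | rfl | rfl | rfl | rfl <;> simp at he
      · exact Or.inl (Or.inl (Or.inl h))
      · exact Or.inl (Or.inl (Or.inr h))
      · exact Or.inl (Or.inr h)
      · exact Or.inr h

theorem piece_subset (e : Fin 6) : piece T e ⊆ K T ((graph T).init e) := by
  intro x hx
  rw [K_eq_iUnion_piece]
  exact Set.mem_iUnion₂.2 ⟨e, rfl, hx⟩

variable (T) in
/-- The points lying in two different children. -/
noncomputable def crossingSet : Fin 2 → Set Plane :=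
  ![{q T 3}, {F T 0 (q T 1), F T 0 (q T 2), F T 4 (q T 2), F T 3 (q T 2)}]

variable (T) in
/-- The boundaries `V₁` and `V₂`. -/
noncomputable def boundarySet : Fin 2 → Set Plane :=
  ![{q T 0, q T 1, q T 2}, {q T 0, q T 2, q T 3}]

theorem crossingSet_one :
    crossingSet T 1 = {F T 0 (q T 1), F T 0 (q T 2), F T 4 (q T 2), F T 3 (q T 2)} := rfl
theorem boundarySet_zero : boundarySet T 0 = {q T 0, q T 1, q T 2} := rfl
theorem boundarySet_one : boundarySet T 1 = {q T 0, q T 2, q T 3} := rfl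

theorem piece_inter {e e' : Fin 6} (hee : e < e') (hi : (graph T).init e = (graph T).init e') :
    ∃ p ∈ crossingSet T ((graph T).init e), piece T e ∩ piece T e' ⊆ {p} := by
  rcases fin_six_cases e with rfl | rfl | rfl | rfl | rfl | rfl <;>
    rcases fin_six_cases e' with rfl | rfl | rfl | rfl | rfl | rfl <;>
    first
      | exact absurd hee (by decide)
      | (exfalso; simp at hi; done)
      | skip
  · refine ⟨q T 3, rfl, ?_⟩
    rintro _ ⟨⟨x, hx, rfl⟩, hy⟩
    rw [piece_one] at hy
    exact inter_F_one_K_one hx hy rfl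
  -- These two pieces are disjoint; the chosen point is a dummy.
  · refine ⟨F T 0 (q T 1), by simp [crossingSet_one], ?_⟩
    rintro _ ⟨⟨x, hx, rfl⟩, y, hy, h⟩
    exact absurd h.symm (inter_F_zero_two hx hy)
  · refine ⟨F T 0 (q T 2), by simp [crossingSet_one], ?_⟩
    rintro _ ⟨⟨x, hx, rfl⟩, y, hy, h⟩
    rw [inter_F_zero_four hx hy h.symm]; rfl
  · refine ⟨F T 0 (q T 1), by simp [crossingSet_one], ?_⟩
    rintro _ ⟨⟨x, hx, rfl⟩, y, hy, h⟩
    rw [inter_F_zero_three hx (K_one_subset hy) h.symm]; rfl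
  · refine ⟨F T 4 (q T 2), by simp [crossingSet_one], ?_⟩
    rintro _ ⟨⟨x, hx, rfl⟩, y, hy, h⟩
    rw [inter_F_four_two hy hx h] at h
    exact h.symm
  · refine ⟨F T 0 (q T 1), by simp [crossingSet_one], ?_⟩
    rintro _ ⟨⟨x, hx, rfl⟩, y, hy, h⟩
    exact absurd h.symm (inter_F_two_three hx (K_one_subset hy))
  · refine ⟨F T 3 (q T 2), by simp [crossingSet_one], ?_⟩
    rintro _ ⟨⟨x, hx, rfl⟩, y, hy, h⟩
    rw [inter_F_three_four (K_one_subset hy) hx h] at h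
    exact h.symm

theorem piece_inter' {e e' : Fin 6} (hee : e ≠ e') (hi : (graph T).init e = (graph T).init e') :
    ∃ p ∈ crossingSet T ((graph T).init e), piece T e ∩ piece T e' ⊆ {p} := by
  rcases lt_or_gt_of_ne hee with h | h
  · exact piece_inter h hi
  · rw [hi, Set.inter_comm]; exact piece_inter h hi.symm

/-- A finite check which starts the descent: inside a child, the parent's crossing points are
already boundary candidates of the child. -/
theorem crossingSet_inter {e : Fin 6} {x : Plane} (hC : x ∈ crossingSet T ((graph T).init e))
    (hx : x ∈ piece T e) : x ∈ (graph T).sim e '' boundarySet T ((graph T).fin e) := by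
  rcases fin_six_cases e with rfl | rfl | rfl | rfl | rfl | rfl
  · obtain rfl : x = q T 3 := hC
    exact ⟨q T 0, by simp [graph, boundarySet_zero], F_one_q_zero T⟩
  · obtain rfl : x = q T 3 := hC
    exact ⟨q T 3, by simp [graph, boundarySet_one], rfl⟩
  · obtain ⟨y, hy, rfl⟩ := hx
    rcases hC with h | h | h | h
    · exact ⟨q T 1, by simp [graph, boundarySet_zero], h.symm⟩
    · exact ⟨q T 2, by simp [graph, boundarySet_zero], h.symm⟩
    · rw [F_four_q_two] at h; exact absurd h (inter_F_zero_two hy (q_mem 0))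
    · obtain rfl := inter_F_zero_three hy (q_mem 2) h
      exact ⟨q T 1, by simp [graph, boundarySet_zero], rfl⟩
  · obtain ⟨y, hy, rfl⟩ := hx
    rcases hC with h | h | h | h
    · exact absurd h.symm (inter_F_zero_two (q_mem 1) hy)
    · exact absurd h.symm (inter_F_zero_two (q_mem 2) hy)
    · exact ⟨q T 0, by simp [graph, boundarySet_zero], (F_four_q_two T).symm.trans h.symm⟩
    · exact absurd h (inter_F_two_three hy (q_mem 2))
  · obtain ⟨y, hy, rfl⟩ := hx
    rcases hC with h | h | h | h
    · have := q_injective T (inter_F_zero_four (q_mem 1) hy h.symm)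
      exact absurd this (by decide)
    · exact ⟨q T 0, by simp [graph, boundarySet_zero], (F_zero_q_two T).symm.trans h.symm⟩
    · exact ⟨q T 2, by simp [graph, boundarySet_zero], h.symm⟩
    · exact ⟨q T 1, by simp [graph, boundarySet_zero], (F_three_q_two T).symm.trans h.symm⟩
  · obtain ⟨y, hy, rfl⟩ := hx
    have hy := K_one_subset hy
    rcases hC with h | h | h | h
    · exact ⟨q T 0, by simp [graph, boundarySet_one], (F_zero_q_one T).symm.trans h.symm⟩
    · have := q_injective T (inter_F_zero_three (q_mem 2) hy h.symm)
      exact absurd this (by decide)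
    · rw [F_four_q_two] at h; exact absurd h.symm (inter_F_two_three (q_mem 0) hy)
    · exact ⟨q T 2, by simp [graph, boundarySet_one], h.symm⟩

/-- The candidates are stable under passing to a child, as the induction along walks requires. -/
theorem boundarySet_inter {e : Fin 6} {x : Plane} (hV : x ∈ boundarySet T ((graph T).init e))
    (hx : x ∈ piece T e) : x ∈ (graph T).sim e '' boundarySet T ((graph T).fin e) := by
  have coord : ∀ (i j : Fin 5) {y : Plane}, F T j y = q T i → ∀ k,
      ratio j * bary T k y + (1 - ratio j) * qCoord j k = qCoord i k := fun i j y h k => by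
    rw [← bary_F, ← bary_q T, h]
  rcases fin_six_cases e with rfl | rfl | rfl | rfl | rfl | rfl
  · obtain ⟨y, hy, hyx⟩ := hx
    have hn := bary_nonneg hy 1
    rcases hV with rfl | rfl | rfl
    · have := coord _ 1 hyx 1; norm_num at this; linarith
    · exact ⟨q T 1, by simp [graph, boundarySet_zero], F_q T 1⟩
    · have := coord _ 1 hyx 1; norm_num at this; linarith
  · rw [piece_one] at hx
    rcases hV with rfl | rfl | rfl
    · exact ⟨q T 0, by simp [graph, boundarySet_one], rfl⟩
    · have := bary_one_le hx; rw [bary_q] at this; norm_num at this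
    · exact ⟨q T 2, by simp [graph, boundarySet_one], rfl⟩
  · obtain ⟨y, hy, hyx⟩ := hx
    have hn := bary_nonneg hy 0
    rcases hV with rfl | rfl | rfl
    · exact ⟨q T 0, by simp [graph, boundarySet_zero], F_q T 0⟩
    · have := coord _ 0 hyx 0; norm_num at this; linarith
    · have := coord _ 0 hyx 0; norm_num at this; linarith
  · obtain ⟨y, hy, hyx⟩ := hx
    have hn := bary_nonneg hy 2
    rcases hV with rfl | rfl | rfl
    · have := coord _ 2 hyx 2; simp at this; linarith
    · exact ⟨q T 2, by simp [graph, boundarySet_zero], F_q T 2⟩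
    · have := coord _ 2 hyx 2; simp at this; linarith
  · obtain ⟨y, hy, hyx⟩ := hx
    have hn := bary_nonneg hy 2
    have hn' := bary_nonneg hy 0
    rcases hV with rfl | rfl | rfl
    · have := coord _ 4 hyx 2; simp at this; linarith
    · have := coord _ 4 hyx 0; norm_num at this; linarith
    · have := coord _ 4 hyx 2; simp at this; linarith
  · obtain ⟨y, hy, hyx⟩ := hx
    have hn := bary_nonneg (K_one_subset hy) 1
    rcases hV with rfl | rfl | rfl
    · have := coord _ 3 hyx 1; norm_num at this; linarith
    · have := coord _ 3 hyx 1; norm_num at this; linarith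
    · exact ⟨q T 3, by simp [graph, boundarySet_one], F_q T 3⟩

end OpenGasket

/-! ### Walks -/

namespace GraphDirected

variable {X S E : Type} [MetricSpace X] (G : GraphDirected X S E)

theorem isWalk_append (s : S) (w w' : List E) :
    G.IsWalk s (w ++ w') ↔ G.IsWalk s w ∧ G.IsWalk (G.endState s w) w' := by
  induction w generalizing s with
  | nil => simp [IsWalk, endState]
  | cons e w ih => simp [IsWalk, endState, ih, and_assoc]

theorem endState_append (s : S) (w w' : List E) :
    G.endState s (w ++ w') = G.endState (G.endState s w) w' := by
  induction w generalizing s with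
  | nil => rfl
  | cons e w ih => simp [endState, ih]

theorem walkSim_nil : G.walkSim [] = 1 := rfl

theorem walkSim_cons (e : E) (w : List E) : G.walkSim (e :: w) = G.sim e * G.walkSim w := by
  simp [walkSim]

theorem walkSim_append (w w' : List E) : G.walkSim (w ++ w') = G.walkSim w * G.walkSim w' := by
  simp [walkSim]

theorem walkSim_singleton (e : E) : G.walkSim [e] = G.sim e := by simp [walkSim]

theorem phi_image_walkSim (w w' : G.nested.Idx) (A : Set X) :
    G.nested.phi w w' '' (G.walkSim w.1 '' A) = G.walkSim w'.1 '' A := by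
  rw [← Set.image_comp, ← DilationEquiv.coe_mul]
  simp [nested]

theorem isAncestor_iff (w w' : G.nested.Idx) :
    G.nested.IsAncestor w w' ↔ ∃ u, u ≠ [] ∧ w'.1 = w.1 ++ u := by
  constructor
  · intro h
    induction h with
    | single h => obtain ⟨e, he⟩ := h; exact ⟨[e], by simp, he⟩
    | tail _ h ih =>
      obtain ⟨u, hu, hu'⟩ := ih
      obtain ⟨e, he⟩ := h
      exact ⟨u ++ [e], by simp, by rw [he, hu', List.append_assoc]⟩
  · rintro ⟨u, hu, hw⟩
    induction u using List.reverseRecOn generalizing w' with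
    | nil => exact absurd rfl hu
    | append_singleton u e ih =>
      have hwalk : G.IsWalk G.start (w.1 ++ u) := by
        have := w'.2
        rw [hw, ← List.append_assoc, isWalk_append] at this
        exact this.1
      have hchild : w' ∈ G.nested.children ⟨w.1 ++ u, hwalk⟩ :=
        ⟨e, by rw [hw, List.append_assoc]⟩
      by_cases hu' : u = []
      · subst hu'
        refine Relation.TransGen.single ?_
        obtain ⟨w, h⟩ := w
        simpa using hchild
      · exact Relation.TransGen.tail (ih ⟨w.1 ++ u, hwalk⟩ hu' rfl) hchild

end GraphDirected

/-! ### The islands as a nested structure -/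

namespace OpenGasket

variable {T : Affine.Triangle ℝ Plane}

theorem K_nontrivial (s : Fin 2) : (K T s).Nontrivial := by
  have hne : q T 0 ≠ q T 2 := (q_injective T).ne (by decide)
  rcases fin_two_cases s with rfl | rfl
  · exact ⟨_, q_mem 0, _, q_mem 2, hne⟩
  · exact ⟨_, q_zero_mem, _, q_two_mem, hne⟩

theorem K_compact (s : Fin 2) : IsCompact (K T s) := by
  rcases fin_two_cases s with rfl | rfl
  · exact K_zero_compact T
  · exact K_one_compact T

theorem K_connected (s : Fin 2) : IsConnected (K T s) := by
  rcases fin_two_cases s with rfl | rfl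
  · exact K_zero_connected T
  · exact K_one_connected T

theorem exists_other_edge (e : Fin 6) : ∃ e' ≠ e, (graph T).init e' = (graph T).init e := by
  rcases fin_six_cases e with rfl | rfl | rfl | rfl | rfl | rfl
  · exact ⟨1, by decide, rfl⟩
  · exact ⟨0, by decide, rfl⟩
  · exact ⟨3, by decide, rfl⟩
  · exact ⟨2, by decide, rfl⟩
  · exact ⟨3, by decide, rfl⟩
  · exact ⟨3, by decide, rfl⟩

variable (T) in
/-- The set `ψ_w K_{f(w)}` of a walk `w` starting at `s`. -/
noncomputable def walkIsland (s : Fin 2) (w : List (Fin 6)) : Set Plane :=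
  (graph T).walkSim w '' K T ((graph T).endState s w)

theorem walkIsland_nil (s : Fin 2) : walkIsland T s [] = K T s := Set.image_id _

theorem walkIsland_cons (s : Fin 2) (e : Fin 6) (w : List (Fin 6)) :
    walkIsland T s (e :: w) = (graph T).sim e '' walkIsland T ((graph T).fin e) w := by
  rw [walkIsland, GraphDirected.walkSim_cons, DilationEquiv.coe_mul, Set.image_comp]
  rfl

theorem walkIsland_subset {s : Fin 2} {w : List (Fin 6)} (hw : (graph T).IsWalk s w) :
    walkIsland T s w ⊆ K T s := by
  induction w generalizing s with
  | nil => rw [walkIsland_nil]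
  | cons e w ih =>
    obtain ⟨rfl, hw⟩ := hw
    rw [walkIsland_cons]
    exact (Set.image_mono (ih hw)).trans (piece_subset e)

theorem walkIsland_cons_subset {s : Fin 2} {e : Fin 6} {w : List (Fin 6)}
    (hw : (graph T).IsWalk s (e :: w)) : walkIsland T s (e :: w) ⊆ piece T e := by
  rw [walkIsland_cons]
  exact Set.image_mono (walkIsland_subset hw.2)

theorem walkIsland_nontrivial (s : Fin 2) (w : List (Fin 6)) : (walkIsland T s w).Nontrivial :=
  (K_nontrivial _).image ((graph T).walkSim w).injective

theorem piece_nontrivial (e : Fin 6) : (piece T e).Nontrivial :=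
  (K_nontrivial _).image ((graph T).sim e).injective

/-- Otherwise a sibling piece would lie in a one-point intersection, although no piece is a
singleton. -/
theorem not_K_subset_piece (e : Fin 6) : ¬ K T ((graph T).init e) ⊆ piece T e := by
  intro h
  obtain ⟨e', hne, hi⟩ := exists_other_edge (T := T) e
  obtain ⟨p, -, hp⟩ := piece_inter' hne hi
  have : piece T e' ⊆ {p} := fun x hx => hp ⟨hx, h (hi ▸ piece_subset e' hx)⟩
  exact (piece_nontrivial e').not_subset_singleton this

/-- Cancel common first edges. Islands behind different first edges share at most one point, and a
proper piece never fills the whole set. -/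
theorem walkIsland_injective {s : Fin 2} {w w' : List (Fin 6)} (hw : (graph T).IsWalk s w)
    (hw' : (graph T).IsWalk s w') (h : walkIsland T s w = walkIsland T s w') : w = w' := by
  induction w generalizing s w' with
  | nil =>
    cases w' with
    | nil => rfl
    | cons e w' =>
      obtain ⟨rfl, hw''⟩ := id hw'
      rw [walkIsland_nil] at h
      exact absurd (h ▸ walkIsland_cons_subset hw') (not_K_subset_piece e)
  | cons e w ih =>
    cases w' with
    | nil =>
      obtain ⟨rfl, hw''⟩ := id hw
      rw [walkIsland_nil] at h
      exact absurd (h ▸ walkIsland_cons_subset hw) (not_K_subset_piece e)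
    | cons e' w' =>
      by_cases hee : e = e'
      · subst hee
        rw [walkIsland_cons, walkIsland_cons] at h
        rw [ih hw.2 hw'.2 (((graph T).sim e).injective.image_injective h)]
      · obtain ⟨p, -, hp⟩ := piece_inter' hee (hw.1.trans hw'.1.symm)
        refine absurd (fun x hx => hp ⟨walkIsland_cons_subset hw hx,
          walkIsland_cons_subset hw' (h ▸ hx)⟩) (walkIsland_nontrivial s (e :: w)).not_subset_singleton

variable (T) in
/-- The nested structure of the gasket. -/
noncomputable abbrev nested : NestedStructure Plane := (graph T).nested

/-- The walk `we`. -/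
noncomputable def extend (w : (nested T).Idx) (e : Fin 6)
    (he : (graph T).init e = (graph T).endState 0 w.1) : (nested T).Idx :=
  ⟨w.1 ++ [e], (GraphDirected.isWalk_append _ _ _ _).2 ⟨w.2, he, trivial⟩⟩

theorem mem_children_iff (w w' : (nested T).Idx) :
    w' ∈ (nested T).children w ↔
      ∃ e, ∃ he : (graph T).init e = (graph T).endState 0 w.1, w' = extend w e he := by
  constructor
  · rintro ⟨e, he⟩
    have h := w'.2
    rw [he, GraphDirected.isWalk_append] at h
    exact ⟨e, h.2.1, Subtype.ext he⟩
  · rintro ⟨e, -, rfl⟩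
    exact ⟨e, rfl⟩

theorem island_extend (w : (nested T).Idx) (e : Fin 6)
    (he : (graph T).init e = (graph T).endState 0 w.1) :
    (nested T).island (extend w e he) = (graph T).walkSim w.1 '' piece T e := by
  change (graph T).walkSim (w.1 ++ [e]) '' K T ((graph T).endState 0 (w.1 ++ [e])) = _
  rw [GraphDirected.walkSim_append, GraphDirected.endState_append, GraphDirected.walkSim_singleton,
    DilationEquiv.coe_mul, Set.image_comp]
  rfl

/-- Conjugating a similitude of islands by the maps of the two walks gives one between the sets of
the final states, so `not_similar` decides. -/
theorem similar_iff (hT : T.Equilateral) (w w' : (nested T).Idx) :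
    (nested T).Similar w w' ↔ (graph T).endState 0 w.1 = (graph T).endState 0 w'.1 := by
  constructor
  · rintro ⟨f, hf⟩
    change f '' ((graph T).walkSim w.1 '' K T ((graph T).endState 0 w.1)) =
      (graph T).walkSim w'.1 '' K T ((graph T).endState 0 w'.1) at hf
    have key : (((graph T).walkSim w'.1)⁻¹ * f * (graph T).walkSim w.1) ''
        K T ((graph T).endState 0 w.1) = K T ((graph T).endState 0 w'.1) := by
      rw [mul_assoc, DilationEquiv.coe_mul, DilationEquiv.coe_mul, Set.image_comp, Set.image_comp,
        hf, ← Set.image_comp, ← DilationEquiv.coe_mul, inv_mul_cancel, DilationEquiv.coe_one,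
        Set.image_id]
    rcases fin_two_cases ((graph T).endState 0 w.1) with h | h <;>
      rcases fin_two_cases ((graph T).endState 0 w'.1) with h' | h' <;> rw [h, h'] at key ⊢
    · exact absurd key (not_similar hT _)
    · refine absurd ?_ (not_similar hT (((graph T).walkSim w'.1)⁻¹ * f * (graph T).walkSim w.1)⁻¹)
      rw [← key, ← Set.image_comp, ← DilationEquiv.coe_mul, inv_mul_cancel, DilationEquiv.coe_one,
        Set.image_id]
  · intro h
    refine ⟨(nested T).phi w w', ?_⟩
    change (nested T).phi w w' '' ((graph T).walkSim w.1 '' K T ((graph T).endState 0 w.1)) =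
      (graph T).walkSim w'.1 '' K T ((graph T).endState 0 w'.1)
    rw [GraphDirected.phi_image_walkSim, h]

variable (T) in
theorem nested_island_injective : Function.Injective (nested T).island := fun w w' h =>
  Subtype.ext (walkIsland_injective w.2 w'.2 h)

variable (T) in
theorem isNested : (nested T).IsNested where
  countable := by
    change Countable {w : List (Fin 6) // (graph T).IsWalk 0 w}
    infer_instance
  distinct := nested_island_injective T
  compact w := (K_compact _).image (Dilation.lipschitz ((graph T).walkSim w.1)).continuous
  connected w := (K_connected _).image _
    (Dilation.lipschitz ((graph T).walkSim w.1)).continuous.continuousOn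
  nontrivial w := walkIsland_nontrivial 0 w.1
  children_finite w := by
    refine ((Set.finite_range fun e : Fin 6 => w.1 ++ [e]).preimage
      (Subtype.val_injective.injOn)).subset ?_
    rintro w' ⟨e, he⟩
    exact ⟨e, he.symm⟩
  two_le_children w := by
    have hfin : ((nested T).children w).Finite := by
      refine ((Set.finite_range fun e : Fin 6 => w.1 ++ [e]).preimage
        (Subtype.val_injective.injOn)).subset ?_
      rintro w' ⟨e, he⟩
      exact ⟨e, he.symm⟩
    change 1 < _
    rw [Set.one_lt_ncard hfin]
    obtain ⟨e, he⟩ : ∃ e, (graph T).init e = (graph T).endState 0 w.1 := by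
      rcases fin_two_cases ((graph T).endState 0 w.1) with h | h <;> rw [h]
      · exact ⟨0, rfl⟩
      · exact ⟨2, rfl⟩
    obtain ⟨e', hne, he'⟩ := exists_other_edge (T := T) e
    refine ⟨extend w e he, ⟨e, rfl⟩, extend w e' (he'.trans he), ⟨e', rfl⟩, fun h => hne ?_⟩
    have := congrArg Subtype.val h
    simpa [extend] using this.symm
  island_eq w := by
    change (graph T).walkSim w.1 '' K T ((graph T).endState 0 w.1) = _
    rw [K_eq_iUnion_piece, Set.image_iUnion₂]
    ext x
    simp only [Set.mem_iUnion, exists_prop]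
    constructor
    · rintro ⟨e, he, hx⟩
      exact ⟨extend w e he, ⟨e, rfl⟩, by rwa [island_extend]⟩
    · rintro ⟨w', hw', hx⟩
      obtain ⟨e, he, rfl⟩ := (mem_children_iff _ _).1 hw'
      exact ⟨e, he, by rwa [island_extend] at hx⟩
  offspring w hw := by
    rw [GraphDirected.isAncestor_iff]
    refine ⟨w.1, fun h => hw (Subtype.ext h), rfl⟩

/-! ### Boundaries -/

theorem crossing_subset (w : (nested T).Idx) :
    (nested T).crossing w ⊆ (graph T).walkSim w.1 '' crossingSet T ((graph T).endState 0 w.1) := by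
  intro x hx
  simp only [NestedStructure.crossing, Set.mem_iUnion] at hx
  obtain ⟨v, hv, v', hv', hne, hx, hx'⟩ := hx
  obtain ⟨e, he, rfl⟩ := (mem_children_iff _ _).1 hv
  obtain ⟨e', he', rfl⟩ := (mem_children_iff _ _).1 hv'
  rw [island_extend] at hx hx'
  obtain ⟨y, hy, rfl⟩ := hx
  obtain ⟨y', hy', h⟩ := hx'
  obtain rfl := ((graph T).walkSim w.1).injective h
  have hee : e ≠ e' := by rintro rfl; exact hne rfl
  obtain ⟨p, hp, hsub⟩ := piece_inter' hee (he.trans he'.symm)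
  obtain rfl : y' = p := hsub ⟨hy, hy'⟩
  exact ⟨y', he ▸ hp, rfl⟩

theorem mem_crossing (w : (nested T).Idx) {e e' : Fin 6} (hee : e ≠ e')
    (he : (graph T).init e = (graph T).endState 0 w.1)
    (he' : (graph T).init e' = (graph T).endState 0 w.1) {x : Plane} (hx : x ∈ piece T e)
    (hx' : x ∈ piece T e') : (graph T).walkSim w.1 x ∈ (nested T).crossing w := by
  simp only [NestedStructure.crossing, Set.mem_iUnion]
  refine ⟨extend w e he, ⟨e, rfl⟩, extend w e' he', ⟨e', rfl⟩, fun h => hee ?_, ?_, ?_⟩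
  · have := congrArg Subtype.val h
    simpa [extend] using this
  · rw [island_extend]; exact ⟨x, hx, rfl⟩
  · rw [island_extend]; exact ⟨x, hx', rfl⟩

theorem boundarySet_walk {s : Fin 2} {w : List (Fin 6)} (hw : (graph T).IsWalk s w) {x : Plane}
    (hV : x ∈ boundarySet T s) (hx : x ∈ walkIsland T s w) :
    x ∈ (graph T).walkSim w '' boundarySet T ((graph T).endState s w) := by
  induction w generalizing s x with
  | nil => exact ⟨x, hV, rfl⟩
  | cons e w ih =>
    obtain ⟨rfl, hw'⟩ := id hw
    obtain ⟨y, hy, rfl⟩ := boundarySet_inter hV (walkIsland_cons_subset hw hx)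
    rw [walkIsland_cons, ((graph T).sim e).injective.mem_set_image] at hx
    rw [GraphDirected.walkSim_cons, DilationEquiv.coe_mul, Set.image_comp]
    exact ⟨y, ih hw' hy hx, rfl⟩

/-- The first edge turns a crossing point into a boundary candidate; the later edges keep it one. -/
theorem crossingSet_walk {s : Fin 2} {w : List (Fin 6)} (hw : (graph T).IsWalk s w) (hne : w ≠ [])
    {x : Plane} (hC : x ∈ crossingSet T s) (hx : x ∈ walkIsland T s w) :
    x ∈ (graph T).walkSim w '' boundarySet T ((graph T).endState s w) := by
  cases w with
  | nil => exact absurd rfl hne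
  | cons e w =>
    obtain ⟨rfl, hw'⟩ := id hw
    obtain ⟨y, hy, rfl⟩ := crossingSet_inter hC (walkIsland_cons_subset hw hx)
    rw [walkIsland_cons, ((graph T).sim e).injective.mem_set_image] at hx
    rw [GraphDirected.walkSim_cons, DilationEquiv.coe_mul, Set.image_comp]
    exact ⟨y, boundarySet_walk hw' hy hx, rfl⟩

/-- Pulling back by the map of the ancestor leaves a crossing point of its state to be followed
along the rest of the walk. -/
theorem island_inter_crossing {γ w : (nested T).Idx} (h : (nested T).IsAncestor γ w) :
    (nested T).island w ∩ (nested T).crossing γ ⊆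
      (graph T).walkSim w.1 '' boundarySet T ((graph T).endState 0 w.1) := by
  obtain ⟨u, hu, hw⟩ := (GraphDirected.isAncestor_iff _ _ _).1 h
  rintro x ⟨hx, hxC⟩
  obtain ⟨y, hy, rfl⟩ := crossing_subset γ hxC
  have hwalk := w.2
  rw [hw, GraphDirected.isWalk_append] at hwalk
  have hy' : y ∈ walkIsland T ((graph T).endState 0 γ.1) u := by
    change (graph T).walkSim γ.1 y ∈ (graph T).walkSim w.1 '' K T ((graph T).endState 0 w.1) at hx
    rw [hw, GraphDirected.walkSim_append, GraphDirected.endState_append, DilationEquiv.coe_mul,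
      Set.image_comp, ((graph T).walkSim γ.1).injective.mem_set_image] at hx
    exact hx
  rw [hw, GraphDirected.walkSim_append, GraphDirected.endState_append, DilationEquiv.coe_mul,
    Set.image_comp]
  exact ⟨y, crossingSet_walk hwalk.2 hu hy hy', rfl⟩

theorem boundary_subset (hT : T.Equilateral) (w : (nested T).Idx) :
    (nested T).boundary w ⊆
      (graph T).walkSim w.1 '' boundarySet T ((graph T).endState 0 w.1) := by
  intro x hx
  simp only [NestedStructure.boundary, Set.mem_iUnion] at hx
  obtain ⟨v, hsim, -, y, ⟨hy, hC⟩, rfl⟩ := hx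
  simp only [Set.mem_iUnion] at hC
  obtain ⟨γ, hγ, hC⟩ := hC
  rw [← (similar_iff hT v w).1 hsim, ← GraphDirected.phi_image_walkSim (graph T) v w]
  exact ⟨y, island_inter_crossing hγ ⟨hy, hC⟩, rfl⟩

theorem boundarySet_finite (s : Fin 2) : (boundarySet T s).Finite := by
  rcases fin_two_cases s with rfl | rfl
  · rw [boundarySet_zero]; exact Set.toFinite _
  · rw [boundarySet_one]; exact Set.toFinite _

/-- The islands of the gasket form a finitely ramified nested structure of finite type. -/
theorem isFRFT (hT : T.Equilateral) : (nested T).IsFRFT where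
  nested := isNested T
  phi_image w w' h := by
    change (nested T).phi w w' '' ((graph T).walkSim w.1 '' K T ((graph T).endState 0 w.1)) =
      (graph T).walkSim w'.1 '' K T ((graph T).endState 0 w'.1)
    rw [GraphDirected.phi_image_walkSim, (similar_iff hT w w').1 h]
  phi_self w := mul_inv_cancel _
  phi_comp w w' v _ _ := by
    change (graph T).walkSim w'.1 * ((graph T).walkSim v.1)⁻¹ *
      ((graph T).walkSim v.1 * ((graph T).walkSim w.1)⁻¹) =
      (graph T).walkSim w'.1 * ((graph T).walkSim w.1)⁻¹
    group
  finite_types := by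
    refine (Set.finite_range fun s : Fin 2 =>
      {w : (nested T).Idx | s = (graph T).endState 0 w.1}).subset ?_
    rintro _ ⟨w, rfl⟩
    exact ⟨(graph T).endState 0 w.1, Set.ext fun v => (similar_iff hT w v).symm⟩
  same_split w w' h v hv := by
    obtain ⟨e, he, rfl⟩ := (mem_children_iff _ _).1 hv
    have hs := (similar_iff hT w w').1 h
    have hphi : ∀ e' he', (nested T).phi (extend w e he) (extend w' e' he') =
        (graph T).walkSim w'.1 * ((graph T).sim e' * ((graph T).sim e)⁻¹) *
          ((graph T).walkSim w.1)⁻¹ := by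
      intro e' he'
      change (graph T).walkSim (w'.1 ++ [e']) * ((graph T).walkSim (w.1 ++ [e]))⁻¹ = _
      rw [GraphDirected.walkSim_append, GraphDirected.walkSim_append,
        GraphDirected.walkSim_singleton, GraphDirected.walkSim_singleton]
      group
    have hsim : (nested T).Similar (extend w e he) (extend w' e (he.trans hs)) := by
      rw [similar_iff hT]
      change (graph T).endState 0 (w.1 ++ [e]) = (graph T).endState 0 (w'.1 ++ [e])
      rw [GraphDirected.endState_append, GraphDirected.endState_append]
      rfl
    have himg : ∀ v v', (nested T).Similar v v' →
        (nested T).phi v v' '' (nested T).island v = (nested T).island v' := fun v v' h => by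
      change (nested T).phi v v' '' ((graph T).walkSim v.1 '' K T ((graph T).endState 0 v.1)) =
        (graph T).walkSim v'.1 '' K T ((graph T).endState 0 v'.1)
      rw [GraphDirected.phi_image_walkSim, (similar_iff hT v v').1 h]
    have heq : (nested T).phi (extend w e he) (extend w' e (he.trans hs)) =
        (nested T).phi w w' := by
      rw [hphi, mul_inv_cancel, mul_one]; rfl
    refine ⟨extend w' e (he.trans hs), ⟨⟨e, rfl⟩, hsim, heq⟩, ?_⟩
    -- Two children reached by the same similitude have the same island, hence are equal.
    rintro v' ⟨-, hv', hv''⟩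
    apply nested_island_injective T
    rw [← himg _ _ hv', ← himg _ _ hsim, hv'', heq]
  finite_boundary w := ((boundarySet_finite _).image _).subset (boundary_subset hT w)

/-- To exhibit a boundary point it suffices to see it in any similar island `v`, at a crossing of an
ancestor `γ` of `v`; `phi` carries it back to `w`. -/
theorem mem_boundary (hT : T.Equilateral) (w v γ : (nested T).Idx) {x : Plane}
    (hs : (graph T).endState 0 v.1 = (graph T).endState 0 w.1) (hv : v.1 ≠ [])
    (hγ : ∃ u, u ≠ [] ∧ v.1 = γ.1 ++ u)
    (hx : (graph T).walkSim v.1 x ∈ (nested T).island v)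
    (hC : (graph T).walkSim v.1 x ∈ (nested T).crossing γ) :
    (graph T).walkSim w.1 x ∈ (nested T).boundary w := by
  simp only [NestedStructure.boundary, Set.mem_iUnion]
  refine ⟨v, (similar_iff hT v w).2 hs, fun h => hv (congrArg Subtype.val h),
    (graph T).walkSim v.1 x, ⟨hx, ?_⟩, ?_⟩
  · simp only [Set.mem_iUnion]
    exact ⟨γ, (GraphDirected.isAncestor_iff _ _ _).2 hγ, hC⟩
  · change ((graph T).walkSim w.1 * ((graph T).walkSim v.1)⁻¹) ((graph T).walkSim v.1 x) = _
    rw [← Function.comp_apply (f := ((graph T).walkSim w.1 * ((graph T).walkSim v.1)⁻¹ : _ ≃ᵈ _)),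
      ← DilationEquiv.coe_mul, inv_mul_cancel_right]

theorem boundary_graph_subset (hT : T.Equilateral) (s : Fin 2) :
    (graph T).boundary s ⊆ boundarySet T s := by
  intro x hx
  obtain ⟨h, hx⟩ := Set.mem_iUnion.1 hx
  obtain ⟨y, hy, rfl⟩ := boundary_subset hT _ hx
  rcases fin_two_cases s with rfl | rfl
  · exact hy
  · exact hy

/-- The first vertex is seen where the half-size copy meets `K T 1`; the other two are seen in the
corner copy of `F T 0`, at its junctions with the copies of `F T 3` and `F T 4`. -/
theorem boundary_zero (hT : T.Equilateral) : (graph T).boundary 0 = {q T 0, q T 1, q T 2} := by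
  refine (boundary_graph_subset hT 0).antisymm ?_
  have hroot : (graph T).IsWalk (graph T).start ((graph T).rep 0) := trivial
  have h0 : (graph T).IsWalk 0 [0] := ⟨rfl, trivial⟩
  have h1 : (graph T).IsWalk 0 [1] := ⟨rfl, trivial⟩
  have h12 : (graph T).IsWalk 0 [1, 2] := ⟨rfl, rfl, trivial⟩
  rintro x (rfl | rfl | rfl) <;> refine Set.mem_iUnion.2 ⟨hroot, ?_⟩
  · refine mem_boundary hT ⟨[], trivial⟩ ⟨[0], h0⟩ ⟨[], trivial⟩ (x := q T 0) rfl (by simp)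
      ⟨[0], by simp, rfl⟩ ⟨_, q_mem 0, rfl⟩ ?_
    refine mem_crossing ⟨[], trivial⟩ (e := 0) (e' := 1) (by decide) rfl rfl (x := F T 1 (q T 0))
      ⟨_, q_mem 0, rfl⟩ ?_
    rw [piece_one, F_one_q_zero]; exact q_three_mem
  · refine mem_boundary hT ⟨[], trivial⟩ ⟨[1, 2], h12⟩ ⟨[1], h1⟩ (x := q T 1) rfl (by simp)
      ⟨[2], by simp, rfl⟩ ⟨_, q_mem 1, rfl⟩ ?_
    exact mem_crossing ⟨[1], h1⟩ (e := 2) (e' := 5) (by decide) rfl rfl (x := F T 0 (q T 1))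
      ⟨_, q_mem 1, rfl⟩ ⟨_, q_zero_mem, (F_zero_q_one T).symm⟩
  · refine mem_boundary hT ⟨[], trivial⟩ ⟨[1, 2], h12⟩ ⟨[1], h1⟩ (x := q T 2) rfl (by simp)
      ⟨[2], by simp, rfl⟩ ⟨_, q_mem 2, rfl⟩ ?_
    exact mem_crossing ⟨[1], h1⟩ (e := 2) (e' := 4) (by decide) rfl rfl (x := F T 0 (q T 2))
      ⟨_, q_mem 2, rfl⟩ ⟨_, q_mem 0, (F_zero_q_two T).symm⟩

/-- Two points are junctions of the copy `F T 3 '' K T 1` with its siblings; `q T 3` is the crossing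
at the root. -/
theorem boundary_one (hT : T.Equilateral) : (graph T).boundary 1 = {q T 0, q T 2, q T 3} := by
  refine (boundary_graph_subset hT 1).antisymm ?_
  have h1 : (graph T).IsWalk 0 [1] := ⟨rfl, trivial⟩
  have h15 : (graph T).IsWalk 0 [1, 5] := ⟨rfl, rfl, trivial⟩
  rintro x (rfl | rfl | rfl) <;> refine Set.mem_iUnion.2 ⟨h1, ?_⟩
  · refine mem_boundary hT ⟨[1], h1⟩ ⟨[1, 5], h15⟩ ⟨[1], h1⟩ (x := q T 0) rfl (by simp)
      ⟨[5], by simp, rfl⟩ ⟨_, q_zero_mem, rfl⟩ ?_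
    exact mem_crossing ⟨[1], h1⟩ (e := 5) (e' := 2) (by decide) rfl rfl (x := F T 3 (q T 0))
      ⟨_, q_zero_mem, rfl⟩ ⟨_, q_mem 1, F_zero_q_one T⟩
  · refine mem_boundary hT ⟨[1], h1⟩ ⟨[1, 5], h15⟩ ⟨[1], h1⟩ (x := q T 2) rfl (by simp)
      ⟨[5], by simp, rfl⟩ ⟨_, q_two_mem, rfl⟩ ?_
    exact mem_crossing ⟨[1], h1⟩ (e := 5) (e' := 4) (by decide) rfl rfl (x := F T 3 (q T 2))
      ⟨_, q_two_mem, rfl⟩ ⟨_, q_mem 1, (F_three_q_two T).symm⟩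
  · refine mem_boundary hT ⟨[1], h1⟩ ⟨[1], h1⟩ ⟨[], trivial⟩ (x := q T 3) rfl (by simp)
      ⟨[1], by simp, rfl⟩ ⟨_, q_three_mem, rfl⟩ ?_
    refine mem_crossing ⟨[], trivial⟩ (e := 1) (e' := 0) (by decide) rfl rfl (x := q T 3)
      ?_ ⟨_, q_mem 0, F_one_q_zero T⟩
    rw [piece_one]; exact q_three_mem

end OpenGasket

/-! ### Resistor networks with three terminals -/

/-- The bilinear form of the `Y`-shaped network with resistances `R` (which may vanish at one
terminal). -/
noncomputable def triForm (R u v : Fin 3 → ℝ) : ℝ :=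
  (R 2 * (u 0 - u 1) * (v 0 - v 1) + R 1 * (u 0 - u 2) * (v 0 - v 2) +
    R 0 * (u 1 - u 2) * (v 1 - v 2)) / (R 0 * R 1 + R 0 * R 2 + R 1 * R 2)

/-- Nonnegative resistances at most one of which vanishes. -/
structure Admissible (R : Fin 3 → ℝ) : Prop where
  nonneg : ∀ i, 0 ≤ R i
  disc_pos : 0 < R 0 * R 1 + R 0 * R 2 + R 1 * R 2

/-- The matrix `H` on the three points `e 0, e 1, e 2` is the Laplacian of the `Y`-shaped network
with resistances `R`. -/
structure HasResistances {V : Type} (e : Fin 3 ≃ V) (H : Matrix V V ℝ) (R : Fin 3 → ℝ) : Prop where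
  symm : H.IsSymm
  off_zero_one : H (e 0) (e 1) = R 2 / (R 0 * R 1 + R 0 * R 2 + R 1 * R 2)
  off_zero_two : H (e 0) (e 2) = R 1 / (R 0 * R 1 + R 0 * R 2 + R 1 * R 2)
  off_one_two : H (e 1) (e 2) = R 0 / (R 0 * R 1 + R 0 * R 2 + R 1 * R 2)
  row_sum : ∀ x, ∑ i, H x (e i) = 0

namespace Admissible

variable {R : Fin 3 → ℝ}

theorem add_pos (hR : Admissible R) :
    0 < R 0 + R 1 ∧ 0 < R 0 + R 2 ∧ 0 < R 1 + R 2 := by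
  have h0 := hR.nonneg 0
  have h1 := hR.nonneg 1
  have h2 := hR.nonneg 2
  have hd := hR.disc_pos
  refine ⟨?_, ?_, ?_⟩ <;> by_contra hcon
  · have e0 : R 0 = 0 := by linarith
    have e1 : R 1 = 0 := by linarith
    rw [e0, e1] at hd; norm_num at hd
  · have e0 : R 0 = 0 := by linarith
    have e1 : R 2 = 0 := by linarith
    rw [e0, e1] at hd; norm_num at hd
  · have e0 : R 1 = 0 := by linarith
    have e1 : R 2 = 0 := by linarith
    rw [e0, e1] at hd; norm_num at hd

theorem of_pos (h : ∀ i, 0 < R i) : Admissible R := by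
  have h0 := h 0
  have h1 := h 1
  have h2 := h 2
  exact ⟨fun i => (h i).le, by positivity⟩

theorem triForm_nonneg (hR : Admissible R) (u : Fin 3 → ℝ) : 0 ≤ triForm R u u := by
  have h0 := hR.nonneg 0
  have h1 := hR.nonneg 1
  have h2 := hR.nonneg 2
  refine div_nonneg ?_ hR.disc_pos.le
  have e : ∀ a b c : ℝ, a * (b - c) * (b - c) = a * (b - c) ^ 2 := fun a b c => by ring
  rw [e, e, e]
  positivity

/-- Currents which are compatible with the potential `u` represent the form. -/
theorem triForm_eq (hR : Admissible R) {c : ℝ} (hc : 0 < c) {u J : Fin 3 → ℝ}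
    (hJ : J 0 + J 1 + J 2 = 0) (h1 : u 0 - u 1 = c * (R 0 * J 0 - R 1 * J 1))
    (h2 : u 0 - u 2 = c * (R 0 * J 0 - R 2 * J 2)) (v : Fin 3 → ℝ) :
    c⁻¹ * triForm R u v = v 0 * J 0 + v 1 * J 1 + v 2 * J 2 := by
  have hd := hR.disc_pos.ne'
  have h3 : u 1 - u 2 = c * (R 1 * J 1 - R 2 * J 2) := by linarith
  have hJ2 : J 2 = -J 0 - J 1 := by linarith
  rw [triForm, h1, h2, h3, hJ2]
  generalize hD : R 0 * R 1 + R 0 * R 2 + R 1 * R 2 = D at hd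
  field_simp
  rw [← hD]
  ring

/-- Every potential has compatible currents. -/
theorem exists_current (hR : Admissible R) {c : ℝ} (hc : 0 < c) (u : Fin 3 → ℝ) :
    ∃ J : Fin 3 → ℝ, J 0 + J 1 + J 2 = 0 ∧ u 0 - u 1 = c * (R 0 * J 0 - R 1 * J 1) ∧
      u 0 - u 2 = c * (R 0 * J 0 - R 2 * J 2) ∧
      ∀ v : Fin 3 → ℝ, c⁻¹ * triForm R u v = v 0 * J 0 + v 1 * J 1 + v 2 * J 2 := by
  have hd := hR.disc_pos.ne'
  obtain ⟨J, hJ⟩ : ∃ J : Fin 3 → ℝ, J =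
      ![(R 2 * (u 0 - u 1) + R 1 * (u 0 - u 2)) / (R 0 * R 1 + R 0 * R 2 + R 1 * R 2) / c,
        (R 2 * (u 1 - u 0) + R 0 * (u 1 - u 2)) / (R 0 * R 1 + R 0 * R 2 + R 1 * R 2) / c,
        (R 1 * (u 2 - u 0) + R 0 * (u 2 - u 1)) / (R 0 * R 1 + R 0 * R 2 + R 1 * R 2) / c] :=
    ⟨_, rfl⟩
  have j0 : J 0 = (R 2 * (u 0 - u 1) + R 1 * (u 0 - u 2)) /
      (R 0 * R 1 + R 0 * R 2 + R 1 * R 2) / c := by rw [hJ]; rfl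
  have j1 : J 1 = (R 2 * (u 1 - u 0) + R 0 * (u 1 - u 2)) /
      (R 0 * R 1 + R 0 * R 2 + R 1 * R 2) / c := by rw [hJ]; rfl
  have j2 : J 2 = (R 1 * (u 2 - u 0) + R 0 * (u 2 - u 1)) /
      (R 0 * R 1 + R 0 * R 2 + R 1 * R 2) / c := by rw [hJ]; rfl
  clear hJ
  generalize hD : R 0 * R 1 + R 0 * R 2 + R 1 * R 2 = D at hd j0 j1 j2
  have e0 : J 0 + J 1 + J 2 = 0 := by rw [j0, j1, j2]; field_simp; ring
  have e1 : u 0 - u 1 = c * (R 0 * J 0 - R 1 * J 1) := by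
    rw [j0, j1]; field_simp; rw [← hD]; ring
  have e2 : u 0 - u 2 = c * (R 0 * J 0 - R 2 * J 2) := by
    rw [j0, j2]; field_simp; rw [← hD]; ring
  exact ⟨J, e0, e1, e2, hR.triForm_eq hc e0 e1 e2⟩

/-- The sum of the pairwise products of the conductances is the inverse of the common denominator,
which is thereby determined; the resistances follow. -/
theorem eq_of_conductances {R' : Fin 3 → ℝ} (hR : Admissible R) (hR' : Admissible R')
    (h2 : R 2 / (R 0 * R 1 + R 0 * R 2 + R 1 * R 2) =
      R' 2 / (R' 0 * R' 1 + R' 0 * R' 2 + R' 1 * R' 2))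
    (h1 : R 1 / (R 0 * R 1 + R 0 * R 2 + R 1 * R 2) =
      R' 1 / (R' 0 * R' 1 + R' 0 * R' 2 + R' 1 * R' 2))
    (h0 : R 0 / (R 0 * R 1 + R 0 * R 2 + R 1 * R 2) =
      R' 0 / (R' 0 * R' 1 + R' 0 * R' 2 + R' 1 * R' 2)) : R = R' := by
  have key : ∀ {S : Fin 3 → ℝ}, Admissible S →
      S 0 / (S 0 * S 1 + S 0 * S 2 + S 1 * S 2) * (S 1 / (S 0 * S 1 + S 0 * S 2 + S 1 * S 2)) +
      S 0 / (S 0 * S 1 + S 0 * S 2 + S 1 * S 2) * (S 2 / (S 0 * S 1 + S 0 * S 2 + S 1 * S 2)) +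
      S 1 / (S 0 * S 1 + S 0 * S 2 + S 1 * S 2) * (S 2 / (S 0 * S 1 + S 0 * S 2 + S 1 * S 2)) =
      (S 0 * S 1 + S 0 * S 2 + S 1 * S 2)⁻¹ := by
    intro S hS
    have := hS.disc_pos.ne'
    field_simp
  have hd : R 0 * R 1 + R 0 * R 2 + R 1 * R 2 = R' 0 * R' 1 + R' 0 * R' 2 + R' 1 * R' 2 := by
    rw [← inv_inj, ← key hR, ← key hR', h0, h1, h2]
  rw [hd] at h0 h1 h2
  have hne := hR'.disc_pos.ne'
  funext i
  rcases fin_three_cases i with rfl | rfl | rfl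
  · exact (div_left_inj' hne).1 h0
  · exact (div_left_inj' hne).1 h1
  · exact (div_left_inj' hne).1 h2

end Admissible

namespace HasResistances

variable {V : Type} {e : Fin 3 ≃ V} {H : Matrix V V ℝ} {R : Fin 3 → ℝ}

theorem finsum_eq (e : Fin 3 ≃ V) (g : V → ℝ) : ∑ᶠ x, g x = g (e 0) + g (e 1) + g (e 2) := by
  rw [← finsum_comp_equiv e, finsum_eq_sum_of_fintype, Fin.sum_univ_three]

theorem entries (h : HasResistances e H R) :
    H (e 1) (e 0) = H (e 0) (e 1) ∧ H (e 2) (e 0) = H (e 0) (e 2) ∧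
    H (e 2) (e 1) = H (e 1) (e 2) ∧ H (e 0) (e 0) = -H (e 0) (e 1) - H (e 0) (e 2) ∧
    H (e 1) (e 1) = -H (e 0) (e 1) - H (e 1) (e 2) ∧
    H (e 2) (e 2) = -H (e 0) (e 2) - H (e 1) (e 2) := by
  have s1 := h.symm.apply (e 0) (e 1)
  have s2 := h.symm.apply (e 0) (e 2)
  have s3 := h.symm.apply (e 1) (e 2)
  have r0 := h.row_sum (e 0)
  have r1 := h.row_sum (e 1)
  have r2 := h.row_sum (e 2)
  rw [Fin.sum_univ_three] at r0 r1 r2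
  exact ⟨s1, s2, s3, by linarith, by linarith, by linarith⟩

theorem discreteForm_eq (h : HasResistances e H R) (u v : V → ℝ) :
    discreteForm H u v = triForm R (fun i => u (e i)) (fun i => v (e i)) := by
  obtain ⟨h1, h2, h3, h4, h5, h6⟩ := h.entries
  simp only [discreteForm, finsum_eq e, h1, h2, h3, h4, h5, h6, h.off_zero_one, h.off_zero_two,
    h.off_one_two, triForm]
  ring

theorem unique {H' : Matrix V V ℝ} (h : HasResistances e H R) (h' : HasResistances e H' R) :
    H = H' := by
  obtain ⟨h1, h2, h3, h4, h5, h6⟩ := h.entries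
  obtain ⟨k1, k2, k3, k4, k5, k6⟩ := h'.entries
  ext x y
  obtain ⟨i, rfl⟩ := e.surjective x
  obtain ⟨j, rfl⟩ := e.surjective y
  rcases fin_three_cases i with rfl | rfl | rfl <;> rcases fin_three_cases j with rfl | rfl | rfl <;>
    simp only [h1, h2, h3, h4, h5, h6, k1, k2, k3, k4, k5, k6, h.off_zero_one, h.off_zero_two,
      h.off_one_two, h'.off_zero_one, h'.off_zero_two, h'.off_one_two]

theorem resistances_unique {R' : Fin 3 → ℝ} (hR : Admissible R) (hR' : Admissible R')
    (h : HasResistances e H R) (h' : HasResistances e H R') : R = R' :=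
  hR.eq_of_conductances hR' (h.off_zero_one.symm.trans h'.off_zero_one)
    (h.off_zero_two.symm.trans h'.off_zero_two) (h.off_one_two.symm.trans h'.off_one_two)

theorem isLaplacian (hpos : ∀ i, 0 < R i) (h : HasResistances e H R) : IsLaplacian H where
  finite := Finite.of_equiv _ e
  symm := h.symm
  nonneg_form u := by
    rw [h.discreteForm_eq]; exact (Admissible.of_pos hpos).triForm_nonneg _
  ker u := by
    have hd := (Admissible.of_pos hpos).disc_pos
    have h0 := hpos 0
    have h1 := hpos 1
    have h2 := hpos 2
    constructor
    · intro hu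
      have hz : discreteForm H u u = 0 := by
        rw [discreteForm, finsum_eq e, hu, hu, hu]; ring
      rw [h.discreteForm_eq, triForm, div_eq_zero_iff, or_iff_left hd.ne'] at hz
      have p1 := mul_nonneg h2.le (mul_self_nonneg (u (e 0) - u (e 1)))
      have p2 := mul_nonneg h1.le (mul_self_nonneg (u (e 0) - u (e 2)))
      have p3 := mul_nonneg h0.le (mul_self_nonneg (u (e 1) - u (e 2)))
      have z1 : R 2 * ((u (e 0) - u (e 1)) * (u (e 0) - u (e 1))) = 0 := by
        simp only [mul_assoc] at hz; linarith
      have z2 : R 1 * ((u (e 0) - u (e 2)) * (u (e 0) - u (e 2))) = 0 := by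
        simp only [mul_assoc] at hz; linarith
      have y1 := mul_self_eq_zero.1 ((mul_eq_zero.1 z1).resolve_left h2.ne')
      have y2 := mul_self_eq_zero.1 ((mul_eq_zero.1 z2).resolve_left h1.ne')
      refine ⟨u (e 0), fun x => ?_⟩
      obtain ⟨i, rfl⟩ := e.surjective x
      rcases fin_three_cases i with rfl | rfl | rfl
      · rfl
      · linarith
      · linarith
    · rintro ⟨c, hc⟩ x
      simp only [hc]
      have := h.row_sum x
      rw [Fin.sum_univ_three] at this
      rw [finsum_eq e, ← add_mul, ← add_mul, this, zero_mul]
  offdiag_nonneg x y hxy := by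
    have hd := (Admissible.of_pos hpos).disc_pos.le
    obtain ⟨h1, h2, h3, -, -, -⟩ := h.entries
    obtain ⟨i, rfl⟩ := e.surjective x
    obtain ⟨j, rfl⟩ := e.surjective y
    rcases fin_three_cases i with rfl | rfl | rfl <;>
      rcases fin_three_cases j with rfl | rfl | rfl <;>
      first
        | exact absurd rfl hxy
        | (simp only [h1, h2, h3, h.off_zero_one, h.off_zero_two, h.off_one_two]
           exact div_nonneg (hpos _).le hd)

end HasResistances

/-- Every Laplacian on three points comes from a `Y`-shaped network. -/
theorem IsLaplacian.exists_resistances {V : Type} {H : Matrix V V ℝ} (hH : IsLaplacian H)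
    (e : Fin 3 ≃ V) : ∃ R, Admissible R ∧ HasResistances e H R := by
  have s1 := hH.symm.apply (e 0) (e 1)
  have s2 := hH.symm.apply (e 0) (e 2)
  have s3 := hH.symm.apply (e 1) (e 2)
  have n1 := hH.offdiag_nonneg (e 0) (e 1) (e.injective.ne (by decide))
  have n2 := hH.offdiag_nonneg (e 0) (e 2) (e.injective.ne (by decide))
  have n3 := hH.offdiag_nonneg (e 1) (e 2) (e.injective.ne (by decide))
  have hrow : ∀ x, H x (e 0) + H x (e 1) + H x (e 2) = 0 := fun x => by
    have := (hH.ker fun _ => 1).2 ⟨1, fun _ => rfl⟩ x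
    rw [HasResistances.finsum_eq e] at this
    linarith
  have r0 := hrow (e 0)
  have r1 := hrow (e 1)
  have r2 := hrow (e 2)
  obtain ⟨a, ha⟩ : ∃ a, a = H (e 0) (e 1) := ⟨_, rfl⟩
  obtain ⟨b, hb⟩ : ∃ b, b = H (e 0) (e 2) := ⟨_, rfl⟩
  obtain ⟨c, hc⟩ : ∃ c, c = H (e 1) (e 2) := ⟨_, rfl⟩
  rw [s1, ← ha] at r1
  rw [s2, s3, ← hb, ← hc] at r2
  rw [← ha, ← hb] at r0
  rw [← hc] at r1 n3
  rw [← ha] at n1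
  rw [← hb] at n2
  -- The indicator of an isolated terminal would be a nonconstant element of the kernel.
  have isolated : ∀ i j k : Fin 3, (∀ l, l = i ∨ l = j ∨ l = k) → i ≠ j → i ≠ k →
      H (e i) (e j) = 0 → H (e i) (e k) = 0 → H (e i) (e i) = 0 → False := by
    intro i j k hl hij hik hj hk hi
    have hcol : ∀ x, H x (e i) = 0 := fun x => by
      obtain ⟨l, rfl⟩ := e.surjective x
      rw [hH.symm.apply]
      rcases hl l with rfl | rfl | rfl <;> assumption
    obtain ⟨d, hd⟩ := (hH.ker (open Classical in fun x => if x = e i then 1 else 0)).1 fun x => by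
      rw [finsum_eq_zero_of_forall_eq_zero]
      intro y
      by_cases hy : y = e i
      · rw [hy, hcol, zero_mul]
      · rw [if_neg hy, mul_zero]
    have d1 := hd (e i)
    have d2 := hd (e j)
    rw [if_pos rfl] at d1
    rw [if_neg (e.injective.ne hij.symm)] at d2
    linarith
  -- If all pairwise products vanish, two conductances are zero, and the terminal common to these
  -- two edges is isolated.
  have hD : 0 < a * b + a * c + b * c := by
    have p1 := mul_nonneg n1 n2
    have p2 := mul_nonneg n1 n3
    have p3 := mul_nonneg n2 n3
    rcases (by positivity : 0 ≤ a * b + a * c + b * c).lt_or_eq with h | h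
    · exact h
    · exfalso
      have z1 : a * b = 0 := by linarith
      have z2 : a * c = 0 := by linarith
      have z3 : b * c = 0 := by linarith
      by_cases hza : a = 0
      · by_cases hzb : b = 0
        · exact isolated 0 1 2 (by decide) (by decide) (by decide) (by rw [← ha, hza])
            (by rw [← hb, hzb]) (by linarith)
        · have hzc := (mul_eq_zero.1 z3).resolve_left hzb
          exact isolated 1 0 2 (by decide) (by decide) (by decide) (by rw [s1, ← ha, hza])
            (by rw [← hc, hzc]) (by linarith)
      · have hzb := (mul_eq_zero.1 z1).resolve_left hza
        have hzc := (mul_eq_zero.1 z2).resolve_left hza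
        exact isolated 2 0 1 (by decide) (by decide) (by decide) (by rw [s2, ← hb, hzb])
          (by rw [s3, ← hc, hzc]) (by linarith)
  have hdisc : c / (a * b + a * c + b * c) * (b / (a * b + a * c + b * c)) +
      c / (a * b + a * c + b * c) * (a / (a * b + a * c + b * c)) +
      b / (a * b + a * c + b * c) * (a / (a * b + a * c + b * c)) = (a * b + a * c + b * c)⁻¹ := by
    have := hD.ne'
    generalize hd : a * b + a * c + b * c = d at this
    field_simp
    rw [← hd]
    ring
  have key : ∀ z : ℝ, z / (a * b + a * c + b * c) / (a * b + a * c + b * c)⁻¹ = z := fun z => by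
    rw [div_inv_eq_mul, div_mul_cancel₀ z hD.ne']
  -- Triangle-star transformation: the leg at a terminal is proportional to the conductance of the
  -- opposite edge.
  refine ⟨![c / (a * b + a * c + b * c), b / (a * b + a * c + b * c),
    a / (a * b + a * c + b * c)], ⟨?_, ?_⟩, hH.symm, ?_, ?_, ?_, ?_⟩
  · intro i
    rcases fin_three_cases i with rfl | rfl | rfl
    · exact div_nonneg n3 hD.le
    · exact div_nonneg n2 hD.le
    · exact div_nonneg n1 hD.le
  · exact hdisc ▸ inv_pos.2 hD
  · exact (ha.symm.trans (key a).symm).trans (congrArg _ hdisc.symm)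
  · exact (hb.symm.trans (key b).symm).trans (congrArg _ hdisc.symm)
  · exact (hc.symm.trans (key c).symm).trans (congrArg _ hdisc.symm)
  · intro x
    rw [Fin.sum_univ_three]; exact hrow x

/-- Multiplying numerator and denominator of the star conductance by the product of all three
resistances leaves the third resistance over the sum of pairwise products. -/
theorem starLaplacian_hasResistances {X : Type} {V : Set X} (e : Fin 3 ≃ V) {R : X → ℝ}
    (hR : ∀ i, 0 < R (e i)) :
    HasResistances e (starLaplacian V R) fun i => R (e i) := by
  have h0 := hR 0
  have h1 := hR 1
  have h2 := hR 2
  have hne : ∀ {i j : Fin 3}, i ≠ j → e i ≠ e j := fun h => e.injective.ne h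
  constructor
  · ext x y
    simp only [starLaplacian, Matrix.transpose_apply]
    by_cases hxy : x = y
    · subst hxy; rfl
    · rw [if_neg hxy, if_neg (Ne.symm hxy)]; ring
  · rw [starLaplacian, HasResistances.finsum_eq e, if_neg (hne (by decide))]
    field_simp
    ring
  · rw [starLaplacian, HasResistances.finsum_eq e, if_neg (hne (by decide))]
    field_simp
    ring
  · rw [starLaplacian, HasResistances.finsum_eq e, if_neg (hne (by decide))]
    field_simp
    ring
  · intro x
    obtain ⟨i, rfl⟩ := e.surjective x
    rw [Fin.sum_univ_three]
    simp only [starLaplacian, HasResistances.finsum_eq e, e.injective.eq_iff]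
    rcases fin_three_cases i with rfl | rfl | rfl <;> simp <;> field_simp <;> ring

/-! ### Minimization and the weak formulation -/

/-- A minimum at zero has no linear term. The test value -b / (|a| + 1) is small enough for the
linear term to dominate, and the 1 covers a = 0. -/
theorem eq_zero_of_forall_quadratic_nonneg {a b : ℝ} (h : ∀ t : ℝ, 0 ≤ 2 * t * b + t ^ 2 * a) :
    b = 0 := by
  by_contra hb
  have hA : 0 < |a| + 1 := by positivity
  have := h (-b / (|a| + 1))
  have e : 2 * (-b / (|a| + 1)) * b + (-b / (|a| + 1)) ^ 2 * a =
      (b ^ 2 * (a - 2 * (|a| + 1))) / (|a| + 1) ^ 2 := by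
    field_simp
    ring
  rw [e] at this
  have h2 : b ^ 2 * (a - 2 * (|a| + 1)) < 0 :=
    mul_neg_of_pos_of_neg (by positivity) (by linarith [le_abs_self a, abs_nonneg a])
  exact absurd this (not_le.2 (div_neg_of_neg_of_pos h2 (by positivity)))

/-- The energy `Q₀ v` is the minimum of `Q₁` over all extensions of `v` if and only if some extension
satisfies the Euler–Lagrange equations. -/
theorem isLeast_energy_iff {X : Type} {V : Set X} {Q₁ : (X → ℝ) → ℝ} {B₁ : (X → ℝ) → (X → ℝ) → ℝ}
    {Q₀ : (V → ℝ) → ℝ} {B₀ : (V → ℝ) → (V → ℝ) → ℝ}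
    (h₁ : ∀ u φ t, Q₁ (u + t • φ) = Q₁ u + 2 * t * B₁ u φ + t ^ 2 * Q₁ φ) (n₁ : ∀ φ, 0 ≤ Q₁ φ)
    (d₁ : ∀ u, B₁ u u = Q₁ u)
    (h₀ : ∀ u φ t, Q₀ (u + t • φ) = Q₀ u + 2 * t * B₀ u φ + t ^ 2 * Q₀ φ)
    (d₀ : ∀ u, B₀ u u = Q₀ u) (z₀ : ∀ u, B₀ u 0 = 0) :
    (∀ v : V → ℝ, IsLeast {t | ∃ u : X → ℝ, (∀ x : V, u x = v x) ∧ Q₁ u = t} (Q₀ v)) ↔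
      ∀ v : V → ℝ, ∃ u : X → ℝ, (∀ x : V, u x = v x) ∧
        ∀ φ : X → ℝ, B₁ u φ = B₀ v (fun x => φ x) := by
  constructor
  · intro h v
    obtain ⟨⟨u, huv, hu⟩, -⟩ := h v
    refine ⟨u, huv, fun φ => ?_⟩
    -- Vary data and extension together: Q₁(u + tφ) - Q₀(v + tφ) is nonnegative and vanishes at t =
    -- 0. Thus `φ` need not vanish on `V`.
    have key : B₁ u φ - B₀ v (fun x => φ x) = 0 := by
      refine eq_zero_of_forall_quadratic_nonneg (a := Q₁ φ - Q₀ fun x => φ x) fun t => ?_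
      have := (h (v + t • fun x : V => φ x)).2 ⟨u + t • φ, fun x => by simp [huv x], rfl⟩
      rw [h₁, h₀, hu] at this
      linarith
    linarith
  · intro h v
    obtain ⟨u, huv, hu⟩ := h v
    have huu : Q₁ u = Q₀ v := by
      rw [← d₁, hu, ← d₀]; congr 1; funext x; exact huv x
    refine ⟨⟨u, huv, huu⟩, ?_⟩
    rintro _ ⟨u', huv', rfl⟩
    have e : u' = u + (1 : ℝ) • (u' - u) := by simp
    -- Two extensions differ by a function vanishing on `V`, so the cross term is zero and only a
    -- nonnegative energy is added.
    have hz : B₁ u (u' - u) = 0 := by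
      rw [hu, ← z₀ v]; congr 1; funext x; simp [huv, huv']
    rw [e, h₁, hz, huu]
    have := n₁ (u' - u)
    linarith

theorem triForm_add_smul (R u φ : Fin 3 → ℝ) (t : ℝ) :
    triForm R (u + t • φ) (u + t • φ) =
      triForm R u u + 2 * t * triForm R u φ + t ^ 2 * triForm R φ φ := by
  simp only [triForm, Pi.add_apply, Pi.smul_apply, smul_eq_mul]
  ring

theorem triForm_zero_right (R u : Fin 3 → ℝ) : triForm R u 0 = 0 := by
  simp [triForm]

/-! ### The two networks of the gasket -/

/-- The network consisting of a copy of the first network, hanging from the second terminal of a copy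
of the second one, reduces to the first network exactly when the resistances satisfy the series
laws. -/
theorem series_network_iff {R R' : Fin 3 → ℝ} (hR : Admissible R) (hR' : Admissible R')
    {r t : ℝ} (hr : 0 < r) (ht : 0 < t) :
    (∀ v : Fin 3 → ℝ, ∃ x y : ℝ, ∀ (φ : Fin 3 → ℝ) (a b : ℝ),
      r⁻¹ * triForm R ![x, v 1, y] ![a, φ 1, b] + t⁻¹ * triForm R' ![v 0, x, v 2] ![φ 0, a, φ 2] =
        triForm R v φ) ↔
    R 0 = t * R' 0 ∧ R 2 = t * R' 2 ∧ R 1 = t * R' 1 + r * (R 0 + R 1) := by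
  constructor
  · intro h
    have key : ∀ j₀ j₂ : ℝ, R 0 * j₀ - R 2 * j₂ = t * (R' 0 * j₀ - R' 2 * j₂) ∧
        R 0 * j₀ + R 1 * (j₀ + j₂) =
          t * (R' 0 * j₀ + R' 1 * (j₀ + j₂)) + r * (R 0 + R 1) * (j₀ + j₂) := by
      intro j₀ j₂
      -- These terminal potentials put the centre of the star at zero and produce the prescribed
      -- currents `j₀`, `-j₀ - j₂`, `j₂`.
      obtain ⟨x, y, hxy⟩ := h ![R 0 * j₀, R 1 * (-j₀ - j₂), R 2 * j₂]
      obtain ⟨I, hI, hI1, -, hIφ⟩ :=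
        hR.exists_current hr ![x, R 1 * (-j₀ - j₂), y]
      obtain ⟨I', hI', hI'1, hI'2, hI'φ⟩ :=
        hR'.exists_current ht ![R 0 * j₀, x, R 2 * j₂]
      have hJ : ∀ φ : Fin 3 → ℝ, triForm R ![R 0 * j₀, R 1 * (-j₀ - j₂), R 2 * j₂] φ =
          φ 0 * j₀ + φ 1 * (-j₀ - j₂) + φ 2 * j₂ := by
        intro φ
        have := hR.triForm_eq one_pos (u := ![R 0 * j₀, R 1 * (-j₀ - j₂), R 2 * j₂])
          (J := ![j₀, -j₀ - j₂, j₂]) (by simp; ring) (by simp) (by simp) φ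
        simpa using this
      have hφ : ∀ f₀ f₁ f₂ a b : ℝ, (a * I 0 + f₁ * I 1 + b * I 2) +
          (f₀ * I' 0 + a * I' 1 + f₂ * I' 2) = f₀ * j₀ + f₁ * (-j₀ - j₂) + f₂ * j₂ := by
        intro f₀ f₁ f₂ a b
        have := hxy ![f₀, f₁, f₂] a b
        rw [hJ] at this
        exact (congrArg₂ (· + ·) (hIφ _) (hI'φ _)).symm.trans this
      -- Testing with the indicator of a node is Kirchhoff's law there.
      have e1 := hφ 1 0 0 0 0
      have e2 := hφ 0 1 0 0 0
      have e3 := hφ 0 0 1 0 0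
      have e4 := hφ 0 0 0 1 0
      have i0 : I' 0 = j₀ := by linarith
      have i2 : I' 2 = j₂ := by linarith
      have i1 : I 1 = -j₀ - j₂ := by linarith
      have i1' : I' 1 = -j₀ - j₂ := by linarith
      have i00 : I 0 = j₀ + j₂ := by linarith
      rw [i00, i1] at hI1
      rw [i0, i1'] at hI'1
      rw [i0, i2] at hI'2
      simp at hI1 hI'1 hI'2
      constructor
      · linarith
      · linarith
    have k1 := (key 1 0).1
    have k2 := (key 0 1).1
    have k3 := (key 0 1).2
    refine ⟨by linarith, by linarith, by linarith⟩
  · rintro ⟨h0, h2, h1⟩ v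
    obtain ⟨J, hJ, hJ1, hJ2, hJφ⟩ := hR.exists_current one_pos v
    -- The free terminal carries no current, so it has the potential of the centre of the hanging
    -- star.
    refine ⟨v 1 - r * (R 0 + R 1) * J 1, v 1 - r * R 1 * J 1, fun φ a b => ?_⟩
    rw [hR.triForm_eq hr (J := ![-J 1, J 1, 0]) (by simp) (by simp; ring) (by simp; ring),
      hR'.triForm_eq ht (J := J) hJ (by simp; linear_combination hJ1 - J 1 * h1 + J 0 * h0)
        (by simp; linear_combination hJ2 + J 0 * h0 - J 2 * h2)]
    have := hJφ φ
    rw [inv_one, one_mul] at this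
    rw [this]
    simp
    ring

/-- The ring-shaped network of three copies of the first and one copy of the second network reduces
to the second network exactly when the resistances satisfy the equations of the triangle-star
transformation. -/
theorem ring_network_iff {R R' : Fin 3 → ℝ} (hR : Admissible R) (hR' : Admissible R')
    {σ t : ℝ} (hσ : 0 < σ) (ht : 0 < t) (h0 : R 0 = t * R' 0) (h2 : R 2 = t * R' 2) :
    (∀ v : Fin 3 → ℝ, ∃ a b c d g : ℝ, ∀ (φ : Fin 3 → ℝ) (a' b' c' d' g' : ℝ),
      σ⁻¹ * triForm R ![v 0, a, b] ![φ 0, a', b'] + σ⁻¹ * triForm R ![c, g, v 2] ![c', g', φ 2] +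
        σ⁻¹ * triForm R ![b, d, c] ![b', d', c'] +
        (t * σ)⁻¹ * triForm R' ![a, v 1, d] ![a', φ 1, d'] = triForm R' v φ) ↔
    R 0 * (2 * (R 0 + R 1 + R 2)) =
      t * σ * (R 0 * (2 * (R 0 + R 1 + R 2)) + (R 0 + R 1) * (R 0 + R 2)) ∧
    t * R' 1 * (2 * (R 0 + R 1 + R 2)) =
      t * σ * (t * R' 1 * (2 * (R 0 + R 1 + R 2)) + (R 0 + R 1) * (R 1 + R 2)) ∧
    R 2 * (2 * (R 0 + R 1 + R 2)) =
      t * σ * ((R 2 + R 0) * (R 1 + R 2) + (R 0 + 2 * R 2) * (2 * (R 0 + R 1 + R 2))) := by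
  have htσ : 0 < t * σ := mul_pos ht hσ
  constructor
  · intro h
    -- The first identity is the voltage law around the ring, whose sides have total resistance 2(R₀
    -- + R₁ + R₂) in units of `σ`. The others compute two terminal voltages along paths through the
    -- network and through the reduced star, both multiplied by `t`.
    have key : ∀ j₀ j₁ : ℝ, ∃ x : ℝ,
        x * (2 * (R 0 + R 1 + R 2)) = (R 1 + R 2) * j₁ - (R 0 + R 2) * j₀ ∧
        R 0 * j₀ - t * R' 1 * j₁ = t * σ * (R 0 * j₀ - (R 0 + R 1) * x - t * R' 1 * j₁) ∧
        R 0 * j₀ + R 2 * (j₀ + j₁) = t * σ * (R 0 * j₀ + (R 2 + R 0) * (j₀ + x) +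
          (R 0 + 2 * R 2) * (j₀ + j₁)) := by
      intro j₀ j₁
      obtain ⟨a, b, c, d, g, hφ⟩ := h ![R' 0 * j₀, R' 1 * j₁, R' 2 * (-j₀ - j₁)]
      obtain ⟨I, hI, hI1, hI2, hIφ⟩ := hR.exists_current hσ ![R' 0 * j₀, a, b]
      obtain ⟨M, hM, -, hM2, hMφ⟩ := hR.exists_current hσ ![c, g, R' 2 * (-j₀ - j₁)]
      obtain ⟨N, hN, hN1, hN2, hNφ⟩ := hR.exists_current hσ ![b, d, c]
      obtain ⟨O, hO, hO1, hO2, hOφ⟩ := hR'.exists_current htσ ![a, R' 1 * j₁, d]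
      have hJ : ∀ φ : Fin 3 → ℝ, triForm R' ![R' 0 * j₀, R' 1 * j₁, R' 2 * (-j₀ - j₁)] φ =
          φ 0 * j₀ + φ 1 * j₁ + φ 2 * (-j₀ - j₁) := by
        intro φ
        have := hR'.triForm_eq one_pos (u := ![R' 0 * j₀, R' 1 * j₁, R' 2 * (-j₀ - j₁)])
          (J := ![j₀, j₁, -j₀ - j₁]) (by simp) (by simp) (by simp) φ
        simpa using this
      have hK : ∀ f₀ f₁ f₂ a' b' c' d' g' : ℝ, (f₀ * I 0 + a' * I 1 + b' * I 2) +
          (c' * M 0 + g' * M 1 + f₂ * M 2) + (b' * N 0 + d' * N 1 + c' * N 2) +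
          (a' * O 0 + f₁ * O 1 + d' * O 2) = f₀ * j₀ + f₁ * j₁ + f₂ * (-j₀ - j₁) := by
        intro f₀ f₁ f₂ a' b' c' d' g'
        have := hφ ![f₀, f₁, f₂] a' b' c' d' g'
        rw [hJ] at this
        exact (congrArg₂ (· + ·) (congrArg₂ (· + ·) (congrArg₂ (· + ·) (hIφ _) (hMφ _)) (hNφ _))
          (hOφ _)).symm.trans this
      have k0 := hK 1 0 0 0 0 0 0 0
      have k1 := hK 0 1 0 0 0 0 0 0
      have k2 := hK 0 0 1 0 0 0 0 0
      have ka := hK 0 0 0 1 0 0 0 0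
      have kb := hK 0 0 0 0 1 0 0 0
      have kc := hK 0 0 0 0 0 1 0 0
      have kd := hK 0 0 0 0 0 0 1 0
      have kg := hK 0 0 0 0 0 0 0 1
      -- The node laws determine all currents except the one circulating in the ring.
      obtain ⟨x, hx⟩ : ∃ x, I 1 = x := ⟨_, rfl⟩
      have i0 : I 0 = j₀ := by linarith
      have i2 : I 2 = -j₀ - x := by linarith
      have o1 : O 1 = j₁ := by linarith
      have o0 : O 0 = -x := by linarith
      have o2 : O 2 = x - j₁ := by linarith
      have m2 : M 2 = -j₀ - j₁ := by linarith
      have m0 : M 0 = j₀ + j₁ := by linarith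
      have n0 : N 0 = j₀ + x := by linarith
      have n1 : N 1 = j₁ - x := by linarith
      have n2 : N 2 = -j₀ - j₁ := by linarith
      rw [i0, hx] at hI1
      rw [i0, i2] at hI2
      rw [m0, m2] at hM2
      rw [n0, n1] at hN1
      rw [n0, n2] at hN2
      rw [o0, o1] at hO1
      rw [o0, o2] at hO2
      simp at hI1 hI2 hM2 hN1 hN2 hO1 hO2
      refine ⟨x, ?_, ?_, ?_⟩
      · refine mul_left_cancel₀ hσ.ne' ?_
        linear_combination hI1 + hO2 - hI2 - hN1 + σ * x * h0 + σ * (x - j₁) * h2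
      · linear_combination t * hI1 + t * hO1 + j₀ * h0 + t * σ * x * h0
      · linear_combination t * hI2 + t * hN2 + t * hM2 + j₀ * h0 + (j₀ + j₁) * h2
    obtain ⟨x, hx, k1, -⟩ := key 1 0
    obtain ⟨y, hy, k2, k3⟩ := key 0 1
    refine ⟨?_, ?_, ?_⟩
    · linear_combination (2 * (R 0 + R 1 + R 2)) * k1 - t * σ * (R 0 + R 1) * hx
    · linear_combination -(2 * (R 0 + R 1 + R 2)) * k2 + t * σ * (R 0 + R 1) * hy
    · linear_combination (2 * (R 0 + R 1 + R 2)) * k3 + t * σ * (R 0 + R 2) * hy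
  · rintro ⟨E1, E2, E3⟩ v
    obtain ⟨J, hJ, hJ1, hJ2, hJφ⟩ := hR'.exists_current one_pos v
    have hS : 0 < 2 * (R 0 + R 1 + R 2) := by
      have := hR.add_pos
      linarith [hR.nonneg 2]
    have hj2 : J 2 = -J 0 - J 1 := by linarith
    obtain ⟨x, hx⟩ : ∃ x, x * (2 * (R 0 + R 1 + R 2)) = (R 1 + R 2) * J 1 - (R 0 + R 2) * J 0 :=
      ⟨_, div_mul_cancel₀ _ hS.ne'⟩
    have hA : R 0 * J 0 - t * R' 1 * J 1 =
        t * σ * (R 0 * J 0 - (R 0 + R 1) * x - t * R' 1 * J 1) := by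
      refine mul_left_cancel₀ hS.ne' ?_
      linear_combination J 0 * E1 - J 1 * E2 + t * σ * (R 0 + R 1) * hx
    have hB : R 0 * J 0 + R 2 * (J 0 + J 1) = t * σ * (R 0 * J 0 + (R 2 + R 0) * (J 0 + x) +
          (R 0 + 2 * R 2) * (J 0 + J 1)) := by
      refine mul_left_cancel₀ hS.ne' ?_
      linear_combination J 0 * E1 + (J 0 + J 1) * E3 - t * σ * (R 0 + R 2) * hx
    -- The interior potentials follow from terminal 0 by subtracting voltage drops along the legs;
    -- the free node `g` has the potential of the centre of its star.
    refine ⟨v 0 - σ * (R 0 * J 0 - R 1 * x), v 0 - σ * (R 0 * J 0 + R 2 * (J 0 + x)),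
      v 0 - σ * (R 0 * J 0 + R 2 * (J 0 + x)) - σ * (R 0 * (J 0 + x) - R 2 * J 2),
      v 0 - σ * (R 0 * J 0 + R 2 * (J 0 + x)) - σ * (R 0 * (J 0 + x) - R 1 * (J 1 - x)),
      v 0 - σ * (R 0 * J 0 + R 2 * (J 0 + x)) - σ * (R 0 * (J 0 + x) - R 2 * J 2) +
        σ * R 0 * J 2, fun φ a' b' c' d' g' => ?_⟩
    rw [hR.triForm_eq hσ (J := ![J 0, x, -J 0 - x]) (by simp)
        (by simp only [Matrix.cons_val]; ring) (by simp only [Matrix.cons_val]; ring),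
      hR.triForm_eq hσ (J := ![-J 2, 0, J 2]) (by simp) (by simp; ring)
        (by
          simp
          refine mul_left_cancel₀ ht.ne' ?_
          rw [hj2] at hJ2 ⊢
          linear_combination t * hJ2 + hB - J 0 * h0 - (J 0 + J 1) * h2),
      hR.triForm_eq hσ (J := ![J 0 + x, J 1 - x, J 2]) (by simp; linarith) (by simp) (by simp),
      hR'.triForm_eq htσ (J := ![-x, J 1, x - J 1]) (by simp)
        (by
          simp
          refine mul_left_cancel₀ ht.ne' ?_
          linear_combination t * hJ1 + hA - J 0 * h0 - t * σ * x * h0)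
        (by
          simp
          linear_combination σ * hx - σ * x * h0 - σ * (x - J 1) * h2)]
    have := hJφ φ
    rw [inv_one, one_mul] at this
    rw [this]
    simp
    ring

/-- The solutions of the renormalization equations. -/
theorem renormalization_equations_iff {R R' : Fin 3 → ℝ} (hR : Admissible R) {r σ t : ℝ}
    (hσ : 0 < σ) (ht : 0 < t) :
    ((R 0 = t * R' 0 ∧ R 2 = t * R' 2 ∧ R 1 = t * R' 1 + r * (R 0 + R 1)) ∧
      R 0 * (2 * (R 0 + R 1 + R 2)) =
        t * σ * (R 0 * (2 * (R 0 + R 1 + R 2)) + (R 0 + R 1) * (R 0 + R 2)) ∧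
      t * R' 1 * (2 * (R 0 + R 1 + R 2)) =
        t * σ * (t * R' 1 * (2 * (R 0 + R 1 + R 2)) + (R 0 + R 1) * (R 1 + R 2)) ∧
      R 2 * (2 * (R 0 + R 1 + R 2)) =
        t * σ * ((R 2 + R 0) * (R 1 + R 2) + (R 0 + 2 * R 2) * (2 * (R 0 + R 1 + R 2)))) ↔
    ∃ a c : ℝ, 2 < a ∧ 0 < c ∧ R 0 = c ∧ R 1 = c * a ∧ R 2 = c * ((2 + 3 * a) / (a - 2)) ∧
      R' 0 = c * 1 / t ∧ R' 1 = c * (1 / (2 * a) + 1 / 4 + a / 4) / t ∧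
      R' 2 = c * ((2 + 3 * a) / (a - 2)) / t ∧ σ = (2 + a) / (4 + 3 * a) / t ∧
      r = (-2 - a + 3 * a ^ 2) / (4 * a + 4 * a ^ 2) := by
  constructor
  · rintro ⟨⟨h0, h2, h1⟩, E1, E2, E3⟩
    obtain ⟨s, hs⟩ : ∃ s, s = t * σ := ⟨_, rfl⟩
    have hs0 : 0 < s := hs ▸ mul_pos ht hσ
    rw [← hs] at E1 E2 E3
    have n0 := hR.nonneg 0
    have n1 := hR.nonneg 1
    have n2 := hR.nonneg 2
    obtain ⟨p01, p02, p12⟩ := hR.add_pos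
    have hS : 0 < 2 * (R 0 + R 1 + R 2) := by linarith
    have c0 : 0 < R 0 := by
      have : 0 < R 0 * (2 * (R 0 + R 1 + R 2)) := by rw [E1]; positivity
      exact pos_of_mul_pos_left this hS.le
    -- Eliminate `s` between the first and third equations; the common positive factors cancel.
    have hb : R 2 * (R 1 - 2 * R 0) = R 0 * (3 * R 1 + 2 * R 0) := by
      have hz : s * (2 * (R 0 + R 1 + R 2)) * (R 0 + R 2) *
          (R 2 * (R 1 - 2 * R 0) - R 0 * (3 * R 1 + 2 * R 0)) = 0 := by
        linear_combination (2 * (R 0 + R 1 + R 2)) * (R 0 * E3 - R 2 * E1)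
      have := (mul_eq_zero.1 hz).resolve_left (by positivity)
      linarith
    -- The right side of `hb` is positive and `R 2` is nonnegative: this is the origin of the bound
    -- 2 < a.
    have ha : 0 < R 1 - 2 * R 0 := by
      have : 0 < R 2 * (R 1 - 2 * R 0) := by rw [hb]; positivity
      exact pos_of_mul_pos_right this n2
    -- Likewise from the first and second equations.
    have he : t * R' 1 * (R 0 + R 2) = R 0 * (R 1 + R 2) := by
      have hz : s * (R 0 + R 1) * (2 * (R 0 + R 1 + R 2)) *
          (t * R' 1 * (R 0 + R 2) - R 0 * (R 1 + R 2)) = 0 := by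
        linear_combination (2 * (R 0 + R 1 + R 2)) * (R 0 * E2 - t * R' 1 * E1)
      have := (mul_eq_zero.1 hz).resolve_left (by positivity)
      linarith
    obtain ⟨c, hc⟩ : ∃ c, R 0 = c := ⟨_, rfl⟩
    obtain ⟨a, hca⟩ : ∃ a, R 1 = c * a := ⟨R 1 / c, by rw [mul_div_cancel₀]; rw [← hc]; exact c0.ne'⟩
    rw [hc] at c0
    have ha2 : 0 < a - 2 := by
      rw [hc, hca] at ha
      have : 0 < c * (a - 2) := by linarith
      exact pos_of_mul_pos_right this c0.le
    have hb' : R 2 = c * ((2 + 3 * a) / (a - 2)) := by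
      rw [hc, hca] at hb
      field_simp
      refine mul_left_cancel₀ c0.ne' ?_
      linear_combination hb
    have ha0 : 0 < a := by linarith
    have hbp : c + R 2 = c * (4 * a) / (a - 2) := by rw [hb']; field_simp; ring
    have hbq : c * a + R 2 = c * (a ^ 2 + a + 2) / (a - 2) := by rw [hb']; field_simp; ring
    have he' : t * R' 1 = c * (1 / (2 * a) + 1 / 4 + a / 4) := by
      rw [hc, hca, hbp, hbq] at he
      field_simp at he ⊢
      linear_combination 2 * he
    refine ⟨a, c, by linarith, c0, hc, hca, hb', ?_, ?_, ?_, ?_, ?_⟩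
    · rw [← hc, h0]; field_simp
    · rw [← he']; field_simp
    · rw [← hb', h2]; field_simp
    · have hsum : 2 * (R 0 + R 1 + R 2) = c * (2 * a * (a + 2)) / (a - 2) := by
        rw [hc, hca, hb']; field_simp; ring
      rw [hsum, hc, hca, hbp] at E1
      have : s = (2 + a) / (4 + 3 * a) := by
        field_simp at E1 ⊢
        linear_combination -E1 / 2
      rw [← this, hs]; field_simp
    · rw [he', hc, hca] at h1
      field_simp at h1 ⊢
      linear_combination -h1 / 2
  · rintro ⟨a, c, ha, hc, e0, e1, e2, e0', e1', e2', rfl, rfl⟩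
    have ha2 : 0 < a - 2 := by linarith
    have ha0 : 0 < a := by linarith
    rw [e0, e1, e2, e0', e1', e2']
    refine ⟨⟨?_, ?_, ?_⟩, ?_, ?_, ?_⟩ <;> field_simp <;> ring

/-! ### Renormalization as a system of linear equations -/

/-- Energies use functions on the whole plane but only see their values at the nodes; distinct nodes
can carry arbitrary values. -/
theorem exists_fun_eq {X : Type} {n : ℕ} {p : Fin n → X} (hp : Function.Injective p)
    (f : Fin n → ℝ) : ∃ u : X → ℝ, ∀ i, u (p i) = f i :=
  ⟨Function.extend p f 0, fun i => hp.extend_apply f 0 i⟩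

theorem exists_equiv_of_range_eq {X : Type} {V : Set X} {p : Fin 3 → X}
    (hp : Function.Injective p) (hV : Set.range p = V) :
    ∃ e : Fin 3 ≃ V, ∀ i, (e i : X) = p i :=
  ⟨(Equiv.ofInjective p hp).trans (Equiv.setCongr hV), fun _ => rfl⟩

/-- The renormalization property of an energy composed of three-terminal networks. -/
theorem isLeast_network_iff {X κ : Type} [Fintype κ] {V : Set X} {e : Fin 3 ≃ V}
    {H : Matrix V V ℝ} {R : Fin 3 → ℝ} (hH : HasResistances e H R) {c : κ → ℝ} (hc : ∀ k, 0 ≤ c k)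
    {S : κ → Fin 3 → ℝ} (hS : ∀ k, Admissible (S k)) {P : κ → Fin 3 → X} {Q : (X → ℝ) → ℝ}
    (hQ : ∀ u, Q u = ∑ k, c k * triForm (S k) (fun i => u (P k i)) (fun i => u (P k i))) :
    (∀ v : V → ℝ, IsLeast {t | ∃ u : X → ℝ, (∀ x : V, u x = v x) ∧ Q u = t}
      (discreteForm H v v)) ↔
    ∀ v : V → ℝ, ∃ u : X → ℝ, (∀ x : V, u x = v x) ∧ ∀ φ : X → ℝ,
      ∑ k, c k * triForm (S k) (fun i => u (P k i)) (fun i => φ (P k i)) =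
        triForm R (fun i => v (e i)) (fun i => φ (e i)) := by
  refine isLeast_energy_iff (Q₁ := Q) (Q₀ := fun v => discreteForm H v v)
    (B₁ := fun u φ => ∑ k, c k * triForm (S k) (fun i => u (P k i)) (fun i => φ (P k i)))
    (B₀ := fun u φ => triForm R (fun i => u (e i)) (fun i => φ (e i))) ?_ ?_ ?_ ?_ ?_ ?_
  · intro u φ t
    rw [hQ, hQ, hQ, Finset.mul_sum, Finset.mul_sum, ← Finset.sum_add_distrib,
      ← Finset.sum_add_distrib]
    refine Finset.sum_congr rfl fun k _ => ?_
    have : triForm (S k) (fun i => (u + t • φ) (P k i)) (fun i => (u + t • φ) (P k i)) = _ :=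
      triForm_add_smul (S k) (fun i => u (P k i)) (fun i => φ (P k i)) t
    rw [this]
    ring
  · intro φ
    rw [hQ]
    exact Finset.sum_nonneg fun k _ => mul_nonneg (hc k) ((hS k).triForm_nonneg _)
  · intro u
    rw [hQ]
  · intro u φ t
    simp only [hH.discreteForm_eq]
    exact triForm_add_smul R (fun i => u (e i)) (fun i => φ (e i)) t
  · intro u
    exact (hH.discreteForm_eq u u).symm
  · intro u
    exact triForm_zero_right R _

/-! ### The energies of the gasket as three-terminal networks -/

namespace OpenGasket

variable {T : Affine.Triangle ℝ Plane}

variable (T) in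
/-- The boundary points, in the order of the terminals of the networks. -/
noncomputable def terminals : Fin 2 → Fin 3 → Plane :=
  ![![q T 0, q T 1, q T 2], ![q T 0, q T 3, q T 2]]

theorem exists_terminal_equiv (hT : T.Equilateral) (s : Fin 2) :
    ∃ e : Fin 3 ≃ (graph T).boundary s, ∀ i, (e i : Plane) = terminals T s i := by
  have hq := q_injective T
  rcases fin_two_cases s with rfl | rfl
  · refine exists_equiv_of_range_eq (p := terminals T 0) ?_ ?_
    · have h : Function.Injective (![0, 1, 2] : Fin 3 → Fin 5) := by decide
      convert hq.comp h using 1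
      funext i
      rcases fin_three_cases i with rfl | rfl | rfl <;> rfl
    · rw [boundary_zero hT]
      ext x
      simp [terminals]
      tauto
  · refine exists_equiv_of_range_eq (p := terminals T 1) ?_ ?_
    · have h : Function.Injective (![0, 3, 2] : Fin 3 → Fin 5) := by decide
      convert hq.comp h using 1
      funext i
      rcases fin_three_cases i with rfl | rfl | rfl <;> rfl
    · rw [boundary_one hT]
      ext x
      simp [terminals]
      tauto

theorem form1_eq {D : (graph T).MatrixFamily} {e : ∀ s, Fin 3 ≃ (graph T).boundary s}
    (he : ∀ s i, (e s i : Plane) = terminals T s i) {R : Fin 2 → Fin 3 → ℝ}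
    (hD : ∀ s, HasResistances (e s) (D s) (R s)) (r : Fin 6 → ℝ) (s : Fin 2) (u : Plane → ℝ) :
    (graph T).form1 D r s u = ∑ k, (if (graph T).init k = s then (r k)⁻¹ else 0) *
      triForm (R ((graph T).fin k))
        (fun i => u ((graph T).sim k (terminals T ((graph T).fin k) i)))
        (fun i => u ((graph T).sim k (terminals T ((graph T).fin k) i))) := by
  rw [GraphDirected.form1, Finset.sum_filter]
  refine Finset.sum_congr rfl fun k _ => ?_
  by_cases hk : (graph T).init k = s
  · rw [if_pos hk, if_pos hk, GraphDirected.form0, (hD _).discreteForm_eq]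
    simp only [he, Function.comp_apply]
  · rw [if_neg hk, if_neg hk, zero_mul]

section Pieces

variable (u : Plane → ℝ)

theorem terminals_zero : (fun i => u ((graph T).sim 0 (terminals T 0 i))) =
    ![u (q T 3), u (q T 1), u (F T 1 (q T 2))] := by
  funext i
  rcases fin_three_cases i with rfl | rfl | rfl
  · exact congrArg u (F_one_q_zero T)
  · exact congrArg u (F_q T 1)
  · rfl

theorem terminals_one : (fun i => u ((graph T).sim 1 (terminals T 1 i))) =
    ![u (q T 0), u (q T 3), u (q T 2)] := by
  funext i
  rcases fin_three_cases i with rfl | rfl | rfl <;> rfl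

theorem terminals_two : (fun i => u ((graph T).sim 2 (terminals T 0 i))) =
    ![u (q T 0), u (F T 0 (q T 1)), u (F T 0 (q T 2))] := by
  funext i
  rcases fin_three_cases i with rfl | rfl | rfl
  · exact congrArg u (F_q T 0)
  · rfl
  · rfl

theorem terminals_three : (fun i => u ((graph T).sim 3 (terminals T 0 i))) =
    ![u (F T 4 (q T 2)), u (F T 2 (q T 1)), u (q T 2)] := by
  funext i
  rcases fin_three_cases i with rfl | rfl | rfl
  · exact congrArg u (F_four_q_two T).symm
  · rfl
  · exact congrArg u (F_q T 2)

theorem terminals_four : (fun i => u ((graph T).sim 4 (terminals T 0 i))) =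
    ![u (F T 0 (q T 2)), u (F T 3 (q T 2)), u (F T 4 (q T 2))] := by
  funext i
  rcases fin_three_cases i with rfl | rfl | rfl
  · exact congrArg u (F_zero_q_two T).symm
  · exact congrArg u (F_three_q_two T).symm
  · rfl

theorem terminals_five : (fun i => u ((graph T).sim 5 (terminals T 1 i))) =
    ![u (F T 0 (q T 1)), u (q T 3), u (F T 3 (q T 2))] := by
  funext i
  rcases fin_three_cases i with rfl | rfl | rfl
  · exact congrArg u (F_zero_q_one T).symm
  · exact congrArg u (F_q T 3)
  · rfl

end Pieces

theorem graph_fin_zero : (graph T).fin 0 = 0 := rfl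
theorem graph_fin_one : (graph T).fin 1 = 1 := rfl
theorem graph_fin_two : (graph T).fin 2 = 0 := rfl
theorem graph_fin_three : (graph T).fin 3 = 0 := rfl
theorem graph_fin_four : (graph T).fin 4 = 0 := rfl
theorem graph_fin_five : (graph T).fin 5 = 1 := rfl

theorem weakForm_zero (R : Fin 2 → Fin 3 → ℝ) (r : Fin 6 → ℝ) (u φ : Plane → ℝ) :
    ∑ k, (if (graph T).init k = 0 then (r k)⁻¹ else 0) *
      triForm (R ((graph T).fin k))
        (fun i => u ((graph T).sim k (terminals T ((graph T).fin k) i)))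
        (fun i => φ ((graph T).sim k (terminals T ((graph T).fin k) i))) =
    (r 0)⁻¹ * triForm (R 0) ![u (q T 3), u (q T 1), u (F T 1 (q T 2))]
        ![φ (q T 3), φ (q T 1), φ (F T 1 (q T 2))] +
      (r 1)⁻¹ * triForm (R 1) ![u (q T 0), u (q T 3), u (q T 2)]
        ![φ (q T 0), φ (q T 3), φ (q T 2)] := by
  rw [Fin.sum_univ_six]
  simp only [terminals_zero, terminals_one, graph_init_zero, graph_init_one, graph_init_two,
    graph_init_three, graph_init_four, graph_init_five, if_true, graph_fin_zero, graph_fin_one,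
    one_ne_zero, if_false, zero_mul, add_zero]

theorem weakForm_one (R : Fin 2 → Fin 3 → ℝ) (r : Fin 6 → ℝ) (u φ : Plane → ℝ) :
    ∑ k, (if (graph T).init k = 1 then (r k)⁻¹ else 0) *
      triForm (R ((graph T).fin k))
        (fun i => u ((graph T).sim k (terminals T ((graph T).fin k) i)))
        (fun i => φ ((graph T).sim k (terminals T ((graph T).fin k) i))) =
    (r 2)⁻¹ * triForm (R 0) ![u (q T 0), u (F T 0 (q T 1)), u (F T 0 (q T 2))]
        ![φ (q T 0), φ (F T 0 (q T 1)), φ (F T 0 (q T 2))] +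
      (r 3)⁻¹ * triForm (R 0) ![u (F T 4 (q T 2)), u (F T 2 (q T 1)), u (q T 2)]
        ![φ (F T 4 (q T 2)), φ (F T 2 (q T 1)), φ (q T 2)] +
      (r 4)⁻¹ * triForm (R 0) ![u (F T 0 (q T 2)), u (F T 3 (q T 2)), u (F T 4 (q T 2))]
        ![φ (F T 0 (q T 2)), φ (F T 3 (q T 2)), φ (F T 4 (q T 2))] +
      (r 5)⁻¹ * triForm (R 1) ![u (F T 0 (q T 1)), u (q T 3), u (F T 3 (q T 2))]
        ![φ (F T 0 (q T 1)), φ (q T 3), φ (F T 3 (q T 2))] := by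
  rw [Fin.sum_univ_six]
  simp only [terminals_two, terminals_three, terminals_four, terminals_five, graph_init_zero,
    graph_init_one, graph_init_two, graph_init_three, graph_init_four, graph_init_five, if_true,
    graph_fin_two, graph_fin_three, graph_fin_four, graph_fin_five, zero_ne_one, if_false,
    zero_mul, zero_add]

variable (T) in
/-- The vertices of the first network. -/
noncomputable def nodes₁ : Fin 5 → Plane :=
  ![q T 2, F T 1 (q T 2), q T 1, q T 3, q T 0]

variable (T) in
/-- The vertices of the second network. -/
noncomputable def nodes₂ : Fin 8 → Plane :=
  ![q T 2, F T 2 (q T 1), F T 4 (q T 2), F T 3 (q T 2), q T 3, F T 0 (q T 2), F T 0 (q T 1), q T 0]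

/-- The nodes are listed so that the functional 10b₀ + b₁ of the coordinates strictly increases. The
same holds for the second list. -/
theorem nodes₁_injective : Function.Injective (nodes₁ T) := by
  refine Function.Injective.of_comp (f := fun x => 10 * bary T 0 x + bary T 1 x)
    (StrictMono.injective (Fin.strictMono_iff_lt_succ.2 ?_))
  simp [Fin.forall_fin_succ, nodes₁, bary_F, bary_q]
  norm_num

theorem nodes₂_injective : Function.Injective (nodes₂ T) := by
  refine Function.Injective.of_comp (f := fun x => 10 * bary T 0 x + bary T 1 x)
    (StrictMono.injective (Fin.strictMono_iff_lt_succ.2 ?_))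
  simp [Fin.forall_fin_succ, nodes₂, bary_F, bary_q]
  norm_num

theorem eq_vec_three (f : Fin 3 → ℝ) : f = ![f 0, f 1, f 2] := by
  funext i
  rcases fin_three_cases i with rfl | rfl | rfl <;> rfl

section Renormalization

variable {D : (graph T).MatrixFamily} {e : ∀ s, Fin 3 ≃ (graph T).boundary s}
  {R : Fin 2 → Fin 3 → ℝ} {r : Fin 6 → ℝ}

/-- Moves the Euler–Lagrange equations from functions on the boundary sets to vectors indexed by
terminals, the language of the network lemmas. -/
theorem renormalization_iff_weak (he : ∀ s i, (e s i : Plane) = terminals T s i)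
    (hR : ∀ s, Admissible (R s)) (hD : ∀ s, HasResistances (e s) (D s) (R s))
    (hr : ∀ k, 0 < r k) (s : Fin 2) :
    (∀ v : (graph T).boundary s → ℝ,
      IsLeast {t | ∃ u : Plane → ℝ, (∀ x : (graph T).boundary s, u x = v x) ∧
        (graph T).form1 D r s u = t} (discreteForm (D s) v v)) ↔
    ∀ v : Fin 3 → ℝ, ∃ u : Plane → ℝ, (∀ i, u (terminals T s i) = v i) ∧ ∀ φ : Plane → ℝ,
      ∑ k, (if (graph T).init k = s then (r k)⁻¹ else 0) *
        triForm (R ((graph T).fin k))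
          (fun i => u ((graph T).sim k (terminals T ((graph T).fin k) i)))
          (fun i => φ ((graph T).sim k (terminals T ((graph T).fin k) i))) =
        triForm (R s) v (fun i => φ (terminals T s i)) := by
  rw [isLeast_network_iff (hD s) (c := fun k => if (graph T).init k = s then (r k)⁻¹ else 0)
    (S := fun k => R ((graph T).fin k))
    (P := fun k i => (graph T).sim k (terminals T ((graph T).fin k) i))
    (fun k => by
      split_ifs
      · exact (inv_pos.2 (hr k)).le
      · exact le_rfl) (fun k => hR _) (form1_eq he hD r s)]
  constructor
  · intro h v
    obtain ⟨u, hu, hφ⟩ := h fun x => v ((e s).symm x)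
    refine ⟨u, fun i => ?_, fun φ => ?_⟩
    · rw [← he, hu, Equiv.symm_apply_apply]
    · have := hφ φ
      simp only [he, Equiv.symm_apply_apply] at this
      exact this
  · intro h v
    obtain ⟨u, hu, hφ⟩ := h fun i => v (e s i)
    refine ⟨u, fun x => ?_, fun φ => ?_⟩
    · obtain ⟨i, rfl⟩ := (e s).surjective x
      rw [he, hu]
    · simp only [he]
      exact hφ φ

theorem renormalization_zero_iff (he : ∀ s i, (e s i : Plane) = terminals T s i)
    (hR : ∀ s, Admissible (R s)) (hD : ∀ s, HasResistances (e s) (D s) (R s))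
    (hr : ∀ k, 0 < r k) :
    (∀ v : (graph T).boundary 0 → ℝ,
      IsLeast {t | ∃ u : Plane → ℝ, (∀ x : (graph T).boundary 0, u x = v x) ∧
        (graph T).form1 D r 0 u = t} (discreteForm (D 0) v v)) ↔
    R 0 0 = r 1 * R 1 0 ∧ R 0 2 = r 1 * R 1 2 ∧
      R 0 1 = r 1 * R 1 1 + r 0 * (R 0 0 + R 0 1) := by
  rw [renormalization_iff_weak he hR hD hr, ← series_network_iff (hR 0) (hR 1) (hr 0) (hr 1)]
  simp only [weakForm_zero]
  constructor
  · intro h v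
    obtain ⟨u, hu, hφ⟩ := h v
    have h0 : u (q T 0) = v 0 := hu 0
    have h1 : u (q T 1) = v 1 := hu 1
    have h2 : u (q T 2) = v 2 := hu 2
    refine ⟨u (q T 3), u (F T 1 (q T 2)), fun φ a b => ?_⟩
    obtain ⟨f, hf⟩ := exists_fun_eq (nodes₁_injective (T := T)) ![φ 2, b, φ 1, a, φ 0]
    have f2 : f (q T 2) = φ 2 := hf 0
    have f4 : f (F T 1 (q T 2)) = b := hf 1
    have f1 : f (q T 1) = φ 1 := hf 2
    have f3 : f (q T 3) = a := hf 3
    have f0 : f (q T 0) = φ 0 := hf 4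
    have := hφ f
    rw [eq_vec_three fun i => f (terminals T 0 i)] at this
    change _ = triForm (R 0) v ![f (q T 0), f (q T 1), f (q T 2)] at this
    rw [f0, f1, f2, f3, f4, h0, h1, h2, ← eq_vec_three φ] at this
    exact this
  · intro h v
    obtain ⟨x, y, hxy⟩ := h v
    obtain ⟨u, hu⟩ := exists_fun_eq (nodes₁_injective (T := T)) ![v 2, y, v 1, x, v 0]
    have f2 : u (q T 2) = v 2 := hu 0
    have f4 : u (F T 1 (q T 2)) = y := hu 1
    have f1 : u (q T 1) = v 1 := hu 2
    have f3 : u (q T 3) = x := hu 3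
    have f0 : u (q T 0) = v 0 := hu 4
    refine ⟨u, fun i => ?_, fun φ => ?_⟩
    · rcases fin_three_cases i with rfl | rfl | rfl
      · exact f0
      · exact f1
      · exact f2
    · rw [f0, f1, f2, f3, f4]
      exact hxy (fun i => φ (terminals T 0 i)) (φ (q T 3)) (φ (F T 1 (q T 2)))

/-- Homogeneity gives the three copies of the first star a common factor `r 2` and the copy of the
second the factor `r 1 * r 2`, as the ring network requires. -/
theorem renormalization_one_iff (he : ∀ s i, (e s i : Plane) = terminals T s i)
    (hR : ∀ s, Admissible (R s)) (hD : ∀ s, HasResistances (e s) (D s) (R s))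
    (hr : ∀ k, 0 < r k) (h3 : r 3 = r 2) (h4 : r 4 = r 2) (h5 : r 5 = r 1 * r 2)
    (h0 : R 0 0 = r 1 * R 1 0) (h2 : R 0 2 = r 1 * R 1 2) :
    (∀ v : (graph T).boundary 1 → ℝ,
      IsLeast {t | ∃ u : Plane → ℝ, (∀ x : (graph T).boundary 1, u x = v x) ∧
        (graph T).form1 D r 1 u = t} (discreteForm (D 1) v v)) ↔
    R 0 0 * (2 * (R 0 0 + R 0 1 + R 0 2)) = r 1 * r 2 *
      (R 0 0 * (2 * (R 0 0 + R 0 1 + R 0 2)) + (R 0 0 + R 0 1) * (R 0 0 + R 0 2)) ∧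
    r 1 * R 1 1 * (2 * (R 0 0 + R 0 1 + R 0 2)) = r 1 * r 2 *
      (r 1 * R 1 1 * (2 * (R 0 0 + R 0 1 + R 0 2)) + (R 0 0 + R 0 1) * (R 0 1 + R 0 2)) ∧
    R 0 2 * (2 * (R 0 0 + R 0 1 + R 0 2)) = r 1 * r 2 *
      ((R 0 2 + R 0 0) * (R 0 1 + R 0 2) +
        (R 0 0 + 2 * R 0 2) * (2 * (R 0 0 + R 0 1 + R 0 2))) := by
  rw [renormalization_iff_weak he hR hD hr,
    ← ring_network_iff (hR 0) (hR 1) (hr 2) (hr 1) h0 h2]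
  simp only [weakForm_one, h3, h4, h5]
  constructor
  · intro h v
    obtain ⟨u, hu, hφ⟩ := h v
    have h0 : u (q T 0) = v 0 := hu 0
    have h1 : u (q T 3) = v 1 := hu 1
    have h2 : u (q T 2) = v 2 := hu 2
    refine ⟨u (F T 0 (q T 1)), u (F T 0 (q T 2)), u (F T 4 (q T 2)), u (F T 3 (q T 2)),
      u (F T 2 (q T 1)), fun φ a b c d g => ?_⟩
    obtain ⟨f, hf⟩ := exists_fun_eq (nodes₂_injective (T := T)) ![φ 2, g, c, d, φ 1, b, a, φ 0]
    have f2 : f (q T 2) = φ 2 := hf 0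
    have fg : f (F T 2 (q T 1)) = g := hf 1
    have fc : f (F T 4 (q T 2)) = c := hf 2
    have fd : f (F T 3 (q T 2)) = d := hf 3
    have f1 : f (q T 3) = φ 1 := hf 4
    have fb : f (F T 0 (q T 2)) = b := hf 5
    have fa : f (F T 0 (q T 1)) = a := hf 6
    have f0 : f (q T 0) = φ 0 := hf 7
    have := hφ f
    rw [eq_vec_three fun i => f (terminals T 1 i)] at this
    change _ = triForm (R 1) v ![f (q T 0), f (q T 3), f (q T 2)] at this
    rw [f0, f1, f2, fa, fb, fc, fd, fg, h0, h1, h2, ← eq_vec_three φ] at this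
    exact this
  · intro h v
    obtain ⟨a, b, c, d, g, hφ⟩ := h v
    obtain ⟨u, hu⟩ := exists_fun_eq (nodes₂_injective (T := T)) ![v 2, g, c, d, v 1, b, a, v 0]
    have f2 : u (q T 2) = v 2 := hu 0
    have fg : u (F T 2 (q T 1)) = g := hu 1
    have fc : u (F T 4 (q T 2)) = c := hu 2
    have fd : u (F T 3 (q T 2)) = d := hu 3
    have f1 : u (q T 3) = v 1 := hu 4
    have fb : u (F T 0 (q T 2)) = b := hu 5
    have fa : u (F T 0 (q T 1)) = a := hu 6
    have f0 : u (q T 0) = v 0 := hu 7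
    refine ⟨u, fun i => ?_, fun φ => ?_⟩
    · rcases fin_three_cases i with rfl | rfl | rfl
      · exact f0
      · exact f1
      · exact f2
    · rw [f0, f1, f2, fa, fb, fc, fd, fg]
      exact hφ (fun i => φ (terminals T 1 i)) (φ (F T 0 (q T 1))) (φ (F T 0 (q T 2)))
        (φ (F T 4 (q T 2))) (φ (F T 3 (q T 2))) (φ (F T 2 (q T 1)))

end Renormalization

/-! ### Factors along walks -/

/-- The contraction ratio of `ψ_w`. -/
noncomputable def walkRatio (w : List (Fin 6)) : ℝ :=
  (1 / 2) ^ w.count 0 * (1 / 3) ^ w.countP (2 ≤ ·)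

theorem walkSim_dist (w : List (Fin 6)) (x y : Plane) :
    dist ((graph T).walkSim w x) ((graph T).walkSim w y) = walkRatio w * dist x y := by
  induction w with
  | nil => simp [walkRatio, GraphDirected.walkSim_nil]
  | cons k w ih =>
    have hk : ∀ a b, dist ((graph T).sim k a) ((graph T).sim k b) =
        walkRatio [k] * dist a b := by
      intro a b
      rcases fin_six_cases k with rfl | rfl | rfl | rfl | rfl | rfl
      · exact (F_dist T 1 a b).trans (by simp [walkRatio])
      · simp [graph, walkRatio]
      · exact (F_dist T 0 a b).trans (by simp [walkRatio])
      · exact (F_dist T 2 a b).trans (by simp [walkRatio])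
      · exact (F_dist T 4 a b).trans (by simp [walkRatio])
      · exact (F_dist T 3 a b).trans (by simp [walkRatio])
    have hmul : walkRatio (k :: w) = walkRatio [k] * walkRatio w := by
      simp only [walkRatio]
      rw [← List.singleton_append, List.count_append, List.countP_append]
      ring
    rw [GraphDirected.walkSim_cons, DilationEquiv.coe_mul, Function.comp_apply,
      Function.comp_apply, hk, ih, hmul, mul_assoc]

theorem phi_isometry_iff (w w' : (nested T).Idx) :
    Isometry ((nested T).phi w w') ↔ walkRatio w.1 = walkRatio w'.1 := by
  have hphi : ∀ x, (nested T).phi w w' ((graph T).walkSim w.1 x) = (graph T).walkSim w'.1 x := by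
    intro x
    change ((graph T).walkSim w'.1 * ((graph T).walkSim w.1)⁻¹) ((graph T).walkSim w.1 x) = _
    rw [← Function.comp_apply (f := ((graph T).walkSim w'.1 * ((graph T).walkSim w.1)⁻¹ : _ ≃ᵈ _)),
      ← DilationEquiv.coe_mul, inv_mul_cancel_right]
  constructor
  · intro h
    have hd : 0 < dist (q T 0) (q T 1) := dist_pos.2 ((q_injective T).ne (by decide))
    have := h.dist_eq ((graph T).walkSim w.1 (q T 0)) ((graph T).walkSim w.1 (q T 1))
    rw [hphi, hphi, walkSim_dist, walkSim_dist] at this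
    exact (mul_right_cancel₀ hd.ne' this).symm
  · intro h
    refine Isometry.of_dist_eq fun x y => ?_
    obtain ⟨x, rfl⟩ := ((graph T).walkSim w.1).surjective x
    obtain ⟨y, rfl⟩ := ((graph T).walkSim w.1).surjective y
    rw [hphi, hphi, walkSim_dist, walkSim_dist, h]

/-- Unique factorization of 2ⁿ3ᵐ. -/
theorem walkRatio_eq_iff (w w' : List (Fin 6)) : walkRatio w = walkRatio w' ↔
    w.count 0 = w'.count 0 ∧ w.countP (2 ≤ ·) = w'.countP (2 ≤ ·) := by
  constructor
  · intro h
    have aux : ∀ n m n' m' : ℕ, 2 ^ n * 3 ^ m = 2 ^ n' * 3 ^ m' → n = n' ∧ m = m' := by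
      intro n m n' m' h
      have f2 : ∀ a b : ℕ, (2 ^ a * 3 ^ b).factorization 2 = a := fun a b => by
        rw [Nat.factorization_mul (by positivity) (by positivity), Nat.Prime.factorization_pow
          Nat.prime_two, Nat.Prime.factorization_pow Nat.prime_three]
        simp
      have f3 : ∀ a b : ℕ, (2 ^ a * 3 ^ b).factorization 3 = b := fun a b => by
        rw [Nat.factorization_mul (by positivity) (by positivity), Nat.Prime.factorization_pow
          Nat.prime_two, Nat.Prime.factorization_pow Nat.prime_three]
        simp
      exact ⟨by rw [← f2 n m, h, f2], by rw [← f3 n m, h, f3]⟩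
    refine aux _ _ _ _ ?_
    have h' := congrArg (·⁻¹) h
    simp only [walkRatio, mul_inv, ← inv_pow, one_div, inv_inv] at h'
    exact_mod_cast h'
  · rintro ⟨h1, h2⟩
    rw [walkRatio, walkRatio, h1, h2]

/-- A potential for the factors: `r_e` equals a homogeneous factor times `τ(f(e)) / τ(i(e))`. -/
theorem prod_walk {r : Fin 6 → ℝ} (h3 : r 3 = r 2) (h4 : r 4 = r 2) (h5 : r 5 = r 1 * r 2)
    {s : Fin 2} {w : List (Fin 6)} (hw : (graph T).IsWalk s w) :
    (w.map r).prod * (![1, r 1] : Fin 2 → ℝ) s =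
      r 0 ^ w.count 0 * (r 1 * r 2) ^ w.countP (2 ≤ ·) *
        (![1, r 1] : Fin 2 → ℝ) ((graph T).endState s w) := by
  induction w generalizing s with
  | nil => simp [GraphDirected.endState]
  | cons k w ih =>
    obtain ⟨rfl, hw⟩ := hw
    have ih := ih hw
    simp only [GraphDirected.endState]
    obtain ⟨z, hz⟩ : ∃ z, z = (![1, r 1] : Fin 2 → ℝ)
      ((graph T).endState ((graph T).fin k) w) := ⟨_, rfl⟩
    rw [← hz] at ih ⊢
    rcases fin_six_cases k with rfl | rfl | rfl | rfl | rfl | rfl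
    · simp [graph_fin_zero] at ih ⊢
      rw [pow_succ]
      linear_combination r 0 * ih
    · simp [graph_fin_one] at ih ⊢
      linear_combination ih
    · simp [graph_fin_two] at ih ⊢
      rw [pow_succ]
      linear_combination r 1 * r 2 * ih
    · simp [graph_fin_three] at ih ⊢
      rw [pow_succ, h3]
      linear_combination r 1 * r 2 * ih
    · simp [graph_fin_four] at ih ⊢
      rw [pow_succ, h4]
      linear_combination r 1 * r 2 * ih
    · simp [graph_fin_five] at ih ⊢
      rw [pow_succ, h5]
      linear_combination r 1 * r 2 * ih

/-- Short walks of equal type and size force the relations. Conversely `prod_walk` expresses the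
factor of a walk through its edge counts and final state, which type and size determine. -/
theorem isHomogeneous_iff (hT : T.Equilateral) {r : Fin 6 → ℝ} (hr : ∀ k, 0 < r k) :
    (graph T).IsHomogeneous r ↔ r 3 = r 2 ∧ r 4 = r 2 ∧ r 5 = r 1 * r 2 := by
  constructor
  · intro h
    have key : ∀ w w' : List (Fin 6), (graph T).IsWalk 0 w → (graph T).IsWalk 0 w' →
        (graph T).endState 0 w = (graph T).endState 0 w' → walkRatio w = walkRatio w' →
        (w.map r).prod = (w'.map r).prod := fun w w' hw hw' he hρ =>
      h ⟨w, hw⟩ ⟨w', hw'⟩ ((similar_iff hT _ _).2 he) ((phi_isometry_iff _ _).2 hρ)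
    have k3 := key [1, 3] [1, 2] ⟨rfl, rfl, trivial⟩ ⟨rfl, rfl, trivial⟩ rfl
      ((walkRatio_eq_iff _ _).2 (by decide))
    have k4 := key [1, 4] [1, 2] ⟨rfl, rfl, trivial⟩ ⟨rfl, rfl, trivial⟩ rfl
      ((walkRatio_eq_iff _ _).2 (by decide))
    -- Edge 1 carries the identity, so it changes the type but not the size; both walks end in state
    -- 1 with ratio 1/3.
    have k5 := key [1, 5] [1, 2, 1] ⟨rfl, rfl, trivial⟩ ⟨rfl, rfl, rfl, trivial⟩ rfl
      ((walkRatio_eq_iff _ _).2 (by decide))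
    simp [(hr 1).ne'] at k3 k4 k5
    exact ⟨k3, k4, by rw [k5, mul_comm]⟩
  · rintro ⟨h3, h4, h5⟩ w w' hs hi
    have hs := (similar_iff hT _ _).1 hs
    obtain ⟨hn, hm⟩ := (walkRatio_eq_iff _ _).1 ((phi_isometry_iff _ _).1 hi)
    have e1 := prod_walk h3 h4 h5 w.2
    have e2 := prod_walk h3 h4 h5 w'.2
    change _ * (1 : ℝ) = _ at e1 e2
    rw [mul_one] at e1 e2
    rw [e1, e2, hn, hm]
    exact congrArg _ (congrArg _ hs)

/-- Around a cycle the potential in `prod_walk` cancels. One exponent is positive because edge 1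
does not close up and must be followed by an edge leaving state 1. -/
theorem isRegular_of_lt_one {r : Fin 6 → ℝ} (hr : ∀ k, 0 < r k) (h3 : r 3 = r 2)
    (h4 : r 4 = r 2) (h5 : r 5 = r 1 * r 2) (h0 : r 0 < 1) (h12 : r 1 * r 2 < 1) :
    (graph T).IsRegular r := by
  intro s w hne hw hend
  have e := prod_walk h3 h4 h5 hw
  have hτ : (![1, r 1] : Fin 2 → ℝ) s ≠ 0 := by
    rcases fin_two_cases s with rfl | rfl
    · exact one_ne_zero
    · exact (hr 1).ne'
  rw [hend] at e
  rw [mul_right_cancel₀ hτ e]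
  have hp0 := (hr 0).le
  have hp12 : 0 ≤ r 1 * r 2 := (mul_pos (hr 1) (hr 2)).le
  have hcount : w.count 0 ≠ 0 ∨ w.countP (2 ≤ ·) ≠ 0 := by
    cases w with
    | nil => exact absurd rfl hne
    | cons k w =>
      obtain ⟨rfl, hw'⟩ := hw
      rcases fin_six_cases k with rfl | rfl | rfl | rfl | rfl | rfl
      · left; simp
      · right
        cases w with
        | nil => exact absurd hend (by simp [GraphDirected.endState, graph_fin_one])
        | cons k w =>
          obtain ⟨hk, -⟩ := hw'
          rcases fin_six_cases k with rfl | rfl | rfl | rfl | rfl | rfl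
          · simp [graph_fin_one] at hk
          · simp [graph_fin_one] at hk
          all_goals simp
      all_goals right; simp
  rcases hcount with h | h
  · exact mul_lt_one_of_nonneg_of_lt_one_left (pow_nonneg hp0 _) (pow_lt_one₀ hp0 h0 h)
      (pow_le_one₀ hp12 h12.le)
  · exact mul_lt_one_of_nonneg_of_lt_one_right (pow_le_one₀ hp0 h0.le) (pow_nonneg hp12 _)
      (pow_lt_one₀ hp12 h12 h)

end OpenGasket

/-! ### The explicit family and its parameters -/

namespace OpenGasket

variable {T : Affine.Triangle ℝ Plane}

theorem legs₁_terminals (x₁ x₂ x₃ : ℝ) (i : Fin 3) :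
    legs₁ T x₁ x₂ x₃ (terminals T 0 i) = (![x₁, x₂, x₃] : Fin 3 → ℝ) i := by
  have hq := q_injective T
  rcases fin_three_cases i with rfl | rfl | rfl
  · change legs₁ T x₁ x₂ x₃ (q T 0) = x₁
    rw [legs₁, if_pos rfl]
  · change legs₁ T x₁ x₂ x₃ (q T 1) = x₂
    rw [legs₁, if_neg (hq.ne (by decide)), if_pos rfl]
  · change legs₁ T x₁ x₂ x₃ (q T 2) = x₃
    rw [legs₁, if_neg (hq.ne (by decide)), if_neg (hq.ne (by decide))]

theorem legs₂_terminals (x₁ x₄ x₃ : ℝ) (i : Fin 3) :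
    legs₂ T x₁ x₄ x₃ (terminals T 1 i) = (![x₁, x₄, x₃] : Fin 3 → ℝ) i := by
  have hq := q_injective T
  rcases fin_three_cases i with rfl | rfl | rfl
  · change legs₂ T x₁ x₄ x₃ (q T 0) = x₁
    rw [legs₂, if_pos rfl]
  · change legs₂ T x₁ x₄ x₃ (q T 3) = x₄
    rw [legs₂, if_neg (hq.ne (by decide)), if_pos rfl]
  · change legs₂ T x₁ x₄ x₃ (q T 2) = x₃
    rw [legs₂, if_neg (hq.ne (by decide)), if_neg (hq.ne (by decide))]

theorem star₁_hasResistances {e : Fin 3 ≃ (graph T).boundary 0}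
    (he : ∀ i, (e i : Plane) = terminals T 0 i) {x₁ x₂ x₃ : ℝ} (h₁ : 0 < x₁) (h₂ : 0 < x₂)
    (h₃ : 0 < x₃) :
    HasResistances e (starLaplacian ((graph T).boundary 0) (legs₁ T x₁ x₂ x₃)) ![x₁, x₂, x₃] := by
  have heq : (fun i => legs₁ T x₁ x₂ x₃ (e i)) = ![x₁, x₂, x₃] :=
    funext fun i => by rw [he, legs₁_terminals]
  rw [← heq]
  refine starLaplacian_hasResistances e fun i => ?_
  rw [he, legs₁_terminals]
  rcases fin_three_cases i with rfl | rfl | rfl <;> assumption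

theorem star₂_hasResistances {e : Fin 3 ≃ (graph T).boundary 1}
    (he : ∀ i, (e i : Plane) = terminals T 1 i) {x₁ x₄ x₃ : ℝ} (h₁ : 0 < x₁) (h₄ : 0 < x₄)
    (h₃ : 0 < x₃) :
    HasResistances e (starLaplacian ((graph T).boundary 1) (legs₂ T x₁ x₄ x₃)) ![x₁, x₄, x₃] := by
  have heq : (fun i => legs₂ T x₁ x₄ x₃ (e i)) = ![x₁, x₄, x₃] :=
    funext fun i => by rw [he, legs₂_terminals]
  rw [← heq]
  refine starLaplacian_hasResistances e fun i => ?_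
  rw [he, legs₂_terminals]
  rcases fin_three_cases i with rfl | rfl | rfl <;> assumption

theorem vec_three_pos {x y z : ℝ} (hx : 0 < x) (hy : 0 < y) (hz : 0 < z) (i : Fin 3) :
    0 < (![x, y, z] : Fin 3 → ℝ) i := by
  rcases fin_three_cases i with rfl | rfl | rfl <;> assumption

/-- The resistances and factors of the solution are positive, and the renormalization factors of the
cycles are less than one. -/
theorem solution_bounds {a : ℝ} (ha : 2 < a) :
    0 < (2 + 3 * a) / (a - 2) ∧ 0 < 1 / (2 * a) + 1 / 4 + a / 4 ∧ 0 < (2 + a) / (4 + 3 * a) ∧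
      (2 + a) / (4 + 3 * a) < 1 ∧ 0 < (-2 - a + 3 * a ^ 2) / (4 * a + 4 * a ^ 2) ∧
      (-2 - a + 3 * a ^ 2) / (4 * a + 4 * a ^ 2) < 1 := by
  have h2 : 0 < a - 2 := by linarith
  have h0 : 0 < a := by linarith
  refine ⟨by positivity, by positivity, by positivity, ?_, ?_, ?_⟩
  · rw [div_lt_one (by positivity)]; linarith
  · refine div_pos ?_ (by positivity)
    nlinarith
  · rw [div_lt_one (by positivity)]; nlinarith

/-- The homogeneous regular harmonic structures are exactly the explicit ones. -/
theorem isHomogeneousRegular_iff (hT : T.Equilateral)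
    (h : (graph T).MatrixFamily × (Fin 6 → ℝ)) :
    IsHomogeneousRegular T h ↔ ∃ a c t : ℝ, 2 < a ∧ 0 < c ∧ 0 < t ∧ solution T a c t = h := by
  choose e he using exists_terminal_equiv hT
  constructor
  · obtain ⟨D, r⟩ := h
    rintro ⟨hharm, -, hhom⟩
    have hr : ∀ k, 0 < r k := hharm.pos
    obtain ⟨h3, h4, h5⟩ := (isHomogeneous_iff hT hr).1 hhom
    choose R hR hD using fun s => (hharm.laplacian s).exists_resistances (e s)
    have hz := (renormalization_zero_iff he hR hD hr).1 (hharm.renormalization 0)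
    have ho := (renormalization_one_iff he hR hD hr h3 h4 h5 hz.1 hz.2.1).1
      (hharm.renormalization 1)
    obtain ⟨a, c, ha, hc, e0, e1, e2, e0', e1', e2', hσ, hr0⟩ :=
      (renormalization_equations_iff (hR 0) (hr 2) (hr 1)).1 ⟨hz, ho⟩
    obtain ⟨hb, hE, hs, -, -, -⟩ := solution_bounds ha
    have ht := hr 1
    have ha0 : 0 < a := by linarith
    refine ⟨a, c, r 1, ha, hc, ht, Prod.ext (funext fun s => ?_) (funext fun k => ?_)⟩
    · rcases fin_two_cases s with rfl | rfl
      -- The formulas make all resistances positive, so a genuine star Laplacian has the same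
      -- resistances as `D 0`, and these determine the matrix.
      · have hstar := star₁_hasResistances (he 0) (x₁ := R 0 0) (x₂ := R 0 1) (x₃ := R 0 2)
          (by rw [e0]; positivity) (by rw [e1]; positivity) (by rw [e2]; positivity)
        rw [← eq_vec_three (R 0), e0, e1, e2] at hstar
        exact hstar.unique (hD 0)
      · have hstar := star₂_hasResistances (he 1) (x₁ := R 1 0) (x₄ := R 1 1) (x₃ := R 1 2)
          (by rw [e0']; positivity) (by rw [e1']; positivity) (by rw [e2']; positivity)
        rw [← eq_vec_three (R 1), e0', e1', e2'] at hstar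
        exact hstar.unique (hD 1)
    · rcases fin_six_cases k with rfl | rfl | rfl | rfl | rfl | rfl
      · exact hr0.symm
      · rfl
      · exact hσ.symm
      · exact hσ.symm.trans h3.symm
      · exact hσ.symm.trans h4.symm
      · refine Eq.trans ?_ h5.symm
        rw [hσ, mul_div_cancel₀ _ ht.ne']
        rfl
  · rintro ⟨a, c, t, ha, hc, ht, rfl⟩
    obtain ⟨hb, hE, hs, hs1, hr0, hr1⟩ := solution_bounds ha
    have ha0 : 0 < a := by linarith
    obtain ⟨R, hRdef⟩ : ∃ R : Fin 2 → Fin 3 → ℝ,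
      R = ![![c, c * a, c * ((2 + 3 * a) / (a - 2))],
        ![c * 1 / t, c * (1 / (2 * a) + 1 / 4 + a / 4) / t, c * ((2 + 3 * a) / (a - 2)) / t]] :=
      ⟨_, rfl⟩
    have hR0 : R 0 = ![c, c * a, c * ((2 + 3 * a) / (a - 2))] := by rw [hRdef]; rfl
    have hR1 : R 1 = ![c * 1 / t, c * (1 / (2 * a) + 1 / 4 + a / 4) / t,
      c * ((2 + 3 * a) / (a - 2)) / t] := by rw [hRdef]; rfl
    have hpos : ∀ s i, 0 < R s i := by
      intro s
      rcases fin_two_cases s with rfl | rfl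
      · rw [hR0]
        exact vec_three_pos hc (mul_pos hc ha0) (mul_pos hc hb)
      · rw [hR1]
        exact vec_three_pos (by positivity) (by positivity) (by positivity)
    have hR : ∀ s, Admissible (R s) := fun s => Admissible.of_pos (hpos s)
    have hD : ∀ s, HasResistances (e s) ((solution T a c t).1 s) (R s) := by
      intro s
      rcases fin_two_cases s with rfl | rfl
      · rw [hR0]
        exact star₁_hasResistances (he 0) hc (mul_pos hc ha0) (mul_pos hc hb)
      · rw [hR1]
        exact star₂_hasResistances (he 1) (by positivity) (by positivity) (by positivity)
    have hr : ∀ k, 0 < (solution T a c t).2 k := by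
      intro k
      rcases fin_six_cases k with rfl | rfl | rfl | rfl | rfl | rfl
      · exact hr0
      · exact ht
      · exact div_pos hs ht
      · exact div_pos hs ht
      · exact div_pos hs ht
      · exact hs
    have h3 : (solution T a c t).2 3 = (solution T a c t).2 2 := rfl
    have h4 : (solution T a c t).2 4 = (solution T a c t).2 2 := rfl
    have h12 : (solution T a c t).2 1 * (solution T a c t).2 2 = (2 + a) / (4 + 3 * a) :=
      mul_div_cancel₀ _ ht.ne'
    have h5 : (solution T a c t).2 5 = (solution T a c t).2 1 * (solution T a c t).2 2 := h12.symm
    obtain ⟨hz, ho⟩ := (renormalization_equations_iff (R := R 0) (R' := R 1)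
      (r := (solution T a c t).2 0) (hR 0) (hr 2) (hr 1)).2
      ⟨a, c, ha, hc, by rw [hR0]; rfl, by rw [hR0]; rfl, by rw [hR0]; rfl, by rw [hR1]; rfl,
        by rw [hR1]; rfl, by rw [hR1]; rfl, rfl, rfl⟩
    refine ⟨⟨fun s => (hD s).isLaplacian (hpos s), hr, fun s => ?_⟩,
      isRegular_of_lt_one hr h3 h4 h5 hr1 (h12 ▸ hs1), (isHomogeneous_iff hT hr).2 ⟨h3, h4, h5⟩⟩
    rcases fin_two_cases s with rfl | rfl
    · exact (renormalization_zero_iff he hR hD hr).2 hz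
    · exact (renormalization_one_iff he hR hD hr h3 h4 h5 hz.1 hz.2.1).2 ho

theorem star₁_injective (hT : T.Equilateral) {x₁ x₂ x₃ y₁ y₂ y₃ : ℝ} (hx₁ : 0 < x₁) (hx₂ : 0 < x₂)
    (hx₃ : 0 < x₃) (hy₁ : 0 < y₁) (hy₂ : 0 < y₂) (hy₃ : 0 < y₃)
    (h : starLaplacian ((graph T).boundary 0) (legs₁ T x₁ x₂ x₃) =
      starLaplacian ((graph T).boundary 0) (legs₁ T y₁ y₂ y₃)) : x₁ = y₁ := by
  obtain ⟨e, he⟩ := exists_terminal_equiv hT 0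
  have hx := star₁_hasResistances he hx₁ hx₂ hx₃
  rw [h] at hx
  exact congrFun (HasResistances.resistances_unique (Admissible.of_pos (vec_three_pos hx₁ hx₂ hx₃))
    (Admissible.of_pos (vec_three_pos hy₁ hy₂ hy₃)) hx (star₁_hasResistances he hy₁ hy₂ hy₃)) 0

/-- Factor 1 is `t`; factor 5 is `s`, free of `t` and an injective Möbius function of `a`; the
resistance at the first vertex is `c`. -/
theorem solution_injective (hT : T.Equilateral) {a c t a' c' t' : ℝ} (ha : 2 < a) (hc : 0 < c)
    (ha' : 2 < a') (hc' : 0 < c') (h : solution T a c t = solution T a' c' t') :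
    a = a' ∧ c = c' ∧ t = t' := by
  have ht : t = t' := congrFun (congrArg Prod.snd h) 1
  have hs : (2 + a) / (4 + 3 * a) = (2 + a') / (4 + 3 * a') := congrFun (congrArg Prod.snd h) 5
  have haa : a = a' := by
    rw [div_eq_div_iff (by linarith) (by linarith)] at hs
    linarith
  subst haa
  have hb := (solution_bounds ha).1
  have ha0 : 0 < a := by linarith
  exact ⟨rfl, star₁_injective hT hc (mul_pos hc ha0) (mul_pos hc hb) hc' (mul_pos hc' ha0)
    (mul_pos hc' hb) (congrFun (congrArg Prod.fst h) 0), ht⟩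

end OpenGasket

theorem theorem5p7 (T : Affine.Triangle ℝ Plane) (hT : T.Equilateral) :
    (OpenGasket.graph T).nested.IsFRFT ∧
    (OpenGasket.graph T).boundary 0 = {OpenGasket.q T 0, OpenGasket.q T 1, OpenGasket.q T 2} ∧
    (OpenGasket.graph T).boundary 1 = {OpenGasket.q T 0, OpenGasket.q T 2, OpenGasket.q T 3} ∧
    Set.BijOn (fun a : ℝ => OpenGasket.solution T a 1 1) (Set.Ioi 2)
      {h | OpenGasket.IsHomogeneousRegular T h ∧ OpenGasket.IsNormalized T h} ∧
    Set.BijOn (fun p : ℝ × ℝ × ℝ => OpenGasket.solution T p.1 p.2.1 p.2.2)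
      {p | 2 < p.1 ∧ 0 < p.2.1 ∧ 0 < p.2.2}
      {h | OpenGasket.IsHomogeneousRegular T h} := by
  refine ⟨OpenGasket.isFRFT hT, OpenGasket.boundary_zero hT, OpenGasket.boundary_one hT,
    ⟨?_, ?_, ?_⟩, ?_, ?_, ?_⟩
  · intro a ha
    have ha : 2 < a := ha
    have hb := (OpenGasket.solution_bounds ha).1
    refine ⟨(OpenGasket.isHomogeneousRegular_iff hT _).2 ⟨a, 1, 1, ha, one_pos, one_pos, rfl⟩, rfl,
      1 * a, 1 * ((2 + 3 * a) / (a - 2)), by linarith, by linarith, rfl⟩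
  · intro a ha a' ha' h
    exact (OpenGasket.solution_injective hT ha one_pos ha' one_pos h).1
  · rintro h ⟨hh, hr, x₂, x₃, hx₂, hx₃, hx⟩
    obtain ⟨a, c, t, ha, hc, ht, rfl⟩ := (OpenGasket.isHomogeneousRegular_iff hT h).1 hh
    obtain rfl : t = 1 := hr
    have hb := (OpenGasket.solution_bounds ha).1
    have ha0 : 0 < a := by linarith
    -- The normalization fixes only the leg at the first vertex, but equal star Laplacians have
    -- equal legs.
    obtain rfl : c = 1 := OpenGasket.star₁_injective hT hc (mul_pos hc ha0) (mul_pos hc hb)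
      one_pos hx₂ hx₃ hx
    exact ⟨a, ha, rfl⟩
  · rintro ⟨a, c, t⟩ ⟨ha, hc, ht⟩
    exact (OpenGasket.isHomogeneousRegular_iff hT _).2 ⟨a, c, t, ha, hc, ht, rfl⟩
  · rintro ⟨a, c, t⟩ ⟨ha, hc, ht⟩ ⟨a', c', t'⟩ ⟨ha', hc', ht'⟩ h
    obtain ⟨rfl, rfl, rfl⟩ := OpenGasket.solution_injective hT ha hc ha' hc' h
    rfl
  · intro h hh
    obtain ⟨a, c, t, ha, hc, ht, rfl⟩ := (OpenGasket.isHomogeneousRegular_iff hT h).1 hh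
    exact ⟨(a, c, t), ⟨ha, hc, ht⟩, rfl⟩
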